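/- **Theorem.** Let $U$ be a compact Lie group with Lie algebra $\mathfrak u$ and an $\mathrm{Ad}$-invariant inner product $\langle\,,\rangle$, let $\mathcal T\subset\mathfrak u$ be a maximal abelian subalgebra with orthonormal basis $a_1,\dots,a_k$ ($k\ge1$), and suppose that $a=a_1$ is regular, i.e. that its Adjoint orbit $M_a\subset\mathfrak u$ is a principal orbit. Write $gbg^{-1}=\mathrm{Ad}(g)b$, $\mathfrak u_a=\{X:[X,a]=0\}$, and $\pi_0,\pi_1$ for the orthogonal projections onto $\mathfrak u_a$ and $\mathfrak u_a^\perp$. Let $\mathcal S(\mathbb R,V)$ be the space of rapidly decreasing smooth maps. *Curves and development map.* $C_a(\mathbb R,M_a)$ is the space of smooth curves $\gamma:\mathbb R\to M_a$ with $\lim_{x\to-\infty}\gamma=a$ and $\gamma_x\in\mathcal S(\mathbb R,\mathfrak u)$; its tangent space $T_\gamma$ consists of the smooth fields $\xi$ along $\gamma$ tangent to $M_a$ with $\xi_x\in\mathcal S(\mathbb R,\mathfrak u)$ and $\lim_{x\to-\infty}\xi=0$. The development map $\Phi:C_a(\mathbb R,M_a)\to\mathcal S(\mathbb R,\mathfrak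 u_a^\perp)$ is $\Phi(\gamma)=g^{-1}g_x$, where $g:\mathbb R\to U$ is the unique smooth map with $\gamma=gag^{-1}$, $\lim_{x\to-\infty}g=e$ and $g^{-1}g_x\in\mathcal S(\mathbb R,\mathfrak u_a^\perp)$. *Operators.* $J_a(v)=[v,a]$; $P_u(v)=v_x+\pi_1[u,v]+[u,h]$ with $h(x)=-\int_{-\infty}^x\pi_0[u,v]\,ds$; and $(J_3)_u=(P_uJ_a^{-1})^3J_a$. Let $B_\gamma$ relate the $L^2$ metric on $T_\gamma$ to the pull-back under $\Phi$ of the $L^2$ metric: $\int\langle d\Phi_\gamma\beta,d\Phi_\gamma\eta\rangle\,dx=\int\langle B_\gamma\beta,\eta\rangle\,dx$ for all $\eta\in T_\gamma$. The operator $\Lambda=\Phi^*(J_3)$ is given by $$\Lambda_\gamma=d\Phi_\gamma^{-1}\circ (J_3)_{\Phi(\gamma)}\circ d\Phi_\gamma\circ B_\gamma^{-1}$$ on the fields $\xi=B_\gamma\beta$, $\beta\in T_\gamma$, for which $w=d\Phi_\gamma\beta$ is in the domain of skew-adjointness of $P_u$, $u=\Phi(\gamma)$ (that is, $\int\langle P_uw,m\rangle\,dx=-\int\langle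 w,P_um\rangle\,dx$ for all $m\in\mathcal S(\mathbb R,\mathfrak u_a^\perp)$); it is extended to a map $\Lambda_\gamma:T_\gamma\to T_\gamma$ for every $\gamma\in C_a(\mathbb R,M_a)$ by requiring that $\Lambda_\gamma(\xi)(x)$ depend only on the restrictions of $\gamma$ and $\xi$ to $(-\infty,x]$. *Geometry.* Regard $M_a$ as a submanifold of the Euclidean space $\mathfrak u$, with Levi-Civita connection $\nabla$, second fundamental form $\mathrm{II}$ and shape operators $A_\nu$. For $1\le i\le k$ put $\hat a_i(gag^{-1})=ga_ig^{-1}$. *Conclusion.* The $\hat a_i$ are well defined and form a parallel orthonormal frame of the normal bundle of $M_a$. The operator $\Lambda=\Phi^*(J_3)$ exists and is unique, and for all $\gamma\in C_a(\mathbb R,M_a)$ and $\xi\in T_\gamma$ $$\Lambda_\gamma(\xi)=\nabla_{\gamma_x}\xi-\sum_{i=1}^k h_i\,A_{\hat a_i(\gamma)}(\gamma_x),\qquad h_i(x)=-\int_{-\infty}^x\langle \mathrm{II}(\xi(s),\gamma_x(s)),\hat a_i(\gamma(s))\rangle\,ds,$$ the integrals being absolutely convergent. Hence $\Lambda$ coincides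 with Ferapontov's Dirac-reduced operator: for every parallel orthonormal normal frame field $(e_\alpha)$ of $M_a$, $$\Lambda_\gamma(\xi)=\nabla_{\gamma_x}\xi+\sum_\alpha\Big(\int_{-\infty}^x\langle \mathrm{II}(\xi,\gamma_x),e_\alpha(\gamma)\rangle\,ds\Big)A_{e_\alpha(\gamma)}(\gamma_x),$$ and $\Lambda_\gamma(\xi)=(\xi+\eta)_x$, where $\eta$ is the unique smooth field along $\gamma$ that is normal to $M_a$, tends to $0$ at $-\infty$, and makes $(\xi+\eta)_x$ tangent to $M_a$. -/

import Mathlib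

open Set Filter Topology MeasureTheory
open scoped Manifold ContDiff SchwartzMap InnerProductSpace

noncomputable section

namespace AdjointCurves

/-! Throughout, `U` is a Lie group modelled on the Euclidean space `E`.  As a vector space, its Lie
algebra `GroupLieAlgebra 𝓘(ℝ, E) U` (the tangent space at `1`) *is* `E`, so the Lie algebra is written
`E`; the inner product of `E` plays the role of the invariant inner product on the Lie algebra (any
inner product on the Lie algebra can be taken as the inner product of the model space). -/

section Algebra

variable {E : Type*} [NormedAddCommGroup E] [InnerProductSpace ℝ E]
variable (U : Type*) [TopologicalSpace U] [ChartedSpace E U] [Group U]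

/-- The Lie bracket `[X, Y]` of the Lie algebra of `U`. -/
def brk (X Y : E) : E :=
  @Bracket.bracket (GroupLieAlgebra 𝓘(ℝ, E) U) (GroupLieAlgebra 𝓘(ℝ, E) U) _ X Y

/-- The Adjoint action `Ad g`, written `X ↦ g X g⁻¹` for matrix groups: the derivative at `1` of
the conjugation by `g`. -/
def Ad (g : U) : E →L[ℝ] E :=
  mfderiv 𝓘(ℝ, E) 𝓘(ℝ, E) (fun h : U => g * h * g⁻¹) 1

/-- The Adjoint orbit `M_a` through `a`. -/
def adOrbit (a : E) : Set E := Set.range fun g : U => Ad U g a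

/-- `a` is regular: its orbit is a principal orbit of the Adjoint action, that is, the isotropy group
of `a` is conjugate to a subgroup of every other isotropy group. -/
def IsRegular (a : E) : Prop :=
  ∀ b : E, ∃ g : U, ∀ s : U, Ad U s a = a → Ad U (g * s * g⁻¹) b = b

/-- A maximal abelian subalgebra (a linear subspace on which the bracket vanishes is automatically
a subalgebra). -/
def IsMaximalAbelian (T : Submodule ℝ E) : Prop :=
  Maximal (fun S : Submodule ℝ E => ∀ X ∈ S, ∀ Y ∈ S, brk U X Y = 0) T

variable [FiniteDimensional ℝ E] [LieGroup 𝓘(ℝ, E) ∞ U]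

theorem brk_add_left (X Y Z : E) : brk U (X + Y) Z = brk U X Z + brk U Y Z := by
  have := FiniteDimensional.complete ℝ E
  have : LieGroup 𝓘(ℝ, E) (minSmoothness ℝ 3) U := by
    rw [minSmoothness_of_isRCLikeNormedField]; infer_instance
  exact add_lie (L := GroupLieAlgebra 𝓘(ℝ, E) U) (M := GroupLieAlgebra 𝓘(ℝ, E) U) X Y Z

theorem brk_smul_left (c : ℝ) (X Z : E) : brk U (c • X) Z = c • brk U X Z := by
  have := FiniteDimensional.complete ℝ E
  have : LieGroup 𝓘(ℝ, E) (minSmoothness ℝ 3) U := by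
    rw [minSmoothness_of_isRCLikeNormedField]; infer_instance
  exact smul_lie (L := GroupLieAlgebra 𝓘(ℝ, E) U) (M := GroupLieAlgebra 𝓘(ℝ, E) U) c X Z

/-- `X ↦ [X, p]` as a linear map. -/
def adRight (p : E) : E →ₗ[ℝ] E where
  toFun X := brk U X p
  map_add' X Y := brk_add_left U X Y p
  map_smul' c X := brk_smul_left U c X p

/-- The isotropy subalgebra `𝔲_a = {X | [X, a] = 0}`. -/
def isotropy (a : E) : Submodule ℝ E := LinearMap.ker (adRight U a)

/-- The tangent space at `p` of the Adjoint orbit through `p`: the image of the Lie algebra under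
the infinitesimal action. -/
def orbitTangent (p : E) : Submodule ℝ E := LinearMap.range (adRight U p)

/-- Orthogonal projection onto `𝔲_a`. -/
def projZero (a X : E) : E := (isotropy U a).starProjection X

/-- Orthogonal projection onto the orthogonal complement of `𝔲_a`. -/
def projOne (a X : E) : E := (isotropy U a)ᗮ.starProjection X

/-- Orthogonal projection onto the tangent space of the orbit at `p`. -/
def tanProj (p X : E) : E := (orbitTangent U p).starProjection X

/-- Orthogonal projection onto the normal space of the orbit at `p`. -/
def norProj (p X : E) : E := (orbitTangent U p)ᗮ.starProjection X

end Algebra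

section Geometry

variable {E : Type*} [NormedAddCommGroup E] [InnerProductSpace ℝ E] [FiniteDimensional ℝ E]
variable (U : Type*) [TopologicalSpace U] [ChartedSpace E U] [Group U] [LieGroup 𝓘(ℝ, E) ∞ U]

/-- Smooth curves `c : ℝ → M_a`. -/
structure IsOrbitCurve (a : E) (c : ℝ → E) : Prop where
  smooth : ContDiff ℝ ∞ c
  mem : ∀ s, c s ∈ adOrbit U a
  tangent : ∀ s, deriv c s ∈ orbitTangent U (c s)

/-- `n` is the normal component at `p` of the derivative in direction `X` of a field tangent to the
orbit with value `Y` at `p`. -/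
def IsSecondFF (p X Y n : E) : Prop :=
  ∃ c Z : ℝ → E, IsOrbitCurve U p c ∧ c 0 = p ∧ deriv c 0 = X ∧
    ContDiff ℝ ∞ Z ∧ (∀ s, Z s ∈ orbitTangent U (c s)) ∧ Z 0 = Y ∧
    n = norProj U p (deriv Z 0)

open Classical in
/-- The second fundamental form `II(X, Y)` at `p` of the orbit through `p`, as a submanifold of the
Euclidean space `E`. -/
def secondFF (p X Y : E) : E :=
  if h : ∃ n, IsSecondFF U p X Y n then h.choose else 0

/-- `w` is minus the tangential component at `p` of the derivative in direction `X` of a normal field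
with value `v` at `p`. -/
def IsShape (p v X w : E) : Prop :=
  ∃ c ν : ℝ → E, IsOrbitCurve U p c ∧ c 0 = p ∧ deriv c 0 = X ∧
    ContDiff ℝ ∞ ν ∧ (∀ s, ν s ∈ (orbitTangent U (c s))ᗮ) ∧ ν 0 = v ∧
    w = -tanProj U p (deriv ν 0)

open Classical in
/-- The shape operator `A_v(X)` at `p` of the orbit through `p`. -/
def shapeOp (p v X : E) : E :=
  if h : ∃ w, IsShape U p v X w then h.choose else 0

/-- `∇_{γ_x} ξ`: Levi-Civita covariant derivative, for the induced metric of the orbit, of a tangent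
field `ξ` along the curve `γ`. -/
def covDeriv (γ ξ : ℝ → E) (x : ℝ) : E := tanProj U (γ x) (deriv ξ x)

open Classical in
/-- The field `b̂` on `M_a`, `b̂(Ad g a) = Ad g b`. -/
def hatField (a b p : E) : E :=
  if h : ∃ g : U, Ad U g a = p then Ad U h.choose b else 0

/-- `ν` is a parallel normal field on `M_a`: it is normal, smooth, and its derivative along every
curve of `M_a` is tangential, i.e. its normal covariant derivative vanishes. -/
structure IsParallelNormal (a : E) (ν : E → E) : Prop where
  normal : ∀ p ∈ adOrbit U a, ν p ∈ (orbitTangent U p)ᗮ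
  smooth : ∀ c, IsOrbitCurve U a c → ContDiff ℝ ∞ fun s => ν (c s)
  parallel : ∀ c, IsOrbitCurve U a c → ∀ s, deriv (fun r => ν (c r)) s ∈ orbitTangent U (c s)

/-- A parallel orthonormal normal frame field on `M_a`. -/
structure IsParallelNormalFrame (a : E) {m : ℕ} (e : Fin m → E → E) : Prop where
  parallel : ∀ i, IsParallelNormal U a (e i)
  orthonormal : ∀ p ∈ adOrbit U a, Orthonormal ℝ fun i => e i p
  span : ∀ p ∈ adOrbit U a, Submodule.span ℝ (Set.range fun i => e i p) = (orbitTangent U p)ᗮ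

/-- `f` is smooth and rapidly decreasing. -/
def RapidDecay (f : ℝ → E) : Prop := ∃ φ : 𝓢(ℝ, E), ∀ x, φ x = f x

/-- The curve space `C_a(ℝ, M_a)`. -/
structure IsCurve (a : E) (γ : ℝ → E) : Prop where
  orbit : IsOrbitCurve U a γ
  tendsto : Tendsto γ atBot (𝓝 a)
  decay : RapidDecay (deriv γ)

/-- The tangent space of `C_a(ℝ, M_a)` at `γ`. -/
structure IsTangentField (γ ξ : ℝ → E) : Prop where
  smooth : ContDiff ℝ ∞ ξ
  tangent : ∀ x, ξ x ∈ orbitTangent U (γ x)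
  decay : RapidDecay (deriv ξ)
  tendsto : Tendsto ξ atBot (𝓝 0)

/-- Ferapontov's operator `Z_γ`, for a parallel orthonormal normal frame field `e` on `M_a`. -/
def ferapontov {m : ℕ} (e : Fin m → E → E) (γ ξ : ℝ → E) (x : ℝ) : E :=
  covDeriv U γ ξ x +
    ∑ i, (∫ s in Iic x, ⟪secondFF U (γ s) (ξ s) (deriv γ s), e i (γ s)⟫_ℝ) •
      shapeOp U (γ x) (e i (γ x)) (deriv γ x)

/-- `η` is the normal correction used in the Dirac reduction of the Poisson operator `d/dx` from curves
in `E` to curves in `M_a`: the field `ξ` is corrected by a field `η` normal to `M_a` in such a way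
that `d/dx (ξ + η)` is tangent to `M_a`; the reduced operator is `ξ ↦ d/dx (ξ + η)`. -/
structure IsDiracCorrection (γ ξ η : ℝ → E) : Prop where
  smooth : ContDiff ℝ ∞ η
  normal : ∀ x, η x ∈ (orbitTangent U (γ x))ᗮ
  tendsto : Tendsto η atBot (𝓝 0)
  tangent : ∀ x, deriv (fun s => ξ s + η s) x ∈ orbitTangent U (γ x)

end Geometry

section Poisson

variable {E : Type*} [NormedAddCommGroup E] [InnerProductSpace ℝ E] [FiniteDimensional ℝ E]
variable (U : Type*) [TopologicalSpace U] [ChartedSpace E U] [Group U] [LieGroup 𝓘(ℝ, E) ∞ U]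

/-- The space `𝓢(ℝ, 𝔲_a^⊥)`. -/
def IsPotential (a : E) (u : ℝ → E) : Prop :=
  RapidDecay u ∧ ∀ x, u x ∈ (isotropy U a)ᗮ

/-- The operator `J_a(v) = [v, a]`. -/
def Ja (a : E) (v : ℝ → E) : ℝ → E := fun x => brk U (v x) a

open Classical in
/-- The inverse of `J_a` on functions with values in the orthogonal complement of `𝔲_a`. -/
def JaInv (a : E) (v : ℝ → E) : ℝ → E := fun x =>
  if h : ∃ w ∈ (isotropy U a)ᗮ, brk U w a = v x then h.choose else 0

/-- `P_u(v) = v_x + π₁[u, v] + [u, h]`, `h(x) = -∫_{-∞}^x π₀[u, v]`. -/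
def Pu (a : E) (u v : ℝ → E) : ℝ → E := fun x =>
  deriv v x + projOne U a (brk U (u x) (v x)) +
    brk U (u x) (-∫ s in Iic x, projZero U a (brk U (u s) (v s)))

/-- `(J_k)_u = (P_u J_a⁻¹)^k J_a`. -/
def Jk (k : ℕ) (a : E) (u w : ℝ → E) : ℝ → E :=
  (fun v => Pu U a u (JaInv U a v))^[k] (Ja U a w)

/-- `u = g⁻¹ g_x`, where `g : ℝ → U` is the frame with `γ = g a g⁻¹`, `g → 1` at `-∞` and `g⁻¹ g_x` in
`𝓢(ℝ, 𝔲_a^⊥)`. -/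
def IsDevelopment (a : E) (γ u : ℝ → E) : Prop :=
  IsPotential U a u ∧ ∃ g : ℝ → U, ContMDiff 𝓘(ℝ, ℝ) 𝓘(ℝ, E) ∞ g ∧
    (∀ x, γ x = Ad U (g x) a) ∧ Tendsto g atBot (𝓝 1) ∧
    ∀ x, HasMFDerivAt 𝓘(ℝ, ℝ) 𝓘(ℝ, E) g x
      ((ContinuousLinearMap.toSpanSingleton ℝ
        (mulInvariantVectorField (I := 𝓘(ℝ, E)) (G := U) (u x) (g x) : E) : ℝ →L[ℝ] E))

open Classical in
/-- The development map `Φ`. -/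
def development (a : E) (γ : ℝ → E) : ℝ → E :=
  if h : ∃ u, IsDevelopment U a γ u then h.choose else 0

/-- `t ↦ Γ t` is a differentiable curve in `C_a(ℝ, M_a)`, through `γ` at `t = 0` with velocity `ξ`. -/
structure IsVariation (a : E) (γ ξ : ℝ → E) (Γ : ℝ → ℝ → E) : Prop where
  smooth : ContDiff ℝ ∞ fun q : ℝ × ℝ => Γ q.1 q.2
  curve : ∀ t, IsCurve U a (Γ t)
  start : Γ 0 = γ
  velocity : ∀ x, HasDerivAt (fun t => Γ t x) (ξ x) 0
  decay : ∀ (R : ℝ) (k : ℕ), ∃ C : ℝ, ∀ t x : ℝ, |t| ≤ R →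
    |x| ^ k * ‖deriv (Γ t) x‖ ≤ C ∧ |x| ^ k * ‖deriv (fun s => deriv (Γ s) x) t‖ ≤ C

/-- `dΦ_γ(ξ) = w`. -/
def HasDevDeriv (a : E) (γ ξ w : ℝ → E) : Prop :=
  ∀ Γ : ℝ → ℝ → E, IsVariation U a γ ξ Γ →
    ∀ x, HasDerivAt (fun t => development U a (Γ t) x) (w x) 0

/-- `B_γ(β) = ξ`, where `B_γ` relates the `L²` metric of `C_a(ℝ, M_a)` to the pull-back under `Φ` of the
`L²` metric of `𝓢(ℝ, 𝔲_a^⊥)`: `(dΦ β, dΦ η) = (ξ, η)` for every tangent field `η`. -/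
def IsMetricRelated (a : E) (γ β ξ : ℝ → E) : Prop :=
  ∀ w η y : ℝ → E, HasDevDeriv U a γ β w → IsTangentField U γ η → HasDevDeriv U a γ η y →
    Integrable (fun x => ⟪w x, y x⟫_ℝ) ∧ Integrable (fun x => ⟪ξ x, η x⟫_ℝ) ∧
    ∫ x, ⟪w x, y x⟫_ℝ = ∫ x, ⟪ξ x, η x⟫_ℝ

/-- `w` lies in the domain on which the Poisson operator `P_u` is skew-adjoint, as a Poisson
operator has to be; elsewhere integration by parts leaves a boundary term at `+∞`, which comes from the
antiderivative in `P_u`. -/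
def IsSkewAt (a : E) (u w : ℝ → E) : Prop :=
  ∀ m : ℝ → E, IsPotential U a m →
    ∫ x, ⟪Pu U a u w x, m x⟫_ℝ = -∫ x, ⟪w x, Pu U a u m x⟫_ℝ

/-- `ζ = (dΦ_γ⁻¹ ∘ (J_k)_{Φ(γ)} ∘ dΦ_γ ∘ B_γ⁻¹)(ξ)`, for `ξ` in the domain of this composition. -/
def IsPullbackPair (k : ℕ) (a : E) (γ ξ ζ : ℝ → E) : Prop :=
  IsTangentField U γ ξ ∧ IsTangentField U γ ζ ∧
  ∃ β w : ℝ → E, IsTangentField U γ β ∧ IsMetricRelated U a γ β ξ ∧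
    HasDevDeriv U a γ β w ∧ IsSkewAt U a (development U a γ) w ∧
    HasDevDeriv U a γ ζ (Jk U k a (development U a γ) w)

/-- `Λ` is the pulled-back operator `Φ^*(J_k)` on `C_a(ℝ, M_a)`.  The composition
`dΦ⁻¹ ∘ J_k ∘ dΦ ∘ B⁻¹` is only defined where `B⁻¹` and the `L²` products make sense; the
operator is made of derivatives and of antiderivatives `∫_{-∞}^x`, so that its value at `x` depends on
the curve and the field on `(-∞, x]` only, and this extends it to all tangent fields. -/
structure IsPullbackOperator (k : ℕ) (a : E) (Λ : (ℝ → E) → (ℝ → E) → ℝ → E) : Prop where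
  maps : ∀ γ ξ, IsCurve U a γ → IsTangentField U γ ξ → IsTangentField U γ (Λ γ ξ)
  pullback : ∀ γ ξ ζ, IsCurve U a γ → IsPullbackPair U k a γ ξ ζ → Λ γ ξ = ζ
  causal : ∀ γ ξ γ' ξ', IsCurve U a γ → IsTangentField U γ ξ →
    IsCurve U a γ' → IsTangentField U γ' ξ' →
    ∀ x, (∀ s ≤ x, γ s = γ' s ∧ ξ s = ξ' s) → Λ γ ξ x = Λ γ' ξ' x

end Poisson

end AdjointCurves

end

/-!
Everything is read in the frame `g` that lifts the curve, `γ = g a g⁻¹`, with `u = g⁻¹ g_x` orthogonal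
to `𝔲_a`.  A tangent field is `ξ = g v g⁻¹` with `v` orthogonal to `𝔲_a`.  If `h` is the nonlocal term
`h = -∫ π₀[u, v]` of `P_u v`, then `h_x = -π₀[u, v]`, hence `(v + h)_x + [u, v + h] = P_u v`, that is,

  `(g (v + h) g⁻¹)_x = g (P_u v) g⁻¹`   (`IsFrame.hasDerivAt_add_nonlocal`).

All the operators of the theorem are the right-hand side of this identity.

* *Geometry.*  For regular `a` the centralizer `𝔲_a` is the maximal abelian subalgebra
  (`IsRegular.isotropy_eq`) and the stabilizer of `a` fixes it pointwise (`IsRegular.stabilizer_fixes`),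
  so the fields `â_i` are well defined; their derivative along a curve of the orbit is the bracket with
  an element of the Lie algebra that is tangent to the orbit, and this makes them parallel.  Along `γ`,
  every parallel normal frame is `g b_i g⁻¹` with constant `b_i`, the second fundamental form
  `II(ξ, γ_x)` is `g π₀[u, v] g⁻¹`, and the shape operators are `-g [u, b_i] g⁻¹`.  So Ferapontov's
  operator is `g (P_u v) g⁻¹` (`IsFrame.ferapontov_eq`), and `g h g⁻¹` is the normal correction of the
  Dirac reduction (`IsFrame.isDiracCorrection_iff`).
* *The operator `Φ^*(J_3)`.*  Differentiating the frames along a variation of `γ` shows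
  `dΦ(β) = P_u J_a⁻¹ (g⁻¹ β g)` (`IsFrame.hasDevDeriv`).  If `ξ = B_γ β` and `w = dΦ(β)` is in the domain
  of skew-adjointness of `P_u`, then the metric relation says `P_u w = J_a v`; so
  `(J_3)_u w = P_u J_a⁻¹ P_u v`, which is `dΦ (g (P_u v) g⁻¹)`.  Since `P_u` is injective, the operator
  maps `ξ` to `g (P_u v) g⁻¹` (`IsFrame.eq_of_isPullbackPair`).  As this depends on the past of `x` only,
  it gives the required extension (`isPullbackOperator_ferapontov`).
* *Uniqueness.*  A rapidly decreasing `ξ` is in the domain as soon as `[ξ, γ]` has a rapidly decreasing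
  antiderivative (`IsFrame.isPullbackPair`).  Any pair `(γ, ξ)` agrees up to a given time with such a
  pair: follow the curve past that time, then turn round and go back to `-∞`
  (`IsCurve.exists_isPullbackPair`).

Two tools stand in for general Lie group theory.  Frames are found by solving `g⁻¹ g_x = w` in
the chart at the identity and translating; the line is compactified by the arctangent, so that initial
values at `-∞` make sense (`exists_hasVel_tendsto`).  The inverse of `X ↦ [X, p]` on the tangent space of
the orbit is a polynomial in `ad p` that is the same at all points `p` of the orbit (`omega`), so that
velocities of lifts are smooth functions of the curve.
-/

namespace AdjointCurves

noncomputable section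

set_option linter.unusedSectionVars false

/-! ### The chart at the identity and the Adjoint representation -/

section Chart

variable {E : Type*} [NormedAddCommGroup E] [InnerProductSpace ℝ E]
variable (U : Type*) [TopologicalSpace U] [ChartedSpace E U] [Group U]

/-- The preferred chart of `U` at the identity, as a map into the Lie algebra. -/
def chartOne (g : U) : E := extChartAt 𝓘(ℝ, E) (1 : U) g

/-- The inverse of the preferred chart at the identity. -/
def chartOneSymm (y : E) : U := (extChartAt 𝓘(ℝ, E) (1 : U)).symm y

/-- The position of the identity in the preferred chart. -/
def chartBase : E := chartOne U 1

variable {U}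

theorem chartOneSymm_base : chartOneSymm U (chartBase U : E) = 1 :=
  extChartAt_to_inv (I := 𝓘(ℝ, E)) (1 : U)

theorem chartOne_chartOneSymm_eventually :
    ∀ᶠ y in 𝓝 (chartBase U : E), chartOne U (chartOneSymm U y) = y := by
  filter_upwards [extChartAt_target_mem_nhds (I := 𝓘(ℝ, E)) (1 : U)] with y hy
  exact (extChartAt 𝓘(ℝ, E) (1 : U)).right_inv hy

theorem chartOneSymm_chartOne_eventually :
    ∀ᶠ g in 𝓝 (1 : U), chartOneSymm U (chartOne U g : E) = g := by
  filter_upwards [extChartAt_source_mem_nhds (I := 𝓘(ℝ, E)) (1 : U)] with g hg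
  exact (extChartAt 𝓘(ℝ, E) (1 : U)).left_inv hg

theorem chartOne_continuousAt : ContinuousAt (chartOne U : U → E) 1 :=
  continuousAt_extChartAt (I := 𝓘(ℝ, E)) (1 : U)

theorem chartOneSymm_continuousAt : ContinuousAt (chartOneSymm U) (chartBase U : E) :=
  continuousAt_extChartAt_symm (I := 𝓘(ℝ, E)) (1 : U)

/-- `f' : E → E` is the derivative at `x` of the map `f` of `U`; tangent spaces are identified with the
model space `E`. -/
def HasD (f : U → U) (x : U) (f' : E →L[ℝ] E) : Prop :=
  HasMFDerivAt 𝓘(ℝ, E) 𝓘(ℝ, E) f x f'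

/-- `v : E` is the velocity at `x` of the curve `k` in `U`; tangent spaces are identified with the
model space `E`. -/
def HasDC (k : ℝ → U) (x : ℝ) (v : E) : Prop :=
  HasMFDerivAt 𝓘(ℝ, ℝ) 𝓘(ℝ, E) k x (ContinuousLinearMap.toSpanSingleton ℝ v : ℝ →L[ℝ] E)

theorem HasD.comp {f g : U → U} {x : U} {f' g' : E →L[ℝ] E} (hg : HasD g (f x) g')
    (hf : HasD f x f') : HasD (fun y => g (f y)) x (g'.comp f') :=
  HasMFDerivAt.comp x hg hf

theorem HasD.unique {f : U → U} {x : U} {f' g' : E →L[ℝ] E} (hg : HasD f x g')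
    (hf : HasD f x f') : f' = g' :=
  hasMFDerivAt_unique (I := 𝓘(ℝ, E)) (I' := 𝓘(ℝ, E)) hf hg

theorem HasD.comp_curve {g : U → U} {k : ℝ → U} {x : ℝ} {v : E} {g' : E →L[ℝ] E}
    (hg : HasD g (k x) g') (hf : HasDC k x v) : HasDC (fun y => g (k y)) x (g' v) := by
  have := HasMFDerivAt.comp x hg hf
  have e : g'.comp (ContinuousLinearMap.toSpanSingleton ℝ v : ℝ →L[ℝ] E) =
    ContinuousLinearMap.toSpanSingleton ℝ (g' v) := by ext; simp
  unfold HasDC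
  rw [← e]
  exact this

/-- A map fixing the identity is differentiable there exactly when its chart expression is, and the
derivative is the same: the tangent space at the identity is identified with `E` through this
chart. -/
theorem hasD_one_iff {f : U → U} (h1 : f 1 = 1) {f' : E →L[ℝ] E} :
    HasD f 1 f' ↔ ContinuousAt f 1 ∧
      HasFDerivAt (fun y => chartOne U (f (chartOneSymm U y))) f' (chartBase U) := by
  have : HasD f 1 f' ↔ ContinuousAt f 1 ∧ HasFDerivWithinAt
    (writtenInExtChartAt 𝓘(ℝ, E) 𝓘(ℝ, E) 1 f) f' (range 𝓘(ℝ, E)) (chartBase U) := Iff.rfl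
  rw [this]
  simp only [writtenInExtChartAt, h1, modelWithCornersSelf_coe, range_id, hasFDerivWithinAt_univ]
  rfl

theorem hasDC_one_iff {k : ℝ → U} {x : ℝ} (h1 : k x = 1) {v : E} :
    HasDC k x v ↔
      ContinuousAt k x ∧ HasDerivAt (fun y => (chartOne U (k y) : E)) v x := by
  have : HasDC k x v ↔ ContinuousAt k x ∧ HasFDerivWithinAt
    (writtenInExtChartAt 𝓘(ℝ, ℝ) 𝓘(ℝ, E) x k)
      (ContinuousLinearMap.toSpanSingleton ℝ v : ℝ →L[ℝ] E) (range 𝓘(ℝ, ℝ)) x := Iff.rfl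
  rw [this]
  simp only [writtenInExtChartAt, h1, modelWithCornersSelf_coe, range_id, hasFDerivWithinAt_univ,
    hasDerivAt_iff_hasFDerivAt]
  rfl

/-- The left-invariant vector field with value `v` at the identity. -/
def lInv (v : E) (g : U) : E := mulInvariantVectorField (I := 𝓘(ℝ, E)) (G := U) v g

/-- The curve `g` in `U` is differentiable at `x` with left logarithmic derivative `g⁻¹ g_x = v`. -/
def HasVel (g : ℝ → U) (v : E) (x : ℝ) : Prop := HasDC g x (lInv v (g x))

variable [LieGroup 𝓘(ℝ, E) ∞ U]

theorem contMDiffAt_chartOneSymm :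
    ∀ᶠ y in 𝓝 (chartBase U : E), ContMDiffAt 𝓘(ℝ, E) 𝓘(ℝ, E) ∞ (chartOneSymm U) y := by
  have := IsManifold.of_le (n := ∞) (I := 𝓘(ℝ, E)) (M := U) le_rfl
  filter_upwards [(isOpen_extChartAt_target (I := 𝓘(ℝ, E)) (1 : U)).mem_nhds
    (mem_extChartAt_target (I := 𝓘(ℝ, E)) (1 : U))] with y hy
  exact (contMDiffOn_extChartAt_symm (I := 𝓘(ℝ, E)) (1 : U)).contMDiffAt
    ((isOpen_extChartAt_target (I := 𝓘(ℝ, E)) (1 : U)).mem_nhds hy)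

theorem contMDiffAt_chartOne :
    ContMDiffAt 𝓘(ℝ, E) 𝓘(ℝ, E) ∞ (chartOne U : U → E) 1 := contMDiffAt_extChartAt

/-- The derivative of a map of `U`, as an endomorphism of the model space `E`. -/
def dMap (f : U → U) (x : U) : E →L[ℝ] E := mfderiv 𝓘(ℝ, E) 𝓘(ℝ, E) f x

theorem hasD_of_contMDiff {f : U → U} (hf : ContMDiff 𝓘(ℝ, E) 𝓘(ℝ, E) ∞ f) (x : U) :
    HasD f x (dMap f x : E →L[ℝ] E) :=
  (hf.contMDiffAt.mdifferentiableAt (by simp)).hasMFDerivAt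

theorem contMDiff_mul_left' (g : U) : ContMDiff 𝓘(ℝ, E) 𝓘(ℝ, E) ∞ (g * ·) :=
  contMDiff_mul_left (I := 𝓘(ℝ, E)) (n := ∞)

theorem contMDiff_conj (g : U) : ContMDiff 𝓘(ℝ, E) 𝓘(ℝ, E) ∞ (fun h => g * h * g⁻¹) :=
  (contMDiff_mul_right (I := 𝓘(ℝ, E)) (n := ∞) (a := g⁻¹)).comp (contMDiff_mul_left' g)

theorem hasD_mul_left (g : U) : HasD (g * ·) 1 (dMap (g * ·) 1 : E →L[ℝ] E) :=
  hasD_of_contMDiff (E := E) (contMDiff_mul_left' g) 1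

theorem lInv_eq (v : E) (g : U) : lInv v g = dMap (g * ·) 1 v := rfl

theorem lInv_one (v : E) : lInv v (1 : U) = v := by
  have h1 := hasD_mul_left (E := E) (1 : U)
  have h2 : HasD (fun x : U => x) 1 (ContinuousLinearMap.id ℝ E) := hasMFDerivAt_id (1 : U)
  have : ((1 : U) * ·) = fun x => x := by ext; simp
  rw [this] at h1
  rw [lInv_eq, this, h2.unique h1]; rfl

theorem lInv_mul (v : E) (g h : U) : lInv v (g * h) =
     dMap (g * ·) h (lInv v h) := by
  have h1 := hasD_of_contMDiff (contMDiff_mul_left' (E := E) g) h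
  have h2 := hasD_mul_left (E := E) h
  have h3 := hasD_mul_left (E := E) (g * h)
  have hc : ((g * h) * ·) = fun y => g * (h * y) := by ext; simp [mul_assoc]
  rw [hc] at h3
  have h1' : HasD (g * ·) (h * 1) (dMap (g * ·) h : E →L[ℝ] E) := by
    rw [mul_one]; exact h1
  rw [lInv_eq, hc, ← h3.unique (h1'.comp h2)]; rfl

theorem HasVel.mul_left {g : ℝ → U} {v : E} {x : ℝ} (h : HasVel g v x) (g₀ : U) :
    HasVel (fun y => g₀ * g y) v x := by
  have h1 := hasD_of_contMDiff (contMDiff_mul_left' (E := E) g₀) (g x)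
  unfold HasVel
  rw [lInv_mul]
  exact h1.comp_curve h

/-- Left translation to the identity turns the left logarithmic derivative into an ordinary
derivative in the chart. -/
theorem hasVel_iff {g : ℝ → U} {v : E} {x : ℝ} :
    HasVel g v x ↔ ContinuousAt g x ∧
      HasDerivAt (fun y => (chartOne U ((g x)⁻¹ * g y) : E)) v x := by
  have := topologicalGroup_of_lieGroup 𝓘(ℝ, E) ∞ (G := U)
  have key : HasVel g v x ↔ HasVel (fun y => (g x)⁻¹ * g y) v x := by
    refine ⟨fun h => h.mul_left _, fun h => ?_⟩
    simpa using h.mul_left (g x)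
  have h1 : (g x)⁻¹ * g x = 1 := by simp
  have := hasDC_one_iff (k := fun y => (g x)⁻¹ * g y) (x := x) h1 (v := v)
  rw [key, HasVel, h1, lInv_one, this]
  refine and_congr_left fun _ => ⟨fun h => ?_, fun h => ?_⟩
  · simpa [Function.comp_def] using (continuous_const_mul (g x)).continuousAt.comp h
  · exact continuousAt_const.mul h

theorem hasD_Ad (g : U) : HasD (fun h => g * h * g⁻¹) 1 (Ad U g : E →L[ℝ] E) :=
  hasD_of_contMDiff (E := E) (contMDiff_conj g) 1

theorem Ad_one : Ad U (1 : U) = ContinuousLinearMap.id ℝ E := by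
  have h1 := hasD_Ad (E := E) (1 : U)
  have h2 : HasD (fun x : U => x) 1 (ContinuousLinearMap.id ℝ E) := hasMFDerivAt_id (1 : U)
  have : (fun h => (1 : U) * h * 1⁻¹) = fun x => x := by ext; simp
  rw [this] at h1
  exact h2.unique h1

theorem Ad_mul (g h : U) : Ad U (g * h) = (Ad U g : E →L[ℝ] E).comp (Ad U h) := by
  have h1 := hasD_Ad (E := E) (g * h)
  have h2 := hasD_Ad (E := E) h
  have h3 : HasD (fun k => g * k * g⁻¹) (h * 1 * h⁻¹) (Ad U g : E →L[ℝ] E) := by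
    simpa using hasD_Ad (E := E) g
  have h4 := HasD.comp (g := fun k => g * k * g⁻¹) (f := fun k => h * k * h⁻¹) h3 h2
  have : (fun k => g * (h * k * h⁻¹) * g⁻¹) = fun k => g * h * k * (g * h)⁻¹ := by
    ext; simp [mul_assoc]
  rw [this] at h4
  exact h4.unique h1

theorem Ad_mul_apply (g h : U) (X : E) : Ad U (g * h) X = Ad U g (Ad U h X) := by
  rw [Ad_mul]; rfl

theorem Ad_inv_Ad (g : U) (X : E) : Ad U g⁻¹ (Ad U g X) = X := by
  rw [← Ad_mul_apply, inv_mul_cancel, Ad_one]; rfl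

theorem Ad_Ad_inv (g : U) (X : E) : Ad U g (Ad U g⁻¹ X) = X := by
  rw [← Ad_mul_apply, mul_inv_cancel, Ad_one]; rfl

/-- The multiplication of `U` read in the preferred chart at the identity. -/
def mulChart (p : E × E) : E := chartOne U (chartOneSymm U p.1 * chartOneSymm U p.2)

/-- The conjugation `(g, h) ↦ g h g⁻¹` read in the preferred chart at the identity. -/
def conjChart (p : E × E) : E :=
  chartOne U (chartOneSymm U p.1 * chartOneSymm U p.2 * (chartOneSymm U p.1)⁻¹)

/-- The left division `(g, h) ↦ g⁻¹ h` read in the preferred chart at the identity. -/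
def divChart (p : E × E) : E := chartOne U ((chartOneSymm U p.1)⁻¹ * chartOneSymm U p.2)

theorem contMDiffAt_chartOneSymm_fst :
    ContMDiffAt 𝓘(ℝ, E × E) 𝓘(ℝ, E) ∞ (fun p : E × E => chartOneSymm U p.1)
      (chartBase U, chartBase U) :=
  ContMDiffAt.comp (x := ((chartBase U, chartBase U) : E × E)) (g := chartOneSymm U)
    (contMDiffAt_chartOneSymm.self_of_nhds) contDiffAt_fst.contMDiffAt

theorem contMDiffAt_chartOneSymm_snd :
    ContMDiffAt 𝓘(ℝ, E × E) 𝓘(ℝ, E) ∞ (fun p : E × E => chartOneSymm U p.2)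
      (chartBase U, chartBase U) :=
  ContMDiffAt.comp (x := ((chartBase U, chartBase U) : E × E)) (g := chartOneSymm U)
    (contMDiffAt_chartOneSymm.self_of_nhds) contDiffAt_snd.contMDiffAt

theorem contDiffAt_chartOne_of {f : E × E → U}
    (hf : ContMDiffAt 𝓘(ℝ, E × E) 𝓘(ℝ, E) ∞ f (chartBase U, chartBase U))
    (h1 : f (chartBase U, chartBase U) = 1) :
    ContDiffAt ℝ ∞ (fun p => (chartOne U (f p) : E)) (chartBase U, chartBase U) := by
  have h : ContMDiffAt 𝓘(ℝ, E) 𝓘(ℝ, E) ∞ (chartOne U : U → E) (f (chartBase U, chartBase U)) := by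
    rw [h1]; exact contMDiffAt_chartOne
  exact (ContMDiffAt.comp (chartBase U, chartBase U) h hf).contDiffAt

theorem contDiffAt_mulChart : ContDiffAt ℝ ∞ (mulChart (U := U) : E × E → E)
    (chartBase U, chartBase U) :=
  contDiffAt_chartOne_of (contMDiffAt_chartOneSymm_fst.mul contMDiffAt_chartOneSymm_snd)
    (by simp [chartOneSymm_base])

theorem contDiffAt_conjChart : ContDiffAt ℝ ∞ (conjChart (U := U) : E × E → E)
    (chartBase U, chartBase U) :=
  contDiffAt_chartOne_of ((contMDiffAt_chartOneSymm_fst.mul contMDiffAt_chartOneSymm_snd).mul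
    contMDiffAt_chartOneSymm_fst.inv) (by simp [chartOneSymm_base])

theorem contDiffAt_divChart : ContDiffAt ℝ ∞ (divChart (U := U) : E × E → E)
    (chartBase U, chartBase U) :=
  contDiffAt_chartOne_of (contMDiffAt_chartOneSymm_fst.inv.mul contMDiffAt_chartOneSymm_snd)
    (by simp [chartOneSymm_base])

/-- Left-invariant fields in the chart: the partial derivative of the product in its second factor. -/
def leftField (y : E) : E →L[ℝ] E :=
  (fderiv ℝ (mulChart (U := U)) (y, chartBase U)).comp (ContinuousLinearMap.inr ℝ E E)

/-- Right-invariant fields in the chart: the partial derivative of the product in its first factor. -/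
def rightField (y : E) : E →L[ℝ] E :=
  (fderiv ℝ (mulChart (U := U)) (chartBase U, y)).comp (ContinuousLinearMap.inl ℝ E E)

theorem hasFDerivAt_mk_left {f : E × E → E} {x y : E} (h : DifferentiableAt ℝ f (x, y)) :
    HasFDerivAt (fun z => f (x, z)) ((fderiv ℝ f (x, y)).comp (ContinuousLinearMap.inr ℝ E E)) y :=
  h.hasFDerivAt.comp y (hasFDerivAt_prodMk_right x y)

theorem hasFDerivAt_mk_right {f : E × E → E} {x y : E} (h : DifferentiableAt ℝ f (x, y)) :
    HasFDerivAt (fun z => f (z, y)) ((fderiv ℝ f (x, y)).comp (ContinuousLinearMap.inl ℝ E E)) x :=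
  h.hasFDerivAt.comp x (hasFDerivAt_prodMk_left x y)

theorem tendsto_mk_base_right : Tendsto (fun y : E => (y, (chartBase U : E))) (𝓝 (chartBase U))
    (𝓝 (chartBase U, chartBase U)) :=
  (continuous_id.prodMk continuous_const).tendsto' _ _ rfl

theorem tendsto_mk_base_left : Tendsto (fun y : E => ((chartBase U : E), y)) (𝓝 (chartBase U))
    (𝓝 (chartBase U, chartBase U)) :=
  (continuous_const.prodMk continuous_id).tendsto' _ _ rfl

theorem eventually_differentiableAt {f : E × E → E} {p : E × E} (h : ContDiffAt ℝ ∞ f p) :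
    ∀ᶠ q in 𝓝 p, DifferentiableAt ℝ f q := by
  have h1 : ContDiffAt ℝ 1 f p := h.of_le (by simp)
  filter_upwards [h1.eventually (by simp)] with q hq
  exact hq.differentiableAt (by simp)

theorem Ad_chartOneSymm_eventually : ∀ᶠ y in 𝓝 (chartBase U : E), Ad U (chartOneSymm U y) =
    (fderiv ℝ (conjChart (U := U)) (y, chartBase U)).comp (ContinuousLinearMap.inr ℝ E E) := by
  filter_upwards [tendsto_mk_base_right.eventually
    (eventually_differentiableAt contDiffAt_conjChart)] with y hy
  have h := (hasD_one_iff (by simp)).1 (hasD_Ad (E := E) (chartOneSymm U y))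
  exact h.2.unique (hasFDerivAt_mk_left hy)

/-- Left-invariant fields are right-invariant fields composed with the Adjoint action.
Differentiating this identity at the identity yields the derivative of `Ad`. -/
theorem leftField_eventually : ∀ᶠ y in 𝓝 (chartBase U : E), leftField (U := U) y =
    (rightField (U := U) y).comp (Ad U (chartOneSymm U y)) := by
  have := topologicalGroup_of_lieGroup 𝓘(ℝ, E) ∞ (G := U)
  filter_upwards [tendsto_mk_base_right.eventually
    (eventually_differentiableAt contDiffAt_mulChart), tendsto_mk_base_left.eventually
    (eventually_differentiableAt contDiffAt_mulChart)] with y hy hy'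
  have h := ((hasD_one_iff (by simp)).1 (hasD_Ad (E := E) (chartOneSymm U y))).2
  have h1 := hasFDerivAt_mk_left hy
  have h2 := hasFDerivAt_mk_right hy'
  have e : (chartOne U (chartOneSymm U y * chartOneSymm U (chartBase U : E) *
      (chartOneSymm U y)⁻¹) : E) = chartBase U := by
    rw [chartOneSymm_base]; simp [chartBase]
  have h3 : HasFDerivAt (fun z => mulChart (U := U) (chartOne U (chartOneSymm U y *
      chartOneSymm U z * (chartOneSymm U y)⁻¹), y))
      ((rightField (U := U) y).comp (Ad U (chartOneSymm U y))) (chartBase U : E) :=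
    HasFDerivAt.comp (g := fun z => mulChart (U := U) (z, y)) (chartBase U : E)
      (by rw [e]; exact h2) h
  have hc : ContinuousAt (fun z : E => chartOneSymm U y * chartOneSymm U z * (chartOneSymm U y)⁻¹)
      (chartBase U) :=
    (continuousAt_const.mul chartOneSymm_continuousAt).mul continuousAt_const
  have hev : ∀ᶠ z in 𝓝 (chartBase U : E), chartOneSymm U ((chartOne U
      (chartOneSymm U y * chartOneSymm U z * (chartOneSymm U y)⁻¹)) : E) =
      chartOneSymm U y * chartOneSymm U z * (chartOneSymm U y)⁻¹ := by
    refine Tendsto.eventually ?_ chartOneSymm_chartOne_eventually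
    have := hc.tendsto
    simpa [chartOneSymm_base] using this
  refine (h1.congr_of_eventuallyEq ?_).unique h3
  filter_upwards [hev] with z hz
  simp only [mulChart, hz]
  simp

theorem leftField_base : leftField (U := U) (chartBase U : E) = ContinuousLinearMap.id ℝ E := by
  have h1 := hasFDerivAt_mk_left (eventually_differentiableAt
    (contDiffAt_mulChart (E := E) (U := U))).self_of_nhds
  refine h1.unique ((hasFDerivAt_id _).congr_of_eventuallyEq ?_)
  filter_upwards [chartOne_chartOneSymm_eventually (U := U) (E := E)] with y hy
  simp [mulChart, chartOneSymm_base, hy]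

theorem rightField_base : rightField (U := U) (chartBase U : E) = ContinuousLinearMap.id ℝ E := by
  have h1 := hasFDerivAt_mk_right (eventually_differentiableAt
    (contDiffAt_mulChart (E := E) (U := U))).self_of_nhds
  refine h1.unique ((hasFDerivAt_id _).congr_of_eventuallyEq ?_)
  filter_upwards [chartOne_chartOneSymm_eventually (U := U) (E := E)] with y hy
  simp [mulChart, chartOneSymm_base, hy]

theorem ContDiffAt.hasFDerivAt_fderiv_infty {f : E × E → E} {p : E × E}
    (h : ContDiffAt ℝ ∞ f p) : HasFDerivAt (fderiv ℝ f) (fderiv ℝ (fderiv ℝ f) p) p :=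
  ((h.fderiv_right (m := ∞) (by simp)).differentiableAt (by simp)).hasFDerivAt

/-- The second derivative of the multiplication in the chart. -/
def mulChart₂ : E × E →L[ℝ] E × E →L[ℝ] E :=
  fderiv ℝ (fderiv ℝ (mulChart (U := U))) (chartBase U, chartBase U)

theorem hasFDerivAt_leftField (Y : E) : HasFDerivAt (fun y => leftField (U := U) y Y)
    ((mulChart₂ (U := U)).flip (0, Y) ∘L ContinuousLinearMap.inl ℝ E E) (chartBase U : E) := by
  have h := ContDiffAt.hasFDerivAt_fderiv_infty (contDiffAt_mulChart (U := U) (E := E))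
  have h1 := HasFDerivAt.comp (chartBase U : E) (f := fun y : E => (y, (chartBase U : E)))
    (g := fderiv ℝ (mulChart (U := U))) h (hasFDerivAt_prodMk_left (𝕜 := ℝ) (chartBase U : E) (chartBase U : E))
  have h2 := h1.clm_apply (hasFDerivAt_const ((0, Y) : E × E) _)
  convert! h2 using 1
  ext; simp [mulChart₂]

theorem hasFDerivAt_rightField : HasFDerivAt (fun y => rightField (U := U) y)
    ((ContinuousLinearMap.compL ℝ E (E × E) E).flip (ContinuousLinearMap.inl ℝ E E) ∘L
      (mulChart₂ (U := U)) ∘L ContinuousLinearMap.inr ℝ E E) (chartBase U : E) := by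
  have h := ContDiffAt.hasFDerivAt_fderiv_infty (contDiffAt_mulChart (U := U) (E := E))
  have h1 := HasFDerivAt.comp (chartBase U : E) (f := fun y : E => ((chartBase U : E), y))
    (g := fderiv ℝ (mulChart (U := U))) h (hasFDerivAt_prodMk_right (𝕜 := ℝ) (chartBase U : E) (chartBase U : E))
  have h2 := h1.clm_comp (hasFDerivAt_const (ContinuousLinearMap.inl ℝ E E) _)
  convert! h2 using 1
  ext; simp [mulChart₂]

theorem differentiableAt_Ad_chart :
    DifferentiableAt ℝ (fun y : E => (Ad U (chartOneSymm U y) : E →L[ℝ] E)) (chartBase U) := by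
  have h := ContDiffAt.hasFDerivAt_fderiv_infty (contDiffAt_conjChart (U := U) (E := E))
  have h1 := HasFDerivAt.comp (chartBase U : E) (f := fun y : E => (y, (chartBase U : E)))
    (g := fderiv ℝ (conjChart (U := U))) h (hasFDerivAt_prodMk_left (𝕜 := ℝ) (chartBase U : E) (chartBase U : E))
  have h2 := h1.clm_comp (hasFDerivAt_const (ContinuousLinearMap.inr ℝ E E) _)
  exact h2.differentiableAt.congr_of_eventuallyEq (Ad_chartOneSymm_eventually (E := E) (U := U))

/-- The derivative `D` at `y` of a map from the chart domain to `U`. -/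
def HasDFrom (f : E → U) (y : E) (f' : E →L[ℝ] E) : Prop :=
  HasMFDerivAt 𝓘(ℝ, E) 𝓘(ℝ, E) f y f'

/-- The derivative `D` at `x` of a map from `U` to the chart domain. -/
def HasDTo (f : U → E) (x : U) (f' : E →L[ℝ] E) : Prop :=
  HasMFDerivAt 𝓘(ℝ, E) 𝓘(ℝ, E) f x f'

theorem hasDFrom_chartOneSymm_base :
    HasDFrom (chartOneSymm U) (chartBase U : E) (ContinuousLinearMap.id ℝ E) := by
  have : HasDFrom (chartOneSymm U) (chartBase U : E)
    (ContinuousLinearMap.id ℝ E) ↔ ContinuousAt (chartOneSymm U) (chartBase U : E) ∧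
      HasFDerivWithinAt (writtenInExtChartAt 𝓘(ℝ, E) 𝓘(ℝ, E) (chartBase U : E) (chartOneSymm U))
      (ContinuousLinearMap.id ℝ E) (range 𝓘(ℝ, E)) (chartBase U : E) := Iff.rfl
  rw [this]
  refine ⟨chartOneSymm_continuousAt, ?_⟩
  simp only [writtenInExtChartAt, chartOneSymm_base, modelWithCornersSelf_coe, range_id,
    hasFDerivWithinAt_univ]
  refine (hasFDerivAt_id _).congr_of_eventuallyEq ?_
  exact chartOne_chartOneSymm_eventually

theorem hasDTo_chartOne_one :
    HasDTo (chartOne U : U → E) 1 (ContinuousLinearMap.id ℝ E) := by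
  have : HasDTo (chartOne U : U → E) 1
    (ContinuousLinearMap.id ℝ E) ↔ ContinuousAt (chartOne U : U → E) 1 ∧
      HasFDerivWithinAt (writtenInExtChartAt 𝓘(ℝ, E) 𝓘(ℝ, E) (1 : U) (chartOne U))
      (ContinuousLinearMap.id ℝ E) (range 𝓘(ℝ, E)) (chartBase U : E) := Iff.rfl
  rw [this]
  refine ⟨chartOne_continuousAt, ?_⟩
  simp only [writtenInExtChartAt, modelWithCornersSelf_coe, range_id,
    hasFDerivWithinAt_univ]
  refine (hasFDerivAt_id _).congr_of_eventuallyEq ?_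
  exact chartOne_chartOneSymm_eventually

theorem HasDFrom.comp_to {g : U → E} {f : E → U} {x : E} {f' g' : E →L[ℝ] E}
    (hg : HasDTo g (f x) g') (hf : HasDFrom f x f') : HasFDerivAt (fun y => g (f y)) (g'.comp f') x :=
  (HasMFDerivAt.comp x hg hf).hasFDerivAt

theorem HasDFrom.comp {g : U → U} {f : E → U} {x : E} {f' g' : E →L[ℝ] E}
    (hg : HasD g (f x) g') (hf : HasDFrom f x f') : HasDFrom (fun y => g (f y)) x (g'.comp f') :=
  HasMFDerivAt.comp x hg hf

theorem HasDTo.comp_from {g : E → U} {f : U → E} {x : U} {f' g' : E →L[ℝ] E}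
    (hg : HasDFrom g (f x) g') (hf : HasDTo f x f') : HasD (fun y => g (f y)) x (g'.comp f') :=
  HasMFDerivAt.comp x hg hf

/-- Near the base point the chart and its inverse have mutually inverse derivatives. -/
theorem exists_hasD_chart : ∀ᶠ y in 𝓝 (chartBase U : E), ∃ D D' : E →L[ℝ] E,
    HasDFrom (chartOneSymm U) y D ∧ HasDTo (chartOne U) (chartOneSymm U y) D' ∧
      D.inverse = D' ∧ D.comp D' = ContinuousLinearMap.id ℝ E := by
  have hm := IsManifold.of_le (n := ∞) (I := 𝓘(ℝ, E)) (M := U) (m := 1) (by simp)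
  have hm := IsManifold.of_le (n := ∞) (I := 𝓘(ℝ, E)) (M := U) le_rfl
  filter_upwards [(isOpen_extChartAt_target (I := 𝓘(ℝ, E)) (1 : U)).mem_nhds
    (mem_extChartAt_target (I := 𝓘(ℝ, E)) (1 : U))] with y hy
  have ht := (isOpen_extChartAt_target (I := 𝓘(ℝ, E)) (1 : U)).mem_nhds hy
  have hys : chartOneSymm U y ∈ (extChartAt 𝓘(ℝ, E) (1 : U)).source :=
    (extChartAt 𝓘(ℝ, E) (1 : U)).map_target hy
  have hs := (isOpen_extChartAt_source (I := 𝓘(ℝ, E)) (1 : U)).mem_nhds hys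
  have h1 : ContMDiffAt 𝓘(ℝ, E) 𝓘(ℝ, E) ∞ (chartOneSymm U) y :=
    (contMDiffOn_extChartAt_symm (I := 𝓘(ℝ, E)) (1 : U)).contMDiffAt ht
  have h2 : ContMDiffAt 𝓘(ℝ, E) 𝓘(ℝ, E) ∞ (chartOne U) (chartOneSymm U y) :=
    (contMDiffOn_extChartAt (I := 𝓘(ℝ, E)) (x := (1 : U))).contMDiffAt
      (by simpa [extChartAt_source] using hs)
  obtain ⟨D, hD⟩ : ∃ D, HasDFrom (chartOneSymm U) y D :=
    ⟨_, (h1.mdifferentiableAt (by simp)).hasMFDerivAt⟩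
  obtain ⟨D', hD'⟩ : ∃ D, HasDTo (chartOne U) (chartOneSymm U y) D :=
    ⟨_, (h2.mdifferentiableAt (by simp)).hasMFDerivAt⟩
  have key : D.comp D' = ContinuousLinearMap.id ℝ E := by
    have hinv : chartOne U (chartOneSymm U y) = y := (extChartAt 𝓘(ℝ, E) (1 : U)).right_inv hy
    have h3 := HasDTo.comp_from (g := chartOneSymm U) (by rw [hinv]; exact hD) hD'
    have h4 : HasD (fun z : U => z) (chartOneSymm U y) (ContinuousLinearMap.id ℝ E) :=
      hasMFDerivAt_id _
    refine HasD.unique (f := fun z : U => z) (x := chartOneSymm U y) h4 ?_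
    refine HasMFDerivAt.congr_of_eventuallyEq h3 ?_
    filter_upwards [hs] with z hz
    exact ((extChartAt 𝓘(ℝ, E) (1 : U)).left_inv hz).symm
  have key' : D'.comp D = ContinuousLinearMap.id ℝ E := by
    have h3 := HasDFrom.comp_to hD' hD
    refine h3.unique ((hasFDerivAt_id _).congr_of_eventuallyEq ?_)
    filter_upwards [ht] with z hz
    exact (extChartAt 𝓘(ℝ, E) (1 : U)).right_inv hz
  exact ⟨D, D', hD, hD', ContinuousLinearMap.inverse_eq key key', key⟩

/-- The derivatives `D` of the inverse chart and `D'` of the chart are mutually inverse, and `D'`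
takes left-invariant fields to `leftField`. -/
theorem chart_lInv_eventually : ∀ᶠ y in 𝓝 (chartBase U : E), ∃ D D' : E →L[ℝ] E,
    HasDFrom (chartOneSymm U) y D ∧ HasDTo (chartOne U) (chartOneSymm U y) D' ∧
      D.inverse = D' ∧ D.comp D' = ContinuousLinearMap.id ℝ E ∧
      ∀ X, D' (lInv X (chartOneSymm U y)) = leftField (U := U) y X := by
  filter_upwards [exists_hasD_chart (U := U) (E := E), tendsto_mk_base_right.eventually
    (eventually_differentiableAt contDiffAt_mulChart)] with y ⟨D, D', h1, h2, h3, h33⟩ hy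
  refine ⟨D, D', h1, h2, h3, h33, fun X => ?_⟩
  rw [lInv_eq]
  have h4 := hasFDerivAt_mk_left hy
  have h5 := hasDFrom_chartOneSymm_base (E := E) (U := U)
  have h6 : HasDFrom (fun z => chartOneSymm U y * chartOneSymm U z) (chartBase U : E)
      ((dMap (fun x => chartOneSymm U y * x) 1).comp (ContinuousLinearMap.id ℝ E)) := by
    refine HasDFrom.comp (g := fun x => chartOneSymm U y * x) ?_ h5
    rw [chartOneSymm_base]
    exact hasD_mul_left _
  have h7 := HasDFrom.comp_to (g := chartOne U) (g' := D')
    (by simpa [chartOneSymm_base] using h2) h6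
  have h8 := h4.unique h7
  rw [leftField, h8]; rfl

/-- In the chart, the left-invariant vector field is `leftField`. -/
theorem mpullback_lInv (X : E) : ∀ᶠ y in 𝓝 (chartBase U : E),
    (VectorField.mpullbackWithin 𝓘(ℝ, E) 𝓘(ℝ, E) (extChartAt 𝓘(ℝ, E) (1 : U)).symm
      (mulInvariantVectorField (I := 𝓘(ℝ, E)) (G := U) X) (range 𝓘(ℝ, E)) : E → E) y =
      leftField (U := U) y X := by
  filter_upwards [chart_lInv_eventually (U := U) (E := E)] with y ⟨D, D', h1, h2, h3, _, h5⟩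
  have e : (VectorField.mpullbackWithin 𝓘(ℝ, E) 𝓘(ℝ, E) (extChartAt 𝓘(ℝ, E) (1 : U)).symm
      (mulInvariantVectorField (I := 𝓘(ℝ, E)) (G := U) X) (range 𝓘(ℝ, E)) : E → E) y =
      D.inverse (lInv X (chartOneSymm U y)) := by
    have hD : D = mfderivWithin 𝓘(ℝ, E) 𝓘(ℝ, E) (extChartAt 𝓘(ℝ, E) (1 : U)).symm
        (range 𝓘(ℝ, E)) y := by
      have : range 𝓘(ℝ, E) = univ := by simp
      rw [this, mfderivWithin_univ]
      exact (HasMFDerivAt.mfderiv h1).symm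
    rw [hD]; rfl
  rw [e, h3, h5]

/-- The bracket is the antisymmetrization of the second-order term of the product in the chart. -/
theorem brk_eq_chart (X Y : E) : brk U X Y =
    mulChart₂ (U := U) (X, 0) (0, Y) - mulChart₂ (U := U) (Y, 0) (0, X) := by
  set V : E → E → E := fun X => (VectorField.mpullbackWithin 𝓘(ℝ, E) 𝓘(ℝ, E)
    (extChartAt 𝓘(ℝ, E) (1 : U)).symm
      (mulInvariantVectorField (I := 𝓘(ℝ, E)) (G := U) X) (range 𝓘(ℝ, E)) : E → E) with hV
  have e1 : brk U X Y = (mfderiv 𝓘(ℝ, E) 𝓘(ℝ, E) (chartOne U : U → E) 1).inverse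
    (VectorField.lieBracketWithin ℝ (V X) (V Y) ((extChartAt 𝓘(ℝ, E) (1 : U)).symm ⁻¹' univ ∩
      range 𝓘(ℝ, E)) (chartBase U : E) : E) := rfl
  have e2 : (mfderiv 𝓘(ℝ, E) 𝓘(ℝ, E) (chartOne U : U → E) 1) = ContinuousLinearMap.id ℝ E :=
    HasMFDerivAt.mfderiv hasDTo_chartOne_one
  have e3 : ((extChartAt 𝓘(ℝ, E) (1 : U)).symm ⁻¹' univ ∩ range 𝓘(ℝ, E)) = univ := by simp
  have hV' : ∀ X, V X =ᶠ[𝓝 (chartBase U)] fun y => leftField (U := U) y X := mpullback_lInv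
  have e4 : VectorField.lieBracketWithin ℝ (V X) (V Y) univ (chartBase U : E) =
      mulChart₂ (U := U) (X, 0) (0, Y) - mulChart₂ (U := U) (Y, 0) (0, X) := by
    rw [VectorField.lieBracketWithin_eq]
    simp only [fderivWithin_univ]
    rw [(hV' X).fderiv_eq, (hV' Y).fderiv_eq, (hV' X).self_of_nhds, (hV' Y).self_of_nhds,
      (hasFDerivAt_leftField X).fderiv, (hasFDerivAt_leftField Y).fderiv]
    simp [leftField_base]
  rw [e1, e3, e4]
  have e5 : (mfderiv 𝓘(ℝ, E) 𝓘(ℝ, E) (chartOne U : U → E) 1).inverse =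
      ContinuousLinearMap.id ℝ E :=
    (congrArg ContinuousLinearMap.inverse e2).trans ContinuousLinearMap.inverse_id
  exact DFunLike.congr_fun e5 _

/-- The derivative at the identity of the Adjoint representation is the bracket. -/
theorem fderiv_Ad_chart (X Y : E) :
    fderiv ℝ (fun y : E => (Ad U (chartOneSymm U y) : E →L[ℝ] E)) (chartBase U) X Y = brk U X Y := by
  have h1 := (differentiableAt_Ad_chart (U := U) (E := E)).hasFDerivAt
  have h2 := (hasFDerivAt_rightField (U := U) (E := E)).clm_comp h1
  have h3 := (h2.clm_apply (hasFDerivAt_const Y _)).congr_of_eventuallyEq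
    ((leftField_eventually (U := U) (E := E)).mono fun y hy => DFunLike.congr_fun hy Y)
  have h4 := DFunLike.congr_fun (h3.unique (hasFDerivAt_leftField Y)) X
  have hsymm : mulChart₂ (U := U) (Y, 0) ((0, X) : E × E) = mulChart₂ (U := U) (0, X) (Y, 0) := by
    have : IsSymmSndFDerivAt ℝ (mulChart (U := U)) ((chartBase U, chartBase U) : E × E) :=
      ContDiffAt.isSymmSndFDerivAt (n := ∞) contDiffAt_mulChart
        (by simpa using WithTop.coe_le_coe.2 (le_top : (2 : ℕ∞) ≤ ⊤))
    exact this _ _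
  rw [brk_eq_chart, hsymm]
  simp [rightField_base, chartOneSymm_base, Ad_one] at h4
  rw [← h4]; abel

variable (U) in
/-- The adjoint representation `ad X = [X, ·]` of the Lie algebra, as a continuous bilinear map. -/
def adL : E →L[ℝ] E →L[ℝ] E :=
  fderiv ℝ (fun y : E => (Ad U (chartOneSymm U y) : E →L[ℝ] E)) (chartBase U)

@[simp]
theorem adL_apply (X Y : E) : adL U X Y = brk U X Y := fderiv_Ad_chart X Y

/-- The derivative of `Ad g` along a curve with left logarithmic derivative `u` is `Ad g ∘ ad u`.
-/
theorem HasVel.hasDerivAt_Ad {g : ℝ → U} {u : E} {x : ℝ} (h : HasVel g u x) :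
    HasDerivAt (fun y => (Ad U (g y) : E →L[ℝ] E)) ((Ad U (g x)).comp (adL U u)) x := by
  have := topologicalGroup_of_lieGroup 𝓘(ℝ, E) ∞ (G := U)
  obtain ⟨hc, hd⟩ := hasVel_iff.1 h
  have hk : Tendsto (fun y => (g x)⁻¹ * g y) (𝓝 x) (𝓝 1) := by
    have := (continuous_const_mul (g x)⁻¹).continuousAt.comp hc
    simpa [ContinuousAt, Function.comp_def] using this
  have h1 : HasFDerivAt (fun y : E => (Ad U (chartOneSymm U y) : E →L[ℝ] E)) (adL U)
      (chartOne U ((g x)⁻¹ * g x)) := by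
    rw [inv_mul_cancel]
    exact differentiableAt_Ad_chart.hasFDerivAt
  have h2 := h1.comp_hasDerivAt x hd
  have h3 : HasDerivAt (fun y => (Ad U ((g x)⁻¹ * g y) : E →L[ℝ] E)) (adL U u) x := by
    refine h2.congr_of_eventuallyEq ?_
    filter_upwards [hk.eventually (chartOneSymm_chartOne_eventually (E := E) (U := U))] with y hy
    simp [hy]
  have h4 := (hasDerivAt_const x (Ad U (g x))).clm_comp h3
  simp only [ContinuousLinearMap.zero_comp, zero_add, ← Ad_mul] at h4
  simpa using h4

theorem continuous_Ad : Continuous (fun g : U => (Ad U g : E →L[ℝ] E)) := by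
  have := topologicalGroup_of_lieGroup 𝓘(ℝ, E) ∞ (G := U)
  have h1 : ContinuousAt (fun g : U => (Ad U g : E →L[ℝ] E)) 1 := by
    have h2 : ContinuousAt (fun g : U => (Ad U (chartOneSymm U (chartOne U g : E)) : E →L[ℝ] E))
      1 := ContinuousAt.comp (f := (chartOne U : U → E))
        (g := fun y : E => (Ad U (chartOneSymm U y) : E →L[ℝ] E))
        differentiableAt_Ad_chart.continuousAt chartOne_continuousAt
    refine h2.congr ?_
    filter_upwards [chartOneSymm_chartOne_eventually (E := E) (U := U)] with y hy
    rw [hy]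
  refine continuous_iff_continuousAt.2 fun g => ?_
  have h2 : ContinuousAt (fun h : U => (Ad U (g⁻¹ * h) : E →L[ℝ] E)) g :=
    ContinuousAt.comp (f := fun h => g⁻¹ * h) (g := fun g : U => (Ad U g : E →L[ℝ] E))
      (by simpa using h1) (continuous_const_mul _).continuousAt
  have h3 := (continuousAt_const (y := (Ad U g : E →L[ℝ] E))).clm_comp h2
  simpa [← Ad_mul] using h3

/-- The left logarithmic derivative in the chart: the partial derivative of the left division in its
second factor, on the diagonal. -/
def logDeriv (y : E) : E →L[ℝ] E :=
  (fderiv ℝ (divChart (U := U)) (y, y)).comp (ContinuousLinearMap.inr ℝ E E)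

/-- The logarithmic derivative of a curve given in the chart. -/
theorem hasVel_chartOneSymm : ∀ᶠ z in 𝓝 (chartBase U : E), ∀ (y : ℝ → E) (x : ℝ) (y' : E),
    y x = z → HasDerivAt y y' x → HasVel (fun t => chartOneSymm U (y t)) (logDeriv (U := U) z y') x := by
  have hdiag : Tendsto (fun y : E => (y, y)) (𝓝 (chartBase U)) (𝓝 (chartBase U, chartBase U)) :=
    (continuous_id.prodMk continuous_id).tendsto' _ _ rfl
  filter_upwards [hdiag.eventually (eventually_differentiableAt contDiffAt_divChart),
    contMDiffAt_chartOneSymm (U := U)] with z hz hz' y x y' hy hd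
  refine hasVel_iff.2 ⟨?_, ?_⟩
  · exact ContinuousAt.comp (g := chartOneSymm U) (by rw [hy]; exact hz'.continuousAt)
      hd.continuousAt
  · have h1 := hasFDerivAt_mk_left hz
    rw [← hy] at h1
    have := h1.comp_hasDerivAt x hd
    simpa [divChart, hy, logDeriv, Function.comp_def] using this

/-- A central element of the Lie algebra is fixed by the Adjoint action of a neighbourhood of the
identity. -/
theorem Ad_central_eventually :
    ∀ᶠ s in 𝓝 (1 : U), ∀ z : E, (∀ X, brk U X z = 0) → Ad U s z = z := by
  obtain ⟨r, hr, hball⟩ := Metric.eventually_nhds_iff_ball.1 (hasVel_chartOneSymm (E := E) (U := U))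
  filter_upwards [chartOneSymm_chartOne_eventually (E := E) (U := U),
    chartOne_continuousAt (E := E) (U := U) (Metric.ball_mem_nhds (chartBase U : E) hr)]
    with s hs hs' z hz
  -- `s` is joined to the identity by the segment in the chart; along it `Ad` applied to `z` is
  -- constant, since its derivative is `Ad g [v, z] = 0`
  set p : E := chartBase U
  set q : E := chartOne U s
  set y : ℝ → E := fun t => p + t • (q - p)
  have hy' : ∀ t, HasDerivAt y (q - p) t := fun t => by
    have h1 := ((hasDerivAt_id t).smul_const (q - p)).const_add p
    rw [one_smul] at h1
    exact h1
  have hv : ∀ t ∈ Icc (0 : ℝ) 1, HasDerivAt (fun t => Ad U (chartOneSymm U (y t)) z) 0 t := by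
    intro t ht
    have hb : y t ∈ Metric.ball p r := by
      have h1 : ‖q - p‖ < r := by simpa [dist_eq_norm] using hs'
      rw [Metric.mem_ball, dist_eq_norm]
      calc ‖y t - p‖ = t * ‖q - p‖ := by simp [y, norm_smul, abs_of_nonneg ht.1]
        _ ≤ ‖q - p‖ := mul_le_of_le_one_left (norm_nonneg _) ht.2
        _ < r := h1
    have h1 := (hball _ hb y t _ rfl (hy' t)).hasDerivAt_Ad
    have h2 := h1.clm_apply (hasDerivAt_const t z)
    simpa [hz] using h2
  have := constant_of_has_deriv_right_zero (f := fun t => Ad U (chartOneSymm U (y t)) z)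
    (a := 0) (b := 1) (fun t ht => (hv t ht).continuousAt.continuousWithinAt)
    (fun t ht => (hv t ⟨ht.1, ht.2.le⟩).hasDerivWithinAt) 1 (by simp)
  simpa [y, p, chartOneSymm_base, Ad_one, q, hs] using this

end Chart

/-! ### Curves with prescribed logarithmic derivative -/

section Curves

variable {E : Type*} [NormedAddCommGroup E] [InnerProductSpace ℝ E]
variable {U : Type*} [TopologicalSpace U] [ChartedSpace E U] [Group U] [LieGroup 𝓘(ℝ, E) ∞ U]

theorem contDiffAt_leftField : ContDiffAt ℝ ∞ (leftField (U := U) : E → E →L[ℝ] E) (chartBase U) := by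
  have h1 : ContDiffAt ℝ ∞ (fderiv ℝ (mulChart (U := U))) ((chartBase U, chartBase U) : E × E) :=
    contDiffAt_mulChart.fderiv_right (m := ∞) (by simp)
  have h2 : ContDiffAt ℝ ∞ (fun y : E => (y, (chartBase U : E))) (chartBase U) :=
    contDiffAt_id.prodMk contDiffAt_const
  exact (ContDiffAt.comp (chartBase U : E) (f := fun y : E => (y, (chartBase U : E))) h1 h2).clm_comp
    contDiffAt_const

theorem HasDFrom.comp_curve {f : E → U} {y : ℝ → E} {x : ℝ} {v : E} {f' : E →L[ℝ] E}
    (hf : HasDFrom f (y x) f') (hy : HasDerivAt y v x) : HasDC (fun t => f (y t)) x (f' v) := by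
  have := HasMFDerivAt.comp x hf hy.hasFDerivAt.hasMFDerivAt
  have e : f'.comp (ContinuousLinearMap.toSpanSingleton ℝ v : ℝ →L[ℝ] E) =
    ContinuousLinearMap.toSpanSingleton ℝ (f' v) := by ext; simp
  unfold HasDC
  rw [← e]
  exact this

theorem HasDTo.comp_curve {f : U → E} {k : ℝ → U} {x : ℝ} {v : E} {f' : E →L[ℝ] E}
    (hf : HasDTo f (k x) f') (hk : HasDC k x v) : HasDerivAt (fun t => f (k t)) (f' v) x := by
  have h : HasFDerivAt (fun t => f (k t)) (f'.comp (ContinuousLinearMap.toSpanSingleton ℝ v)) x :=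
    (HasMFDerivAt.comp x hf hk).hasFDerivAt
  simpa using h.hasDerivAt

/-- In the chart at the identity, the equation `g⁻¹ g_x = v` reads `y' = leftField y v`. -/
theorem hasVel_of_leftField : ∀ᶠ z in 𝓝 (chartBase U : E), ∀ (y : ℝ → E) (x : ℝ) (v : E),
    y x = z → HasDerivAt y (leftField (U := U) z v) x → HasVel (fun t => chartOneSymm U (y t)) v x := by
  filter_upwards [chart_lInv_eventually (U := U) (E := E)] with z ⟨D, D', h1, h2, h3, h4, h5⟩
    y x v hy hd
  subst hy
  have := h1.comp_curve hd
  rw [← h5] at this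
  have e : D (D' (lInv v (chartOneSymm U (y x)))) = lInv v (chartOneSymm U (y x)) :=
    DFunLike.congr_fun h4 _
  rw [e] at this
  exact this

/-- Converse of `hasVel_of_leftField`: a solution of `g⁻¹ g_x = v` near the identity solves `y' =
leftField y v` in the chart. -/
theorem HasVel.chart : ∀ᶠ h in 𝓝 (1 : U), ∀ (k : ℝ → U) (x : ℝ) (v : E),
    k x = h → HasVel k v x →
      HasDerivAt (fun t => (chartOne U (k t) : E)) (leftField (U := U) (chartOne U h) v) x := by
  filter_upwards [(chartOne_continuousAt (E := E) (U := U)).eventually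
    (chart_lInv_eventually (U := U) (E := E)), chartOneSymm_chartOne_eventually (E := E) (U := U)]
    with h ⟨D, D', h1, h2, h3, h4, h5⟩ hh k x v hk hv
  subst hk
  rw [hh] at h2 h5
  rw [← h5]
  exact h2.comp_curve hv

theorem HasVel.congr {g k : ℝ → U} {v : E} {x : ℝ} (h : HasVel g v x) (hk : k =ᶠ[𝓝 x] g) :
    HasVel k v x := by
  have : k x = g x := hk.self_of_nhds
  unfold HasVel
  rw [this]
  exact HasMFDerivAt.congr_of_eventuallyEq h hk

/-- Two solutions of `g⁻¹ g_x = w` that agree at `c` fit together to a solution. -/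
theorem HasVel.glue {g k : ℝ → U} {w : ℝ → E} {α β α' β' c : ℝ}
    (hg : ∀ x ∈ Ioo α β, HasVel g (w x) x) (hk : ∀ x ∈ Ioo α' β', HasVel k (w x) x)
    (hc : c ∈ Ioo α β) (hc' : c ∈ Ioo α' β') (hgk : g c = k c) :
    ∀ x ∈ Ioo α β', HasVel (fun t => if t ≤ c then g t else k t) (w x) x := by
  intro x hx
  rcases lt_trichotomy x c with h | h | h
  · refine (hg x ⟨hx.1, h.trans hc.2⟩).congr ?_
    filter_upwards [Iio_mem_nhds h] with t ht
    simp [show t ≤ c from le_of_lt (mem_Iio.1 ht)]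
  · subst h
    obtain ⟨h1, h2⟩ := hasVel_iff.1 (hg x hc)
    obtain ⟨h3, h4⟩ := hasVel_iff.1 (hk x hc')
    have e1 : ∀ t ∈ Iic x, (if t ≤ x then g t else k t) = g t := fun t ht => if_pos ht
    have e2 : ∀ t ∈ Ici x, (if t ≤ x then g t else k t) = k t := by
      intro t ht
      rcases eq_or_lt_of_le (show x ≤ t from ht) with h | h
      · subst h; simp [hgk]
      · simp [h]
    refine hasVel_iff.2 ⟨continuousAt_iff_continuous_left_right.2
      ⟨h1.continuousWithinAt.congr e1 (e1 x (by simp)),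
        h3.continuousWithinAt.congr e2 (e2 x (by simp))⟩, ?_⟩
    rw [← hasDerivWithinAt_univ, ← Iic_union_Ici (a := x)]
    refine HasDerivWithinAt.union (h2.hasDerivWithinAt.congr (fun t ht => ?_) ?_)
      (h4.hasDerivWithinAt.congr (fun t ht => ?_) ?_)
    · simp only [e1 t ht, le_refl, if_true]
    · simp
    · simp only [e2 t ht, le_refl, if_true, hgk]
    · simp [hgk]
  · refine (hk x ⟨hc'.1.trans h, hx.2⟩).congr ?_
    filter_upwards [Ioi_mem_nhds h] with t ht
    simp [show ¬ t ≤ c from not_le.2 ht]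

open scoped NNReal in
/-- Local solutions of `g⁻¹ g_x = w` exist on an interval whose length depends on a bound of `w`
only: left translations reduce the initial value to the identity. -/
theorem exists_hasVel_local [CompleteSpace E] (M : ℝ≥0) : ∃ ε > (0 : ℝ), ε ≤ 1 ∧ ∀ (w : ℝ → E) (x₀ : ℝ) (g₀ : U),
    ContinuousOn w (Icc (x₀ - ε) (x₀ + ε)) → (∀ x ∈ Icc (x₀ - ε) (x₀ + ε), ‖w x‖ ≤ M) →
    ∃ g : ℝ → U, g x₀ = g₀ ∧ ∀ x ∈ Ioo (x₀ - ε) (x₀ + ε), HasVel g (w x) x := by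
  obtain ⟨K, s, hs, hK⟩ := ContDiffAt.exists_lipschitzOnWith
    ((contDiffAt_leftField (E := E) (U := U)).of_le (m := 1) (by simp))
  obtain ⟨r, hr, hball⟩ := Metric.nhds_basis_closedBall.mem_iff.1
    (inter_mem hs (hasVel_of_leftField (E := E) (U := U)))
  set p : E := chartBase U
  lift r to ℝ≥0 using hr.le
  set L : ℝ≥0 := 1 + K * r
  have hL : ∀ y ∈ Metric.closedBall p r, ‖leftField (U := U) y‖ ≤ L := by
    intro y hy
    have h1 := hK.dist_le_mul y (hball hy).1 p (mem_of_mem_nhds hs)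
    rw [dist_eq_norm, leftField_base] at h1
    have h2 : ‖ContinuousLinearMap.id ℝ E‖ ≤ 1 := ContinuousLinearMap.norm_id_le
    have h3 := norm_le_insert' (leftField (U := U) y) (ContinuousLinearMap.id ℝ E)
    have h4 : (K : ℝ) * dist y p ≤ K * r := by gcongr; exact hy
    simp only [L, NNReal.coe_add, NNReal.coe_one, NNReal.coe_mul]
    linarith
  set ε : ℝ := min 1 (r / (L * M + 1))
  have hε : 0 < ε := lt_min one_pos (by positivity)
  have hε2 : L * M * ε ≤ r := by
    calc (L : ℝ) * M * ε ≤ L * M * (r / (L * M + 1)) := by gcongr; exact min_le_right _ _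
      _ = (L * M / (L * M + 1)) * r := by ring
      _ ≤ 1 * r := by
        gcongr
        rw [div_le_one (by positivity)]; linarith
      _ = r := one_mul _
  refine ⟨ε, hε, min_le_left _ _, fun w x₀ g₀ hw hM => ?_⟩
  have hx₀ : x₀ ∈ Icc (x₀ - ε) (x₀ + ε) := ⟨by linarith, by linarith⟩
  have hpl : IsPicardLindelof (fun t y => leftField (U := U) y (w t)) (tmin := x₀ - ε)
      (tmax := x₀ + ε) ⟨x₀, hx₀⟩ p r 0 (L * M) (K * M) := by
    refine ⟨fun t ht => ?_, fun y hy => ?_, fun t ht y hy => ?_, ?_⟩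
    · refine LipschitzOnWith.of_dist_le_mul fun y hy z hz => ?_
      have h1 := hK.dist_le_mul y (hball hy).1 z (hball hz).1
      rw [dist_eq_norm, dist_eq_norm] at *
      rw [← sub_apply]
      calc _ ≤ ‖leftField (U := U) y - leftField (U := U) z‖ * ‖w t‖ :=
            ContinuousLinearMap.le_opNorm _ _
        _ ≤ K * ‖y - z‖ * M := by gcongr; exact hM t ht
        _ = _ := by push_cast; ring
    · exact continuousOn_const.clm_apply hw
    · calc _ ≤ ‖leftField (U := U) y‖ * ‖w t‖ := ContinuousLinearMap.le_opNorm _ _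
        _ ≤ L * M := by gcongr; exacts [hL y hy, hM t ht]
    · simp only [NNReal.coe_mul, add_sub_cancel_left, sub_sub_cancel, max_self, NNReal.coe_zero,
        sub_zero]
      exact hε2
  obtain ⟨α, hα⟩ := ODE.FunSpace.exists_isFixedPt_next hpl (x := p) (by simp)
  have hα0 : α.compProj x₀ = p := by
    have := ODE.FunSpace.compProj_val (α := α) (t := ⟨x₀, hx₀⟩)
    rw [this, ← hα, ODE.FunSpace.next_apply₀]
  have hmem : ∀ t, α.compProj t ∈ Metric.closedBall p r :=
    fun t => α.compProj_mem_closedBall hpl.mul_max_le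
  have hd : ∀ t ∈ Ioo (x₀ - ε) (x₀ + ε),
      HasDerivAt α.compProj (leftField (U := U) (α.compProj t) (w t)) t := by
    intro t ht
    refine HasDerivWithinAt.hasDerivAt ?_ (Icc_mem_nhds ht.1 ht.2)
    refine (ODE.hasDerivWithinAt_picard_Icc hx₀
      hpl.continuousOn_uncurry α.continuous_compProj.continuousOn
      (fun _ _ => α.compProj_mem_closedBall hpl.mul_max_le) p (Ioo_subset_Icc_self ht)).congr_of_mem
      (fun t' ht' => ?_) (Ioo_subset_Icc_self ht)
    nth_rw 1 [← hα]
    rw [ODE.FunSpace.compProj_of_mem ht', ODE.FunSpace.next_apply]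
  refine ⟨fun t => g₀ * chartOneSymm U (α.compProj t), by simp only [hα0, p, chartOneSymm_base, mul_one],
    fun x hx => ?_⟩
  exact ((hball (hmem x)).2 _ x _ rfl (hd x hx)).mul_left g₀

/-- Solutions of `g⁻¹ g_x = w` exist on intervals of any length: a bound of `w` on a slightly
larger interval gives local solutions on intervals of the fixed length `2 ε`, which are glued on
both sides in steps of length `ε / 2`. -/
theorem exists_hasVel_Ioo [CompleteSpace E] {w : ℝ → E} (hw : Continuous w) (x₀ : ℝ) (g₀ : U) (R : ℝ) :
    ∃ g : ℝ → U, g x₀ = g₀ ∧ ∀ x ∈ Ioo (x₀ - R) (x₀ + R), HasVel g (w x) x := by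
  obtain ⟨M, hM⟩ := (isCompact_Icc (a := x₀ - R - 2) (b := x₀ + R + 2)).exists_bound_of_continuousOn
    hw.continuousOn
  obtain ⟨ε, hε, hε1, hloc⟩ := exists_hasVel_local (E := E) (U := U) M.toNNReal
  have hloc' : ∀ x₁ ∈ Icc (x₀ - R - 1) (x₀ + R + 1), ∀ g₁ : U, ∃ g : ℝ → U, g x₁ = g₁ ∧
      ∀ x ∈ Ioo (x₁ - ε) (x₁ + ε), HasVel g (w x) x := by
    intro x₁ hx₁ g₁
    refine hloc w x₁ g₁ hw.continuousOn fun x hx => (hM x ⟨?_, ?_⟩).trans (Real.le_coe_toNNReal M)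
    · linarith [hx.1, hx₁.1]
    · linarith [hx.2, hx₁.2]
  have key : ∀ n : ℕ, n * (ε / 2) ≤ R + 1 → ∃ g : ℝ → U, g x₀ = g₀ ∧
      ∀ x ∈ Ioo (x₀ - (n * (ε / 2) + ε)) (x₀ + (n * (ε / 2) + ε)), HasVel g (w x) x := by
    intro n
    induction n with
    | zero =>
      intro h
      have h0 : (0 : ℝ) ≤ R + 1 := by simpa using h
      simpa using hloc' x₀ ⟨by linarith, by linarith⟩ g₀
    | succ n ih =>
      intro hn
      push_cast at hn
      obtain ⟨g, hg0, hg⟩ := ih (by linarith)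
      set d := n * (ε / 2) + ε with hd
      have hn0 : (0 : ℝ) ≤ n * (ε / 2) := by positivity
      obtain ⟨k, hk0, hk⟩ := hloc' (x₀ + d - ε / 2) ⟨by linarith, by linarith⟩ (g (x₀ + d - ε / 2))
      obtain ⟨k', hk0', hk'⟩ := hloc' (x₀ - d + ε / 2) ⟨by linarith, by linarith⟩
        (g (x₀ - d + ε / 2))
      have h1 := HasVel.glue hg hk (c := x₀ + d - ε / 2) ⟨by linarith, by linarith⟩
        ⟨by linarith, by linarith⟩ hk0.symm
      have h2 := HasVel.glue hk' h1 (c := x₀ - d + ε / 2) ⟨by linarith, by linarith⟩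
        ⟨by linarith, by linarith⟩ (by rw [hk0', if_pos (by linarith)])
      refine ⟨_, ?_, fun x hx => h2 x ⟨?_, ?_⟩⟩
      · rw [if_neg (by linarith), if_pos (by linarith), hg0]
      · have := hx.1; push_cast at this; linarith
      · have := hx.2; push_cast at this; linarith
  by_cases hR : R + 1 < 0
  · exact ⟨fun _ => g₀, rfl, fun x hx => absurd (hx.1.trans hx.2) (by linarith)⟩
  · obtain ⟨g, hg0, hg⟩ := key ⌊(R + 1) / (ε / 2)⌋₊ (by
      have := Nat.floor_le (div_nonneg (not_lt.1 hR) (half_pos hε).le)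
      rwa [le_div_iff₀ (half_pos hε)] at this)
    have h2 := Nat.lt_floor_add_one ((R + 1) / (ε / 2))
    rw [div_lt_iff₀ (half_pos hε)] at h2
    exact ⟨g, hg0, fun x hx => hg x ⟨by linarith [hx.1], by linarith [hx.2]⟩⟩

/-- Bootstrap: a curve with smooth left logarithmic derivative is smooth. -/
theorem contMDiff_of_hasVel {g : ℝ → U} {w : ℝ → E} (hw : ContDiff ℝ ∞ w)
    (hg : ∀ x, HasVel g (w x) x) : ContMDiff 𝓘(ℝ, ℝ) 𝓘(ℝ, E) ∞ g := by
  have := topologicalGroup_of_lieGroup 𝓘(ℝ, E) ∞ (G := U)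
  intro x₀
  set k : ℝ → U := fun x => (g x₀)⁻¹ * g x with hk
  have hkv : ∀ x, HasVel k (w x) x := fun x => (hg x).mul_left _
  have hk0 : k x₀ = 1 := by simp [hk]
  have hkc : Tendsto k (𝓝 x₀) (𝓝 1) := hk0 ▸ (hasVel_iff.1 (hkv x₀)).1
  set y : ℝ → E := fun t => chartOne U (k t) with hy
  have hy0 : y x₀ = chartBase U := by simp [hy, hk0, chartBase]
  have hd : ∀ᶠ x in 𝓝 x₀, HasDerivAt y (leftField (U := U) (y x) (w x)) x := by
    filter_upwards [hkc.eventually (HasVel.chart (E := E) (U := U))] with x hx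
    exact hx k x _ rfl (hkv x)
  have hsm : ∀ n : ℕ, ContDiffAt ℝ n y x₀ := by
    intro n
    induction n with
    | zero =>
      have := hd.self_of_nhds.continuousAt
      exact contDiffAt_zero.2 ⟨_, hd, fun x hx => HasDerivAt.continuousAt hx |>.continuousWithinAt⟩
    | succ n ih =>
      push_cast
      rw [contDiffAt_succ_iff_hasFDerivAt]
      refine ⟨fun x => ContinuousLinearMap.toSpanSingleton ℝ (leftField (U := U) (y x) (w x)),
        ⟨_, hd, fun x hx => HasDerivAt.hasFDerivAt hx⟩, ?_⟩
      have h1 : ContDiffAt ℝ n (fun x => leftField (U := U) (y x)) x₀ :=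
        ContDiffAt.comp x₀ (g := leftField (U := U))
          (by rw [hy0]; exact contDiffAt_leftField.of_le (by exact_mod_cast le_top)) ih
      have h2 := h1.clm_apply (hw.contDiffAt.of_le (by exact_mod_cast le_top))
      exact (ContinuousLinearMap.toSpanSingletonCLE (𝕜 := ℝ) (E := E)).contDiff.contDiffAt.comp x₀ h2
  have hsm' : ContDiffAt ℝ ∞ y x₀ := contDiffAt_infty.2 hsm
  have h3 : ContMDiffAt 𝓘(ℝ, ℝ) 𝓘(ℝ, E) ∞ (fun x => g x₀ * chartOneSymm U (y x)) x₀ := by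
    refine contMDiffAt_const.mul ?_
    refine ContMDiffAt.comp x₀ (g := chartOneSymm U) ?_ hsm'.contMDiffAt
    rw [hy0]
    exact contMDiffAt_chartOneSymm.self_of_nhds
  refine h3.congr_of_eventuallyEq ?_
  filter_upwards [hkc.eventually (chartOneSymm_chartOne_eventually (E := E) (U := U))] with x hx
  simp only [hy, hx]
  simp [hk]

theorem hasD_inv : HasD (fun g : U => g⁻¹) 1 (-ContinuousLinearMap.id ℝ E) := by
  have hinv : ContMDiff 𝓘(ℝ, E) 𝓘(ℝ, E) ∞ (fun g : U => g⁻¹) := contMDiff_inv _ _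
  have h := hasD_of_contMDiff (E := E) hinv 1
  set J : E →L[ℝ] E := dMap (fun g : U => g⁻¹) 1
  obtain ⟨hc, hJ⟩ := (hasD_one_iff (by simp)).1 h
  have hm := (eventually_differentiableAt
    (contDiffAt_mulChart (E := E) (U := U))).self_of_nhds.hasFDerivAt
  set f : E → E := fun y => chartOne U ((chartOneSymm U y)⁻¹)
  have hf0 : f (chartBase U) = chartBase U := by
    simp only [f, chartOneSymm_base]; simp [chartBase]
  have h1 : HasFDerivAt (fun z => mulChart (U := U) (z, f z)) _ (chartBase U : E) :=
    HasFDerivAt.comp (chartBase U : E) (g := mulChart (U := U)) (f := fun z : E => (z, f z))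
      (by rw [hf0]; exact hm) ((hasFDerivAt_id _).prodMk hJ)
  have h2 : HasFDerivAt (fun z => mulChart (U := U) (z, f z)) (0 : E →L[ℝ] E) (chartBase U : E) := by
    refine (hasFDerivAt_const (chartBase U : E) _).congr_of_eventuallyEq ?_
    have ht : Tendsto (fun y : E => (chartOneSymm U y)⁻¹) (𝓝 (chartBase U)) (𝓝 1) := by
      have := hc.tendsto.comp (by
        simpa [ContinuousAt, chartOneSymm_base] using chartOneSymm_continuousAt (E := E) (U := U) :
          Tendsto (chartOneSymm U) (𝓝 (chartBase U : E)) (𝓝 1))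
      simpa [Function.comp_def] using this
    filter_upwards [ht.eventually (chartOneSymm_chartOne_eventually (E := E) (U := U))] with z hz
    simp [mulChart, f, hz, chartBase]
  have h3 := h1.unique h2
  -- differentiate `g g⁻¹ = 1` in the chart, where the derivative of the product at the identity is
  -- the sum
  have hJ' : J = -ContinuousLinearMap.id ℝ E := by
    ext v
    have h4 := DFunLike.congr_fun h3 v
    have h5 : fderiv ℝ (mulChart (U := U)) ((chartBase U, chartBase U) : E × E) (v, J v) =
        v + J v := by
      have e : ((v, J v) : E × E) = ContinuousLinearMap.inl ℝ E E v +
        ContinuousLinearMap.inr ℝ E E (J v) := by simp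
      have e1 := DFunLike.congr_fun (rightField_base (E := E) (U := U)) v
      have e2 := DFunLike.congr_fun (leftField_base (E := E) (U := U)) (J v)
      rw [e, map_add]
      exact congrArg₂ (· + ·) e1 e2
    have h6 : v + J v = 0 := by rw [← h5]; exact h4
    simpa using eq_neg_of_add_eq_zero_right h6
  rw [← hJ']
  exact h

/-- If `h⁻¹ h_x = v`, then the logarithmic derivative of `h⁻¹` is `-h v h⁻¹`. -/
theorem HasVel.inv {h : ℝ → U} {v : E} {x : ℝ} (hv : HasVel h v x) :
    HasVel (fun y => (h y)⁻¹) (-(Ad U (h x) v)) x := by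
  have := topologicalGroup_of_lieGroup 𝓘(ℝ, E) ∞ (G := U)
  have h1 := hv.mul_left (h x)⁻¹
  have hk : HasDC (fun y => (h x)⁻¹ * h y) x v := by
    have h2 : HasDC (fun y => (h x)⁻¹ * h y) x (lInv v ((h x)⁻¹ * h x)) := h1
    rwa [inv_mul_cancel, lInv_one] at h2
  have h3 : HasDC (fun y => ((h x)⁻¹ * h y)⁻¹) x ((-ContinuousLinearMap.id ℝ E) v) :=
    HasD.comp_curve (g := fun g : U => g⁻¹) (by simpa using hasD_inv) hk
  have h4 : HasDC (fun y => h x * ((h x)⁻¹ * h y)⁻¹ * (h x)⁻¹) x (Ad U (h x) (-v)) :=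
    HasD.comp_curve (g := fun k => h x * k * (h x)⁻¹) (g' := Ad U (h x))
      (by simpa using hasD_Ad (h x)) h3
  obtain ⟨h5, h6⟩ := (hasDC_one_iff (by simp)).1 h4
  refine hasVel_iff.2 ⟨(hasVel_iff.1 hv).1.inv, ?_⟩
  simpa [mul_assoc] using h6

end Curves

/-! ### Polynomials in skew operators -/

section SkewOperators

open Polynomial

/-- First-order Taylor expansion of a polynomial at `N`, for increments that commute with `N`. -/
theorem exists_norm_aeval_add_sub_le {A : Type*} [NormedRing A] [NormedAlgebra ℝ A] (N : A)
    (m : ℝ[X]) : ∃ C : ℝ, ∀ B : A, Commute N B → ‖B‖ ≤ 1 →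
      ‖aeval (N + B) m - aeval N m - B * aeval N (derivative m)‖ ≤ C * ‖B‖ ^ 2 := by
  induction m using Polynomial.induction_on' with
  | add p q hp hq =>
    obtain ⟨C, hC⟩ := hp
    obtain ⟨D, hD⟩ := hq
    refine ⟨C + D, fun B hB hB1 => ?_⟩
    have e : aeval (N + B) (p + q) - aeval N (p + q) - B * aeval N (derivative (p + q)) =
      (aeval (N + B) p - aeval N p - B * aeval N (derivative p)) +
      (aeval (N + B) q - aeval N q - B * aeval N (derivative q)) := by
      simp only [map_add, mul_add]; abel
    rw [e, add_mul]
    exact (norm_add_le _ _).trans (add_le_add (hC B hB hB1) (hD B hB hB1))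
  | monomial n c =>
    have key : ∃ C : ℝ, ∀ B : A, Commute N B → ‖B‖ ≤ 1 →
      ‖(N + B) ^ n - N ^ n - (n : A) * (B * N ^ (n - 1))‖ ≤ C * ‖B‖ ^ 2 := by
      induction n with
      | zero => exact ⟨0, fun B _ _ => by simp⟩
      | succ n ih =>
        obtain ⟨C, hC⟩ := ih
        refine ⟨max C 0 * (‖N‖ + 1) + ‖(n : A)‖ * ‖N ^ (n - 1)‖, fun B hB hB1 => ?_⟩
        have e : (N + B) ^ (n + 1) - N ^ (n + 1) - ((n + 1 : ℕ) : A) * (B * N ^ (n + 1 - 1)) =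
          ((N + B) ^ n - N ^ n - (n : A) * (B * N ^ (n - 1))) * (N + B) +
            (n : A) * (B * N ^ (n - 1) * B) := by
          have h1 : (n : A) * (B * N ^ (n - 1)) * N = (n : A) * (B * N ^ n) := by
            cases n with
            | zero => simp
            | succ k => simp [pow_succ, mul_assoc]
          have h2 : N ^ n * B = B * N ^ n := (hB.pow_left n).eq
          rw [sub_mul, sub_mul, mul_add ((n : A) * _), h1, pow_succ (N + B), mul_add (N ^ n), h2,
            pow_succ N]
          push_cast
          simp only [add_mul, one_mul, mul_assoc]
          abel
        rw [e]
        refine (norm_add_le _ _).trans ?_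
        rw [add_mul]
        refine add_le_add ?_ ?_
        · calc _ ≤ ‖(N + B) ^ n - N ^ n - (n : A) * (B * N ^ (n - 1))‖ * ‖N + B‖ := norm_mul_le _ _
            _ ≤ (max C 0 * ‖B‖ ^ 2) * (‖N‖ + 1) := by
              gcongr
              · exact (hC B hB hB1).trans (by gcongr; exact le_max_left _ _)
              · exact (norm_add_le _ _).trans (by gcongr)
            _ = _ := by ring
        · calc _ ≤ ‖(n : A)‖ * (‖B‖ * ‖N ^ (n - 1)‖ * ‖B‖) := by
                refine (norm_mul_le _ _).trans ?_
                gcongr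
                exact (norm_mul_le _ _).trans (by gcongr; exact norm_mul_le _ _)
            _ = _ := by ring
    obtain ⟨C, hC⟩ := key
    refine ⟨|c| * C, fun B hB hB1 => ?_⟩
    have e : aeval (N + B) (monomial n c) - aeval N (monomial n c) -
        B * aeval N (derivative (monomial n c)) =
        c • ((N + B) ^ n - N ^ n - (n : A) * (B * N ^ (n - 1))) := by
      rw [derivative_monomial]
      simp only [aeval_monomial, ← Algebra.smul_def, smul_sub]
      congr 1
      rw [mul_smul_comm, mul_smul]
      congr 1
      rw [← nsmul_eq_mul, Nat.cast_smul_eq_nsmul]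
    rw [e, norm_smul, Real.norm_eq_abs, mul_assoc]
    gcongr
    exact hC B hB hB1

/-- A root `N` of a polynomial without multiple roots is isolated among the roots commuting with it. -/
theorem exists_root_isolated {A : Type*} [NormedRing A] [NormedAlgebra ℝ A] (N : A)
    {m : ℝ[X]} (hm : m.Separable) (hN : aeval N m = 0) : ∃ δ > (0 : ℝ), ∀ B : A, Commute N B →
      ‖B‖ < δ → aeval (N + B) m = 0 → B = 0 := by
  obtain ⟨C, hC⟩ := exists_norm_aeval_add_sub_le N m
  obtain ⟨p, q, hpq⟩ := hm
  set D := ‖aeval N q‖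
  have h1 : aeval N (derivative m) * aeval N q = 1 := by
    have := congrArg (aeval N) hpq
    rw [map_add, map_mul, map_mul, hN, mul_zero, zero_add, map_one] at this
    rw [← map_mul, mul_comm, map_mul, this]
  refine ⟨min 1 (1 / (max C 0 * D + 1)), by positivity, fun B hB hB1 hr => ?_⟩
  have h2 := hC B hB (hB1.le.trans (min_le_left _ _))
  rw [hr, hN, sub_zero, zero_sub, norm_neg] at h2
  have h3 : ‖B‖ ≤ max C 0 * ‖B‖ ^ 2 * D := by
    calc ‖B‖ = ‖B * aeval N (derivative m) * aeval N q‖ := by rw [mul_assoc, h1, mul_one]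
      _ ≤ ‖B * aeval N (derivative m)‖ * D := norm_mul_le _ _
      _ ≤ C * ‖B‖ ^ 2 * D := by gcongr
      _ ≤ _ := by gcongr; exact le_max_left _ _
  by_contra hne
  have hpos : 0 < ‖B‖ := norm_pos_iff.2 hne
  have h4 : ‖B‖ * (max C 0 * D + 1) < 1 := by
    have := hB1.trans_le (min_le_right _ _)
    rwa [lt_div_iff₀ (by positivity)] at this
  nlinarith

variable {E : Type*} [NormedAddCommGroup E] [InnerProductSpace ℝ E] [FiniteDimensional ℝ E]

/-- A skew operator is semisimple, since orthogonal complements of invariant subspaces are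
invariant; so its minimal polynomial has no multiple factors. -/
theorem skew_minpoly_squarefree {N : E →L[ℝ] E} (hN : ∀ x y, ⟪N x, y⟫_ℝ = -⟪x, N y⟫_ℝ) :
    ∃ m : ℝ[X], Squarefree m ∧ aeval N m = 0 := by
  have hs : Module.End.IsSemisimple (N : E →ₗ[ℝ] E) := by
    rw [Module.End.isSemisimple_iff]
    intro p hp
    refine ⟨pᗮ, ?_, Submodule.isCompl_orthogonal p⟩
    intro x hx y hy
    have h1 : N y ∈ p := hp hy
    have h2 := hx _ h1
    rw [hN] at h2
    simpa using h2
  refine ⟨minpoly ℝ (N : E →ₗ[ℝ] E), hs.minpoly_squarefree, ?_⟩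
  have h := aeval_algHom_apply (Module.End.toContinuousLinearMap (𝕜 := ℝ) E).toAlgHom
    (N : E →ₗ[ℝ] E) (minpoly ℝ (N : E →ₗ[ℝ] E))
  rw [minpoly.aeval, map_zero] at h
  exact h

/-- A skew operator is regular in the sense of von Neumann, with a polynomial quasi-inverse. -/
theorem skew_exists_quasiInverse {N : E →L[ℝ] E} (hN : ∀ x y, ⟪N x, y⟫_ℝ = -⟪x, N y⟫_ℝ) :
    ∃ q : ℝ[X], aeval N (X - X ^ 2 * q) = 0 := by
  obtain ⟨m, hm, hmN⟩ := skew_minpoly_squarefree hN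
  -- it suffices to write `X` as a combination of `X ^ 2` and `m`, that is, to see that their
  -- greatest common divisor divides `X`; this holds as `X ^ 2` does not divide `m`
  have key : ∃ q r : ℝ[X], (X : ℝ[X]) - X ^ 2 * q = r * m := by
    by_cases hX : (X : ℝ[X]) ∣ m
    · obtain ⟨m₁, rfl⟩ := hX
      have hnd : ¬ (X : ℝ[X]) ∣ m₁ := by
        rintro ⟨m₂, rfl⟩
        exact irreducible_X.not_isUnit (hm X ⟨m₂, by ring⟩)
      obtain ⟨α, β, h⟩ := irreducible_X.coprime_iff_not_dvd.2 hnd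
      refine ⟨α, β, ?_⟩
      linear_combination -X * h
    · obtain ⟨α, β, h⟩ := irreducible_X.coprime_iff_not_dvd.2 hX
      refine ⟨α, β * X, ?_⟩
      linear_combination -X * h
  obtain ⟨q, r, h⟩ := key
  exact ⟨q, by rw [h, map_mul, hmN, mul_zero]⟩

theorem contDiff_aeval {F A : Type*} [NormedAddCommGroup F] [NormedSpace ℝ F] [NormedRing A]
    [NormedAlgebra ℝ A] {n : WithTop ℕ∞} {f : F → A} (hf : ContDiff ℝ n f) (q : ℝ[X]) :
    ContDiff ℝ n (fun x => aeval (f x) q) := by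
  induction q using Polynomial.induction_on' with
  | add p q hp hq => simpa using hp.add hq
  | monomial k c => simpa [aeval_monomial] using contDiff_const.mul (hf.pow k)

theorem aeval_conj {A : Type*} [Ring A] [Algebra ℝ A] {S S' N : A} (h : S' * S = 1) (h' : S * S' = 1)
    (q : ℝ[X]) :
    aeval (S * N * S') q = S * aeval N q * S' := by
  induction q using Polynomial.induction_on' with
  | add p q hp hq => simp [hp, hq, mul_add, add_mul]
  | monomial k c =>
    have : (S * N * S') ^ k = S * N ^ k * S' := by
      induction k with
      | zero => simp [h']
      | succ k ih =>
        rw [pow_succ, ih, pow_succ]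
        calc S * N ^ k * S' * (S * N * S') = S * N ^ k * (S' * S) * N * S' := by
              simp only [mul_assoc]
          _ = _ := by rw [h]; simp only [mul_assoc, mul_one]
    simp only [aeval_monomial, this, ← Algebra.smul_def, mul_smul_comm, smul_mul_assoc]

end SkewOperators

/-! ### The invariant inner product -/

section InvariantAlgebra

variable {E : Type*} [NormedAddCommGroup E] [InnerProductSpace ℝ E] [FiniteDimensional ℝ E]
variable {U : Type*} [TopologicalSpace U] [ChartedSpace E U] [Group U] [LieGroup 𝓘(ℝ, E) ∞ U]

theorem brk_antisymm (X Y : E) : brk U X Y = -brk U Y X := by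
  have := FiniteDimensional.complete ℝ E
  have : LieGroup 𝓘(ℝ, E) (minSmoothness ℝ 3) U := by
    rw [minSmoothness_of_isRCLikeNormedField]; infer_instance
  exact (lie_skew (L := GroupLieAlgebra 𝓘(ℝ, E) U) X Y).symm

theorem brk_self (X : E) : brk U X X = 0 := by
  have := FiniteDimensional.complete ℝ E
  have : LieGroup 𝓘(ℝ, E) (minSmoothness ℝ 3) U := by
    rw [minSmoothness_of_isRCLikeNormedField]; infer_instance
  exact lie_self (L := GroupLieAlgebra 𝓘(ℝ, E) U) X

/-- The Jacobi identity: `ad X` is a derivation. -/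
theorem brk_brk (X Y Z : E) : brk U X (brk U Y Z) = brk U (brk U X Y) Z + brk U Y (brk U X Z) := by
  have := FiniteDimensional.complete ℝ E
  have : LieGroup 𝓘(ℝ, E) (minSmoothness ℝ 3) U := by
    rw [minSmoothness_of_isRCLikeNormedField]; infer_instance
  exact leibniz_lie (L₁ := GroupLieAlgebra 𝓘(ℝ, E) U) (L₂ := GroupLieAlgebra 𝓘(ℝ, E) U)
    (M := GroupLieAlgebra 𝓘(ℝ, E) U) X Y Z

theorem brk_add_right (X Y Z : E) : brk U X (Y + Z) = brk U X Y + brk U X Z := by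
  simp only [← adL_apply, map_add]

theorem brk_sub_left (X Y Z : E) : brk U (X - Y) Z = brk U X Z - brk U Y Z := by
  simp only [← adL_apply, map_sub, sub_apply]

theorem brk_neg_left (X Z : E) : brk U (-X) Z = -brk U X Z := by
  simp only [← adL_apply, map_neg, neg_apply]

theorem brk_zero_left (Z : E) : brk U (0 : E) Z = 0 := by
  simp only [← adL_apply, map_zero, zero_apply]

theorem brk_zero_right (Z : E) : brk U Z (0 : E) = 0 := by
  simp only [← adL_apply, map_zero]

theorem mem_isotropy {p X : E} : X ∈ isotropy U p ↔ brk U X p = 0 := LinearMap.mem_ker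

theorem mem_isotropy' {p X : E} : X ∈ isotropy U p ↔ brk U p X = 0 := by
  rw [mem_isotropy, brk_antisymm, neg_eq_zero]

theorem mem_orbitTangent {p X : E} : X ∈ orbitTangent U p ↔ ∃ Y, brk U Y p = X := Iff.rfl

variable (U) in
theorem exists_hasVel_const (X : E) : ∃ c : ℝ → U, c 0 = 1 ∧ ∀ t ∈ Ioo (-2 : ℝ) 2, HasVel c X t := by
  have := FiniteDimensional.complete ℝ E
  obtain ⟨g, h0, h⟩ := exists_hasVel_Ioo (E := E) (U := U) (w := fun _ => X) continuous_const 0 1 2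
  exact ⟨g, h0, by simpa using h⟩

theorem exp_neg_mul_exp (X : E →L[ℝ] E) : NormedSpace.exp (-X) * NormedSpace.exp X = 1 := by
  have := FiniteDimensional.complete ℝ E
  let _ : NormedAlgebra ℚ (E →L[ℝ] E) := NormedAlgebra.restrictScalars ℚ ℝ _
  rw [← NormedSpace.exp_add_of_commute (Commute.refl X).neg_left]; simp

variable (U) in
/-- The one-parameter group of automorphisms generated by `ad X` lies in the Adjoint group. -/
theorem exists_Ad_eq_exp (X : E) : ∃ g : U, Ad U g = NormedSpace.exp (adL U X) := by
  have := FiniteDimensional.complete ℝ E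
  obtain ⟨c, c0, hc⟩ := exists_hasVel_const U X
  refine ⟨c 1, ?_⟩
  have hd : ∀ t ∈ Icc (0 : ℝ) 1, HasDerivAt (fun t : ℝ =>
      (Ad U (c t) : E →L[ℝ] E) * NormedSpace.exp (t • (-adL U X))) 0 t := by
    intro t ht
    have h1 : HasDerivAt (fun t => (Ad U (c t) : E →L[ℝ] E)) (Ad U (c t) * adL U X) t :=
      (hc t ⟨by linarith [ht.1], by linarith [ht.2]⟩).hasDerivAt_Ad
    have h2 := hasDerivAt_exp_smul_const' (𝕂 := ℝ) (-adL U X) t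
    have h3 := HasDerivAt.mul h1 h2
    rwa [mul_assoc, ← mul_add, neg_mul, add_neg_cancel, mul_zero] at h3
  have h := constant_of_has_deriv_right_zero
    (fun t ht => (hd t ht).continuousAt.continuousWithinAt)
    (fun t ht => (hd t ⟨ht.1, ht.2.le⟩).hasDerivWithinAt) 1 (by simp)
  simp only [c0, one_smul, zero_smul, NormedSpace.exp_zero, Ad_one] at h
  calc (Ad U (c 1) : E →L[ℝ] E)
      = Ad U (c 1) * (NormedSpace.exp (-adL U X) * NormedSpace.exp (adL U X)) := by
        rw [exp_neg_mul_exp, mul_one]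
    _ = NormedSpace.exp (adL U X) := by rw [← mul_assoc, h]; simp; rfl

/-- `Ad g` is an automorphism of the Lie algebra. -/
theorem Ad_brk (g : U) (X Y : E) : Ad U g (brk U X Y) = brk U (Ad U g X) (Ad U g Y) := by
  obtain ⟨c, c0, hc⟩ := exists_hasVel_const U X
  have h1 := hc 0 (by simp)
  have h1' : HasDC c 0 X := by
    have : HasDC c 0 (lInv X (c 0)) := h1
    rwa [c0, lInv_one] at this
  have h2 : HasVel (fun t => g * c t * g⁻¹) (Ad U g X) 0 := by
    have h := HasD.comp_curve (g := fun h => g * h * g⁻¹) (k := c) (g' := Ad U g)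
      (by rw [c0]; exact hasD_Ad g) h1'
    have e : lInv (Ad U g X) (g * c 0 * g⁻¹) = Ad U g X := by rw [c0]; simp [lInv_one]
    unfold HasVel
    rwa [e]
  have h3 := h2.hasDerivAt_Ad.clm_apply (hasDerivAt_const 0 (Ad U g Y))
  have h4 := (Ad U g : E →L[ℝ] E).hasFDerivAt.comp_hasDerivAt 0
    (h1.hasDerivAt_Ad.clm_apply (hasDerivAt_const 0 Y))
  have e : (fun t => Ad U (g * c t * g⁻¹) (Ad U g Y)) = fun t => Ad U g (Ad U (c t) Y) := by
    ext t; simp [Ad_mul_apply, Ad_inv_Ad]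
  rw [e] at h3
  have h5 := h4.unique h3
  simpa [c0, Ad_one] using h5

theorem adL_Ad (g : U) (p : E) :
    adL U (Ad U g p) = (Ad U g : E →L[ℝ] E) * adL U p * Ad U g⁻¹ := by
  ext X
  simp [Ad_brk, Ad_Ad_inv]

theorem Ad_mul_Ad_inv (g : U) : (Ad U g : E →L[ℝ] E) * Ad U g⁻¹ = 1 := by
  ext X; simp [Ad_Ad_inv]

theorem Ad_inv_mul_Ad (g : U) : (Ad U g⁻¹ : E →L[ℝ] E) * Ad U g = 1 := by
  ext X; simp [Ad_inv_Ad]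

variable (hinv : ∀ (g : U) (X Y : E), ⟪Ad U g X, Ad U g Y⟫_ℝ = ⟪X, Y⟫_ℝ)

include hinv

/-- An `Ad`-invariant inner product is invariant under the bracket. -/
theorem inner_brk (X Y Z : E) : ⟪brk U X Y, Z⟫_ℝ = -⟪Y, brk U X Z⟫_ℝ := by
  obtain ⟨c, c0, hc⟩ := exists_hasVel_const U X
  have h1 := (hc 0 (by simp)).hasDerivAt_Ad
  have h2 := (h1.clm_apply (hasDerivAt_const 0 Y)).inner ℝ (h1.clm_apply (hasDerivAt_const 0 Z))
  simp only [hinv, c0, Ad_one] at h2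
  have h3 := h2.unique (hasDerivAt_const (0 : ℝ) _)
  simp at h3
  linarith

theorem norm_Ad (g : U) (X : E) : ‖Ad U g X‖ = ‖X‖ := by
  rw [@norm_eq_sqrt_real_inner _ _ _ X, @norm_eq_sqrt_real_inner _ _ _ (Ad U g X), hinv]

theorem orbitTangent_orthogonal (p : E) : (orbitTangent U p)ᗮ = isotropy U p := by
  ext Y
  rw [Submodule.mem_orthogonal, mem_isotropy']
  constructor
  · intro h
    have := h (brk U (brk U p Y) p) ⟨_, rfl⟩
    rw [brk_antisymm, inner_neg_left, inner_brk hinv, neg_neg] at this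
    exact inner_self_eq_zero.1 this
  · rintro h _ ⟨X, rfl⟩
    change ⟪brk U X p, Y⟫_ℝ = 0
    rw [brk_antisymm, inner_neg_left, inner_brk hinv, h]; simp

theorem isotropy_orthogonal (p : E) : (isotropy U p)ᗮ = orbitTangent U p := by
  rw [← orbitTangent_orthogonal hinv, Submodule.orthogonal_orthogonal]

end InvariantAlgebra

/-! ### Regular elements of the Lie algebra -/

section Regular

variable {E : Type*} [NormedAddCommGroup E] [InnerProductSpace ℝ E] [FiniteDimensional ℝ E]
variable {U : Type*} [TopologicalSpace U] [ChartedSpace E U] [Group U] [LieGroup 𝓘(ℝ, E) ∞ U]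

theorem exp_smul_adL_apply {X p : E} (h : brk U X p = 0) (t : ℝ) :
    NormedSpace.exp (adL U (t • X)) p = p := by
  have hd : ∀ t : ℝ, HasDerivAt (fun t : ℝ => NormedSpace.exp (t • adL U X) p) 0 t := by
    intro t
    have h1 := (hasDerivAt_exp_smul_const (𝕂 := ℝ) (adL U X) t).clm_apply (hasDerivAt_const t p)
    simpa [h] using h1
  have := is_const_of_deriv_eq_zero (fun t => (hd t).differentiableAt) (fun t => (hd t).deriv) t 0
  simpa [NormedSpace.exp_zero] using this

/-- If the stabilizer of `a` fixes `b`, then `[X, a] = 0` implies `[X, b] = 0`: differentiate the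
one-parameter groups generated by `ad X`. -/
theorem isotropy_le_of_stabilizer {a b : E} (h : ∀ s : U, Ad U s a = a → Ad U s b = b) :
    isotropy U a ≤ isotropy U b := by
  intro X hX
  rw [mem_isotropy] at hX ⊢
  have hc : (fun t : ℝ => NormedSpace.exp (t • adL U X) b) = fun _ => b := by
    ext t
    obtain ⟨s, hs⟩ := exists_Ad_eq_exp U (t • X)
    have h1 : Ad U s a = a := by rw [hs, exp_smul_adL_apply hX]
    have h2 := h s h1
    rwa [hs, map_smul] at h2
  have h1 := (hasDerivAt_exp_smul_const (𝕂 := ℝ) (adL U X) 0).clm_apply (hasDerivAt_const 0 b)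
  rw [hc] at h1
  simpa [NormedSpace.exp_zero] using h1.unique (hasDerivAt_const 0 b)

theorem Ad_mem_isotropy {g : U} {X p : E} : Ad U g X ∈ isotropy U (Ad U g p) ↔ X ∈ isotropy U p := by
  rw [mem_isotropy, mem_isotropy, ← Ad_brk]
  refine ⟨fun h => ?_, fun h => by rw [h, map_zero]⟩
  have := Ad_inv_Ad g (brk U X p)
  rwa [h, map_zero, eq_comm] at this

theorem Ad_mem_orbitTangent {g : U} {X p : E} (h : X ∈ orbitTangent U p) :
    Ad U g X ∈ orbitTangent U (Ad U g p) := by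
  obtain ⟨Y, rfl⟩ := h
  exact ⟨Ad U g Y, (Ad_brk g Y p).symm⟩

theorem finrank_isotropy_Ad (g : U) (p : E) :
    Module.finrank ℝ (isotropy U p) ≤ Module.finrank ℝ (isotropy U (Ad U g p)) := by
  have hi : Function.Injective (Ad U g : E →L[ℝ] E) :=
    Function.LeftInverse.injective (g := Ad U g⁻¹) (Ad_inv_Ad g)
  rw [(Submodule.equivMapOfInjective (Ad U g : E →L[ℝ] E).toLinearMap hi _).finrank_eq]
  refine Submodule.finrank_mono ?_
  rintro _ ⟨X, hX, rfl⟩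
  exact Ad_mem_isotropy.2 hX

/-- The isotropy algebra of a regular element has the least dimension. -/
theorem IsRegular.finrank_isotropy_le {a : E} (hreg : IsRegular U a) (b : E) :
    Module.finrank ℝ (isotropy U a) ≤ Module.finrank ℝ (isotropy U b) := by
  obtain ⟨g, hg⟩ := hreg b
  have h1 : isotropy U a ≤ isotropy U (Ad U g⁻¹ b) := by
    refine isotropy_le_of_stabilizer fun s hs => ?_
    have := hg s hs
    rw [Ad_mul_apply, Ad_mul_apply] at this
    have h2 := congrArg (Ad U g⁻¹) this
    rwa [Ad_inv_Ad] at h2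
  have h2 := finrank_isotropy_Ad g (Ad U g⁻¹ b)
  rw [Ad_Ad_inv] at h2
  exact (Submodule.finrank_mono h1).trans h2

variable (hinv : ∀ (g : U) (X Y : E), ⟪Ad U g X, Ad U g Y⟫_ℝ = ⟪X, Y⟫_ℝ)

include hinv

omit hinv in
/-- On the orthogonal complement of its kernel, `ad a` is bounded below. -/
theorem exists_norm_brk_ge (a : E) : ∃ δ > (0 : ℝ), ∀ X ∈ (isotropy U a)ᗮ, δ * ‖X‖ ≤ ‖brk U X a‖ := by
  set f : (isotropy U a)ᗮ →ₗ[ℝ] E := (adRight U a).comp (isotropy U a)ᗮ.subtype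
  have hf : LinearMap.ker f = ⊥ := by
    refine LinearMap.ker_eq_bot'.2 fun X hX => ?_
    have h1 : (X : E) ∈ isotropy U a := hX
    exact Subtype.ext (inner_self_eq_zero.1 ((Submodule.mem_orthogonal _ _).1 X.2 _ h1))
  obtain ⟨K, hK, h⟩ := f.exists_antilipschitzWith hf
  refine ⟨(K : ℝ)⁻¹, by positivity, fun X hX => ?_⟩
  have := h.le_mul_dist ⟨X, hX⟩ 0
  rw [map_zero, dist_zero_right, dist_zero_right] at this
  rw [inv_mul_le_iff₀ (by positivity)]
  exact this

theorem brk_mem_isotropy_orthogonal {a c X : E} (hc : c ∈ isotropy U a) (hX : X ∈ (isotropy U a)ᗮ) :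
    brk U c X ∈ (isotropy U a)ᗮ := by
  rw [Submodule.mem_orthogonal] at hX ⊢
  intro Y hY
  rw [real_inner_comm, inner_brk hinv, real_inner_comm, hX, neg_zero]
  rw [mem_isotropy'] at *
  rw [brk_brk, hc, hY, brk_zero_left, brk_zero_right, add_zero]

/-- A small perturbation of `a` in its centralizer does not enlarge the centralizer. -/
theorem exists_isotropy_add_smul_le {a c : E} (hc : c ∈ isotropy U a) : ∃ r > (0 : ℝ), ∀ ε : ℝ,
    0 < ε → ε < r → isotropy U (a + ε • c) ≤ isotropy U a ⊓ isotropy U c := by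
  obtain ⟨δ, hδ, h⟩ := exists_norm_brk_ge (U := U) a
  refine ⟨δ / (‖adL U c‖ + 1), by positivity, fun ε hε hεr X hX => ?_⟩
  rw [lt_div_iff₀ (by positivity)] at hεr
  rw [mem_isotropy'] at hX
  set X₀ := (isotropy U a).starProjection X
  set X₁ := (isotropy U a)ᗮ.starProjection X
  have hX0 : X₀ ∈ isotropy U a := Submodule.starProjection_apply_mem _ _
  have hX1 : X₁ ∈ (isotropy U a)ᗮ := Submodule.starProjection_apply_mem _ _
  have hXX : X = X₀ + X₁ := (Submodule.starProjection_add_starProjection_orthogonal X).symm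
  have h0 : ε • brk U c X₀ ∈ isotropy U a := by
    refine Submodule.smul_mem _ _ ?_
    rw [mem_isotropy'] at *
    rw [brk_brk, hc, hX0, brk_zero_left, brk_zero_right, add_zero]
  have h1 : brk U a X₁ + ε • brk U c X₁ ∈ (isotropy U a)ᗮ :=
    add_mem (brk_mem_isotropy_orthogonal hinv (mem_isotropy.2 (brk_self a)) hX1)
      (Submodule.smul_mem _ _ (brk_mem_isotropy_orthogonal hinv hc hX1))
  have hsum : ε • brk U c X₀ + (brk U a X₁ + ε • brk U c X₁) = 0 := by
    rw [hXX] at hX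
    rw [mem_isotropy'] at hX0
    simp only [← adL_apply, map_add, map_smul, add_apply, smul_apply] at hX hX0 ⊢
    rw [← hX, hX0]; module
  have h0' : ε • brk U c X₀ = 0 := by
    have h2 : ε • brk U c X₀ ∈ (isotropy U a)ᗮ := by
      rw [eq_neg_of_add_eq_zero_left hsum]; exact neg_mem h1
    exact inner_self_eq_zero.1 ((Submodule.mem_orthogonal _ _).1 h2 _ h0)
  have hX1z : X₁ = 0 := by
    rw [h0', zero_add] at hsum
    have h3 := h X₁ hX1
    rw [brk_antisymm, norm_neg, eq_neg_of_add_eq_zero_left hsum, norm_neg, norm_smul,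
      Real.norm_of_nonneg hε.le, ← adL_apply] at h3
    have h4 := (adL U c).le_opNorm X₁
    by_contra hne
    have h5 : 0 < ‖X₁‖ := norm_pos_iff.2 hne
    nlinarith [norm_nonneg (adL U c), mul_le_mul_of_nonneg_left h4 hε.le, mul_pos hε h5]
  rw [hX1z, add_zero] at hXX
  rw [hXX]
  exact ⟨hX0, mem_isotropy'.2 ((smul_eq_zero.1 h0').resolve_left hε.ne')⟩

/-- For regular `a` the dimension of the centralizer is least, so the centralizer of `a + ε c`
cannot be smaller than that of `a`; hence the latter centralizes `c`, and `𝔲_a` is abelian. -/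
theorem IsRegular.isotropy_add_smul {a c : E} (hreg : IsRegular U a) (hc : c ∈ isotropy U a) :
    isotropy U a ≤ isotropy U c ∧ ∃ r > (0 : ℝ), ∀ ε : ℝ,
      0 < ε → ε < r → isotropy U (a + ε • c) = isotropy U a := by
  obtain ⟨r, hr, h⟩ := exists_isotropy_add_smul_le hinv hc
  have key : ∀ ε : ℝ, 0 < ε → ε < r → isotropy U (a + ε • c) = isotropy U a := fun ε h1 h2 =>
    Submodule.eq_of_le_of_finrank_le ((h ε h1 h2).trans inf_le_left) (hreg.finrank_isotropy_le _)
  refine ⟨?_, r, hr, key⟩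
  rw [← key (r / 2) (by positivity) (by linarith)]
  exact (h (r / 2) (by positivity) (by linarith)).trans inf_le_right

/-- The centralizer of a regular element of a maximal abelian subalgebra is that subalgebra. -/
theorem IsRegular.isotropy_eq {a : E} (hreg : IsRegular U a) {T : Submodule ℝ E}
    (hT : IsMaximalAbelian U T) (ha : a ∈ T) : isotropy U a = T := by
  refine le_antisymm ?_ fun X hX => mem_isotropy.2 (hT.prop X hX a ha)
  refine hT.le_of_ge (y := isotropy U a) ?_ fun X hX => mem_isotropy.2 (hT.prop X hX a ha)
  intro X hX Y hY
  exact mem_isotropy.1 ((hreg.isotropy_add_smul hinv hY).1 hX)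

variable [T2Space U] [CompactSpace U]

omit hinv in
/-- An element of the group that moves `a` very little moves it as an element close to the identity
does. -/
theorem exists_mem_stabilizer_of_norm_lt (a : E) {N : Set U} (hN : N ∈ 𝓝 (1 : U)) :
    ∃ δ > (0 : ℝ), ∀ s : U, ‖Ad U s a - a‖ < δ → ∃ n ∈ N, Ad U s a = Ad U n a := by
  have := topologicalGroup_of_lieGroup 𝓘(ℝ, E) ∞ (G := U)
  obtain ⟨O, hON, hO, h1⟩ := mem_nhds_iff.1 hN
  set W : Set U := ⋃ h ∈ {h : U | Ad U h a = a}, (fun s => s * h⁻¹) ⁻¹' O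
  have hW : IsOpen W := isOpen_biUnion fun h _ => hO.preimage (continuous_mul_const _)
  have hWe : ∀ s ∈ W, ∃ n ∈ N, Ad U s a = Ad U n a := by
    intro s hs
    simp only [W, mem_iUnion, mem_preimage] at hs
    obtain ⟨h, hh, hs⟩ := hs
    refine ⟨s * h⁻¹, hON hs, ?_⟩
    have : Ad U h⁻¹ a = a := by
      conv_lhs => rw [← show Ad U h a = a from hh]
      exact Ad_inv_Ad h a
    rw [Ad_mul_apply, this]
  have hf : Continuous fun s : U => ‖Ad U s a - a‖ :=
    ((continuous_Ad.clm_apply continuous_const).sub continuous_const).norm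
  rcases Wᶜ.eq_empty_or_nonempty with h | h
  · refine ⟨1, one_pos, fun s _ => hWe s ?_⟩
    rw [compl_empty_iff.1 h]; trivial
  obtain ⟨s₀, hs₀, hmin⟩ := hW.isClosed_compl.isCompact.exists_isMinOn h hf.continuousOn
  refine ⟨‖Ad U s₀ a - a‖, ?_, fun s hs => hWe s ?_⟩
  · refine norm_pos_iff.2 fun h0 => hs₀ ?_
    simp only [W, mem_iUnion, mem_preimage]
    exact ⟨s₀, sub_eq_zero.1 h0, by simpa using h1⟩
  · by_contra hsW
    exact absurd (hmin hsW) (not_le.2 hs)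

theorem adL_skew (p X Y : E) : ⟪adL U p X, Y⟫_ℝ = -⟪X, adL U p Y⟫_ℝ := by
  simpa using inner_brk hinv p X Y

/-- An element that moves `a` very little inside its centralizer fixes `a`. -/
theorem exists_Ad_eq_self (a : E) : ∃ δ > (0 : ℝ), ∀ s : U,
    ‖Ad U s a - a‖ < δ → Ad U s a ∈ isotropy U a → Ad U s a = a := by
  obtain ⟨m, hm, hm0⟩ := skew_minpoly_squarefree (adL_skew hinv a)
  obtain ⟨δ, hδ, hroot⟩ := exists_root_isolated (adL U a) (PerfectField.separable_iff_squarefree.2 hm)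
    hm0
  obtain ⟨δ', hδ', hn⟩ := exists_mem_stabilizer_of_norm_lt a
    (Ad_central_eventually (E := E) (U := U))
  refine ⟨min δ' (δ / (‖adL U (E := E)‖ + 1)), by positivity, fun s hs hsa => ?_⟩
  set Z := Ad U s a - a
  have hZ : Z ∈ isotropy U a := sub_mem hsa (mem_isotropy.2 (brk_self a))
  have hsZ : Ad U s a = a + Z := by simp [Z]
  have hcomm : Commute (adL U a) (adL U Z) := by
    ext X
    simp [brk_brk a Z X, mem_isotropy'.1 hZ, brk_zero_left]
  have hsmall : ‖adL U Z‖ < δ := by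
    have h1 := (lt_div_iff₀ (by positivity)).1 (hs.trans_le (min_le_right _ _))
    have h2 := (adL U (E := E)).le_opNorm Z
    nlinarith [norm_nonneg Z]
  -- `ad (a + Z)` is conjugate to `ad a`, so it is a root of the same polynomial, and roots that
  -- commute with `ad a` are isolated: `Z` is central
  have hz : adL U Z = 0 := by
    refine hroot _ hcomm hsmall ?_
    rw [← map_add, ← hsZ, adL_Ad, aeval_conj (Ad_inv_mul_Ad s) (Ad_mul_Ad_inv s), hm0]
    simp
  -- replace `s` by an element `n` close to the identity, which fixes the central element `Z`; by
  -- invariance `⟪a, Z⟫ = ⟪a + Z, Z⟫`, so `Z = 0`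
  obtain ⟨n, hnZ, hna⟩ := hn s (hs.trans_le (min_le_left _ _))
  have h1 : Ad U n Z = Z := hnZ Z fun X => by
    rw [brk_antisymm, ← adL_apply, hz]; simp
  have h2 := hinv n a Z
  rw [h1, ← hna, hsZ, inner_add_left, add_eq_left] at h2
  rw [hsZ, inner_self_eq_zero.1 h2, add_zero]

/-- The stabilizer of a regular element acts trivially on its centralizer, so that every element of
the centralizer gives a well defined field on the orbit. -/
theorem IsRegular.stabilizer_fixes {a : E} (hreg : IsRegular U a) {c : E} (hc : c ∈ isotropy U a)
    {s : U} (hs : Ad U s a = a) : Ad U s c = c := by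
  have := topologicalGroup_of_lieGroup 𝓘(ℝ, E) ∞ (G := U)
  obtain ⟨δ, hδ, hfix⟩ := exists_Ad_eq_self hinv a
  obtain ⟨-, r, hr, hiso⟩ := hreg.isotropy_add_smul hinv hc
  obtain ⟨ε, hε0, hεr, hεδ⟩ : ∃ ε : ℝ, 0 < ε ∧ ε < r ∧ ε * (2 * ‖c‖) < δ := by
    refine ⟨min (r / 2) (δ / (2 * ‖c‖ + 1)), by positivity, ?_, ?_⟩
    · exact (min_le_left _ _).trans_lt (by linarith)
    · have h1 : min (r / 2) (δ / (2 * ‖c‖ + 1)) ≤ δ / (2 * ‖c‖ + 1) := min_le_right _ _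
      have h2 : δ / (2 * ‖c‖ + 1) * (2 * ‖c‖ + 1) = δ := by field_simp
      have h3 : 0 < min (r / 2) (δ / (2 * ‖c‖ + 1)) := by positivity
      nlinarith [norm_nonneg c]
  set b := a + ε • c with hb
  have hbb : isotropy U b = isotropy U a := hiso ε hε0 hεr
  -- the stabilizer of `b` is contained in that of `a`
  have hba : ∀ s : U, Ad U s b = b → Ad U s a = a := by
    intro s hsb
    have e : Ad U s a - a = ε • (c - Ad U s c) := by
      rw [hb, map_add, map_smul] at hsb
      rw [smul_sub, sub_eq_sub_iff_add_eq_add, hsb, add_comm]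
    refine hfix s ?_ ?_
    · rw [e, norm_smul, Real.norm_of_nonneg hε0.le]
      refine lt_of_le_of_lt (mul_le_mul_of_nonneg_left ?_ hε0.le) hεδ
      refine (norm_sub_le _ _).trans ?_
      rw [norm_Ad hinv]; linarith
    · rw [← hbb, ← hsb, Ad_mem_isotropy, hbb, mem_isotropy]
      exact brk_self a
  obtain ⟨g, hg⟩ := hreg b
  -- conjugation by `g` maps the stabilizer of `a` into the stabilizer of `b`, hence into itself
  have hga : ∀ (n : ℕ) (s : U), Ad U s a = a → Ad U (g ^ n * s * (g ^ n)⁻¹) a = a := by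
    intro n
    induction n with
    | zero => intro s hs; simpa using hs
    | succ n ih =>
      intro s hs
      have := hba _ (hg _ (ih s hs))
      convert this using 3
      rw [pow_succ']; group
  -- by compactness powers of `g` accumulate at the identity, so conjugation by `g⁻¹` preserves the
  -- (closed) stabilizer of `a` as well
  have hcl : Ad U (g⁻¹ * s * g) a = a := by
    by_contra hne
    have hopen : ∀ᶠ x in 𝓝 (1 : U), Ad U (g⁻¹ * x * s * (g⁻¹ * x)⁻¹) a ≠ a := by
      have hcont : Continuous fun x : U => Ad U (g⁻¹ * x * s * (g⁻¹ * x)⁻¹) a :=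
        (continuous_Ad.comp (by fun_prop)).clm_apply continuous_const
      refine hcont.continuousAt.eventually_ne ?_
      simpa using hne
    have hfr := (mapClusterPt_one_atTop_pow g).frequently hopen
    obtain ⟨n, hn1, hn⟩ := frequently_atTop.1 hfr 1
    obtain ⟨n, rfl⟩ := Nat.exists_eq_add_of_le' hn1
    refine hn ?_
    have := hga n s hs
    convert this using 3
    rw [pow_succ']; group
  have h1 := hg _ hcl
  have h2 : Ad U s b = b := by convert h1 using 3; group
  rw [hb, map_add, hs, map_smul, add_right_inj] at h2
  exact smul_right_injective _ hε0.ne' h2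

end Regular

/-! ### Geometry of Adjoint orbits -/

section OrbitGeometry

/-- Solutions of linear differential equations with smooth coefficients are smooth. -/
theorem contDiff_of_linear_ode {F : Type*} [NormedAddCommGroup F] [NormedSpace ℝ F]
    {B : ℝ → F →L[ℝ] F} (hB : ContDiff ℝ ∞ B) {y : ℝ → F} (hy : ∀ x, HasDerivAt y (B x (y x)) x) :
    ContDiff ℝ ∞ y := by
  refine contDiff_infty.2 fun n => ?_
  induction n with
  | zero => exact contDiff_zero.2 (continuous_iff_continuousAt.2 fun x => (hy x).continuousAt)
  | succ n ih =>
    push_cast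
    refine contDiff_succ_iff_deriv.2 ⟨fun x => (hy x).differentiableAt, by simp, ?_⟩
    rw [show deriv y = fun x => B x (y x) from funext fun x => (hy x).deriv]
    exact (hB.of_le (by exact_mod_cast le_top)).clm_apply ih

variable {E : Type*} [NormedAddCommGroup E] [InnerProductSpace ℝ E] [FiniteDimensional ℝ E]
variable {U : Type*} [TopologicalSpace U] [ChartedSpace E U] [Group U] [LieGroup 𝓘(ℝ, E) ∞ U]

open Polynomial Classical in
variable (U) in
/-- A polynomial `q` with `N = N² q(N)` for `N = ad a`, hence for `N = ad p` at every `p` of the orbit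
of `a`. -/
def quasiInvPoly (a : E) : ℝ[X] :=
  if h : ∃ q : ℝ[X], aeval (adL U a) (X - X ^ 2 * q) = 0 then h.choose else 0

open Polynomial in
variable (U) in
/-- The inverse of the infinitesimal action at `p`, extended by zero to the normal space: the element
`Y = omega U a p X` is tangent to the orbit and `[Y, p]` is the tangential part of `X`.  It is a
polynomial in `ad p`, the same for all points `p` of the orbit of `a`. -/
def omega (a p : E) : E →L[ℝ] E := -aeval (adL U p) (X * quasiInvPoly U a ^ 2)

theorem contDiff_omega (a : E) : ContDiff ℝ ∞ (omega U a) :=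
  (contDiff_aeval (adL U (E := E)).contDiff _).neg

open Polynomial in
/-- Equivariance of the tangent pseudo-inverse. -/
theorem omega_Ad (a : E) (g : U) (p X : E) :
    omega U a (Ad U g p) (Ad U g X) = Ad U g (omega U a p X) := by
  simp only [omega]
  rw [adL_Ad, aeval_conj (Ad_inv_mul_Ad g) (Ad_mul_Ad_inv g)]
  simp [Ad_inv_Ad]

theorem mem_adOrbit_self (a : E) : a ∈ adOrbit U a := ⟨1, by simp [Ad_one]⟩

theorem Ad_mem_adOrbit {a p : E} (g : U) (hp : p ∈ adOrbit U a) : Ad U g p ∈ adOrbit U a := by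
  obtain ⟨h, rfl⟩ := hp
  exact ⟨g * h, Ad_mul_apply g h a⟩

theorem adOrbit_eq {a p : E} (hp : p ∈ adOrbit U a) : adOrbit U p = adOrbit U a := by
  obtain ⟨h, rfl⟩ := hp
  ext q
  constructor
  · rintro ⟨g, rfl⟩; exact ⟨g * h, Ad_mul_apply g h a⟩
  · rintro ⟨g, rfl⟩
    exact ⟨g * h⁻¹, by simp [Ad_mul_apply, Ad_inv_Ad]⟩

theorem IsOrbitCurve.of_mem {a p : E} {c : ℝ → E} (hp : p ∈ adOrbit U a) (hc : IsOrbitCurve U p c) :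
    IsOrbitCurve U a c :=
  ⟨hc.smooth, fun s => adOrbit_eq hp ▸ hc.mem s, hc.tangent⟩

theorem tanProj_mem (p X : E) : tanProj U p X ∈ orbitTangent U p :=
  Submodule.starProjection_apply_mem _ _

theorem tanProj_add_norProj (p X : E) : tanProj U p X + norProj U p X = X :=
  Submodule.starProjection_add_starProjection_orthogonal X

theorem tanProj_eq_self {p X : E} (h : X ∈ orbitTangent U p) : tanProj U p X = X :=
  Submodule.starProjection_eq_self_iff.2 h

theorem tanProj_eq_of_sub_mem {p X Y : E} (hY : Y ∈ orbitTangent U p)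
    (h : X - Y ∈ (orbitTangent U p)ᗮ) : tanProj U p X = Y :=
  (Submodule.eq_starProjection_of_mem_orthogonal hY h)

theorem adL_mul_Ad_inv_lift {g : ℝ → U} {w : E} {x : ℝ} (h : HasVel (fun y => (g y)⁻¹) (-w) x) :
    HasVel g (Ad U (g x)⁻¹ w) x := by
  have := h.inv
  simpa using this

variable (hinv : ∀ (g : U) (X Y : E), ⟪Ad U g X, Ad U g Y⟫_ℝ = ⟪X, Y⟫_ℝ)

theorem Ad_adL_Ad_inv (g : U) (w : E) :
    (Ad U g).comp (adL U (Ad U g⁻¹ w)) = (adL U w).comp (Ad U g) := by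
  ext X; simp [Ad_brk, Ad_Ad_inv]

include hinv

open Polynomial in
theorem quasiInvPoly_spec {a p : E} (hp : p ∈ adOrbit U a) :
    adL U p = adL U p * (adL U p * aeval (adL U p) (quasiInvPoly U a)) := by
  have h : ∃ q : ℝ[X], aeval (adL U a) (X - X ^ 2 * q) = 0 := skew_exists_quasiInverse
    fun X Y => by simpa using inner_brk hinv a X Y
  have h1 : aeval (adL U a) (X - X ^ 2 * quasiInvPoly U a) = 0 := by
    rw [quasiInvPoly, dif_pos h]; exact h.choose_spec
  obtain ⟨g, rfl⟩ := hp
  have h2 : aeval (adL U (Ad U g a)) (X - X ^ 2 * quasiInvPoly U a) = 0 := by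
    rw [adL_Ad, aeval_conj (Ad_inv_mul_Ad g) (Ad_mul_Ad_inv g), h1]; simp
  simp only [map_sub, aeval_X, map_mul, map_pow, sub_eq_zero] at h2
  rw [← mul_assoc, ← pow_two]; exact h2

omit hinv in
open Polynomial in
theorem omega_mem {a p : E} (X : E) : omega U a p X ∈ orbitTangent U p := by
  refine ⟨aeval (adL U p) (quasiInvPoly U a ^ 2) X, ?_⟩
  change brk U _ p = _
  rw [brk_antisymm, omega]
  simp

/-- `omega` inverts the infinitesimal action: `[omega X, p]` is the tangential part of `X`. -/
theorem brk_omega {a p : E} (hp : p ∈ adOrbit U a) (X : E) :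
    brk U (omega U a p X) p = tanProj U p X := by
  set N := adL U p
  set Q := Polynomial.aeval N (quasiInvPoly U a)
  have hN : N = N * (N * Q) := quasiInvPoly_spec hinv hp
  have hc : Commute N Q := by
    have := (Commute.all (Polynomial.X : Polynomial ℝ) (quasiInvPoly U a)).map (Polynomial.aeval N)
    simpa using this
  have e : brk U (omega U a p X) p = N (Q X) := by
    have : N * (N * Q ^ 2) = N * Q := by
      conv_rhs => rw [hN]
      rw [pow_two, ← mul_assoc N Q Q, ← mul_assoc N (N * Q) Q]
    rw [brk_antisymm, ← adL_apply, omega]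
    change -N (-_) = _
    rw [map_neg, neg_neg, map_mul, Polynomial.aeval_X, map_pow]
    exact DFunLike.congr_fun this X
  rw [e]
  refine (tanProj_eq_of_sub_mem ⟨-Q X, ?_⟩ ?_).symm
  · change brk U _ p = _
    rw [brk_neg_left, brk_antisymm, neg_neg, ← adL_apply]
  · rw [orbitTangent_orthogonal hinv, mem_isotropy', ← adL_apply, map_sub, sub_eq_zero]
    exact DFunLike.congr_fun hN X

theorem eq_of_brk_eq {p X Y : E} (hX : X ∈ orbitTangent U p) (hY : Y ∈ orbitTangent U p)
    (h : brk U X p = brk U Y p) : X = Y := by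
  have h1 : X - Y ∈ isotropy U p := by rw [mem_isotropy, brk_sub_left, h, sub_self]
  rw [← orbitTangent_orthogonal hinv] at h1
  exact sub_eq_zero.1 (inner_self_eq_zero.1 ((Submodule.mem_orthogonal _ _).1 h1 _ (sub_mem hX hY)))

theorem omega_brk {a p X : E} (hp : p ∈ adOrbit U a) (hX : X ∈ orbitTangent U p) :
    omega U a p (brk U X p) = X :=
  eq_of_brk_eq hinv (omega_mem _) hX (by
    rw [brk_omega hinv hp, tanProj_eq_self (mem_orbitTangent.2 ⟨X, rfl⟩)])

theorem norm_omega_le {a p : E} (hp : p ∈ adOrbit U a) (X : E) :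
    ‖omega U a p X‖ ≤ ‖omega U a a‖ * ‖X‖ := by
  obtain ⟨g, rfl⟩ := hp
  have h := omega_Ad a g a (Ad U g⁻¹ X)
  rw [Ad_Ad_inv] at h
  rw [h, norm_Ad hinv, ← norm_Ad hinv g⁻¹ X]
  exact (omega U a a).le_opNorm _

theorem norm_of_mem_adOrbit {a p : E} (hp : p ∈ adOrbit U a) : ‖p‖ = ‖a‖ := by
  obtain ⟨g, rfl⟩ := hp
  exact norm_Ad hinv g a

theorem brk_isotropy_mem_orbitTangent {p X Y : E} (hX : X ∈ isotropy U p) (hY : Y ∈ orbitTangent U p) :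
    brk U Y X ∈ orbitTangent U p := by
  rw [← isotropy_orthogonal hinv] at hY ⊢
  rw [brk_antisymm]
  exact neg_mem (brk_mem_isotropy_orthogonal hinv hX hY)

/-- A curve in the orbit lifts, near each parameter, to a curve `g` in the group, whose velocity is
chosen tangent to the orbit. -/
theorem IsOrbitCurve.exists_lift {a : E} {c : ℝ → E} (hc : IsOrbitCurve U a c) (s₀ : ℝ) :
    ∃ g : ℝ → U, g s₀ = 1 ∧ ∀ s ∈ Ioo (s₀ - 1) (s₀ + 1), c s = Ad U (g s) (c s₀) ∧
      HasDerivAt (fun s => (Ad U (g s) : E →L[ℝ] E))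
        ((adL U (omega U a (c s) (deriv c s))).comp (Ad U (g s))) s := by
  have := FiniteDimensional.complete ℝ E
  set w : ℝ → E := fun s => omega U a (c s) (deriv c s) with hw
  have hws : Continuous w := ((contDiff_omega a).comp hc.smooth).continuous.clm_apply
    (hc.smooth.continuous_deriv (by simp))
  obtain ⟨h, h0, hh⟩ := exists_hasVel_Ioo (E := E) (U := U) hws.neg s₀ 1 1
  have hd : ∀ s ∈ Ioo (s₀ - 1) (s₀ + 1), HasDerivAt (fun s => Ad U (h s) (c s)) 0 s := by
    intro s hs
    have h1 := (hh s hs).hasDerivAt_Ad.clm_apply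
      (hc.smooth.differentiable (by simp) s).hasDerivAt
    have h2 : brk U (w s) (c s) = deriv c s := by
      rw [hw, brk_omega hinv (hc.mem s), tanProj_eq_self (hc.tangent s)]
    simpa [h2] using h1
  refine ⟨fun s => (h s)⁻¹, by simp [h0], fun s hs => ⟨?_, ?_⟩⟩
  · have h1 := isOpen_Ioo.is_const_of_deriv_eq_zero (isPreconnected_Ioo)
      (fun s hs => (hd s hs).differentiableAt.differentiableWithinAt) (fun s hs => (hd s hs).deriv)
      hs (show s₀ ∈ Ioo (s₀ - 1) (s₀ + 1) by simp)
    simp only [h0, Ad_one] at h1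
    have h2 := Ad_inv_Ad (h s) (c s)
    rw [h1] at h2
    exact h2.symm
  · have h1 := (adL_mul_Ad_inv_lift (g := fun s => (h s)⁻¹) (w := w s) (x := s)
      (by simpa using hh s hs)).hasDerivAt_Ad
    rwa [Ad_adL_Ad_inv] at h1

/-- The normal part of the derivative of a tangent field along a curve of the orbit. -/
theorem IsOrbitCurve.norProj_deriv {a : E} {c Z : ℝ → E} (hc : IsOrbitCurve U a c)
    (hZ : Differentiable ℝ Z) (hZt : ∀ s, Z s ∈ orbitTangent U (c s)) (s : ℝ) :
    norProj U (c s) (deriv Z s) = norProj U (c s) (brk U (omega U a (c s) (deriv c s)) (Z s)) := by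
  obtain ⟨g, g0, hg⟩ := hc.exists_lift hinv s
  have hs : s ∈ Ioo (s - 1) (s + 1) := by simp
  have key : deriv Z s - brk U (omega U a (c s) (deriv c s)) (Z s) ∈ (orbitTangent U (c s))ᗮᗮ := by
    refine (Submodule.mem_orthogonal _ _).2 fun n hn => ?_
    have h1 := ((hg s hs).2.clm_apply (hasDerivAt_const s n)).inner ℝ (hZ s).hasDerivAt
    have h2 : (fun t => ⟪Ad U (g t) n, Z t⟫_ℝ) =ᶠ[𝓝 s] fun _ => 0 := by
      filter_upwards [isOpen_Ioo.mem_nhds hs] with t ht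
      rw [orbitTangent_orthogonal hinv] at hn
      have h3 : Ad U (g t) n ∈ isotropy U (c t) := by rw [(hg t ht).1]; exact Ad_mem_isotropy.2 hn
      rw [← orbitTangent_orthogonal hinv] at h3
      exact (Submodule.mem_orthogonal' _ _).1 h3 _ (hZt t)
    have h3 := h1.unique ((hasDerivAt_const s (0 : ℝ)).congr_of_eventuallyEq h2)
    simp only [g0, Ad_one] at h3
    simp at h3
    rw [inner_sub_right, ← h3, inner_brk hinv]; ring
  rw [Submodule.orthogonal_orthogonal] at key
  rw [← sub_eq_zero, norProj, norProj, ← map_sub]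
  exact (Submodule.starProjection_apply_eq_zero_iff _).2 (by rwa [Submodule.orthogonal_orthogonal])

/-- The tangential part of the derivative of a normal field along a curve of the orbit. -/
theorem IsOrbitCurve.tanProj_deriv {a : E} {c ν : ℝ → E} (hc : IsOrbitCurve U a c)
    (hν : Differentiable ℝ ν) (hνn : ∀ s, ν s ∈ (orbitTangent U (c s))ᗮ) (s : ℝ) :
    tanProj U (c s) (deriv ν s) = brk U (omega U a (c s) (deriv c s)) (ν s) := by
  obtain ⟨g, g0, hg⟩ := hc.exists_lift hinv s
  have hs : s ∈ Ioo (s - 1) (s + 1) := by simp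
  refine tanProj_eq_of_sub_mem ?_ ?_
  · refine brk_isotropy_mem_orbitTangent hinv ?_ (omega_mem _)
    rw [← orbitTangent_orthogonal hinv]
    exact hνn s
  refine (Submodule.mem_orthogonal _ _).2 fun n hn => ?_
  have h1 := ((hg s hs).2.clm_apply (hasDerivAt_const s n)).inner ℝ (hν s).hasDerivAt
  have h2 : (fun t => ⟪Ad U (g t) n, ν t⟫_ℝ) =ᶠ[𝓝 s] fun _ => 0 := by
    filter_upwards [isOpen_Ioo.mem_nhds hs] with t ht
    have h3 : Ad U (g t) n ∈ orbitTangent U (c t) := by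
      rw [(hg t ht).1]; exact Ad_mem_orbitTangent hn
    exact (Submodule.mem_orthogonal _ _).1 (hνn t) _ h3
  have h3 := h1.unique ((hasDerivAt_const s (0 : ℝ)).congr_of_eventuallyEq h2)
  simp only [g0, Ad_one] at h3
  simp at h3
  rw [inner_sub_right, ← h3, inner_brk hinv]; ring

omit hinv in
variable (U) in
theorem hasDerivAt_exp_adL (X Y : E) (s : ℝ) : HasDerivAt (fun s : ℝ =>
    NormedSpace.exp (s • adL U X) Y) (brk U X (NormedSpace.exp (s • adL U X) Y)) s := by
  have h1 := (hasDerivAt_exp_smul_const' (𝕂 := ℝ) (adL U X) s).clm_apply (hasDerivAt_const s Y)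
  simpa using h1

omit hinv in
theorem contDiff_exp_adL (X Y : E) : ContDiff ℝ ∞ fun s : ℝ => NormedSpace.exp (s • adL U X) Y :=
  contDiff_of_linear_ode (B := fun _ => adL U X) contDiff_const
    fun s => by simpa using hasDerivAt_exp_adL U X Y s

omit hinv in
theorem exists_Ad_eq_exp_smul (X : E) (s : ℝ) :
    ∃ g : U, Ad U g = NormedSpace.exp (s • adL U X) := by
  simpa using exists_Ad_eq_exp U (s • X)

omit hinv in
theorem isOrbitCurve_exp (p X : E) :
    IsOrbitCurve U p fun s : ℝ => NormedSpace.exp (s • adL U X) p where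
  smooth := contDiff_exp_adL X p
  mem s := by
    obtain ⟨g, hg⟩ := exists_Ad_eq_exp_smul (U := U) X s
    exact ⟨g, DFunLike.congr_fun hg p⟩
  tangent s := by
    rw [(hasDerivAt_exp_adL U X p s).deriv]
    exact ⟨X, rfl⟩

/-- The value does not depend on the curve and the field used to compute it; the curve `exp (s ad
Z) p` with `[Z, p] = X`, and `Y` transported along it, show that such a pair exists. -/
theorem secondFF_eq {a p X Y : E} (hp : p ∈ adOrbit U a) (hX : X ∈ orbitTangent U p)
    (hY : Y ∈ orbitTangent U p) :
    secondFF U p X Y = norProj U p (brk U (omega U a p X) Y) := by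
  have hex : ∃ n, IsSecondFF U p X Y n := by
    refine ⟨_, fun s : ℝ => NormedSpace.exp (s • adL U (omega U a p X)) p,
      fun s : ℝ => NormedSpace.exp (s • adL U (omega U a p X)) Y, isOrbitCurve_exp _ _,
      by simp [NormedSpace.exp_zero], ?_, contDiff_exp_adL _ _, fun s => ?_,
      by simp [NormedSpace.exp_zero], rfl⟩
    · rw [(hasDerivAt_exp_adL U _ p 0).deriv]
      simp [NormedSpace.exp_zero, brk_omega hinv hp, tanProj_eq_self hX]
    · obtain ⟨g, hg⟩ := exists_Ad_eq_exp_smul (U := U) (omega U a p X) s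
      dsimp only
      rw [← hg]
      exact Ad_mem_orbitTangent hY
  rw [secondFF, dif_pos hex]
  obtain ⟨c, Z, hc, c0, hcX, hZ, hZt, hZY, hn⟩ := hex.choose_spec
  have h := (hc.of_mem hp).norProj_deriv hinv (hZ.differentiable (by simp)) hZt 0
  rw [c0, hcX, hZY] at h
  exact hn.trans h

/-- As for the second fundamental form, the value does not depend on the curve and the field, and
the curve `exp (s ad Z) p` with `[Z, p] = X` carries a suitable field. -/
theorem shapeOp_eq {a p v X : E} (hp : p ∈ adOrbit U a) (hv : v ∈ (orbitTangent U p)ᗮ)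
    (hX : X ∈ orbitTangent U p) :
    shapeOp U p v X = -brk U (omega U a p X) v := by
  have hex : ∃ w, IsShape U p v X w := by
    refine ⟨_, fun s : ℝ => NormedSpace.exp (s • adL U (omega U a p X)) p,
      fun s : ℝ => NormedSpace.exp (s • adL U (omega U a p X)) v, isOrbitCurve_exp _ _,
      by simp [NormedSpace.exp_zero], ?_, contDiff_exp_adL _ _, fun s => ?_,
      by simp [NormedSpace.exp_zero], rfl⟩
    · rw [(hasDerivAt_exp_adL U _ p 0).deriv]
      simp [NormedSpace.exp_zero, brk_omega hinv hp, tanProj_eq_self hX]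
    · obtain ⟨g, hg⟩ := exists_Ad_eq_exp_smul (U := U) (omega U a p X) s
      dsimp only
      rw [← hg]
      rw [orbitTangent_orthogonal hinv] at hv ⊢
      exact Ad_mem_isotropy.2 hv
  rw [shapeOp, dif_pos hex]
  obtain ⟨c, ν, hc, c0, hcX, hν, hνn, hνv, hn⟩ := hex.choose_spec
  have h := (hc.of_mem hp).tanProj_deriv hinv (hν.differentiable (by simp)) hνn 0
  rw [c0, hcX, hνv] at h
  exact hn.trans (by rw [h])

variable [T2Space U] [CompactSpace U]

/-- The fields `â_i` are well defined: the stabilizer of a regular element fixes its centralizer.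
-/
theorem IsRegular.hatField_Ad {a b : E} (hreg : IsRegular U a) (hb : b ∈ isotropy U a) (g : U) :
    hatField U a b (Ad U g a) = Ad U g b := by
  have h : ∃ g' : U, Ad U g' a = Ad U g a := ⟨g, rfl⟩
  rw [hatField, dif_pos h]
  have h1 : Ad U (g⁻¹ * h.choose) a = a := by
    rw [Ad_mul_apply, h.choose_spec, Ad_inv_Ad]
  have h2 := hreg.stabilizer_fixes hinv hb h1
  rw [Ad_mul_apply] at h2
  rw [← h2, Ad_Ad_inv, h2]

/-- Along a lift `g` of the curve the field is `g b g⁻¹`, so its derivative is the bracket with the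
velocity of the lift. -/
theorem IsRegular.hasDerivAt_hatField {a b : E} (hreg : IsRegular U a) (hb : b ∈ isotropy U a)
    {c : ℝ → E} (hc : IsOrbitCurve U a c) (s : ℝ) :
    HasDerivAt (fun s => hatField U a b (c s))
      (brk U (omega U a (c s) (deriv c s)) (hatField U a b (c s))) s := by
  obtain ⟨g, g0, hg⟩ := hc.exists_lift hinv s
  have hs : s ∈ Ioo (s - 1) (s + 1) := by simp
  obtain ⟨k, hk : Ad U k a = c s⟩ := hc.mem s
  have h1 := (hg s hs).2.clm_apply (hasDerivAt_const s (Ad U k b))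
  have h2 : (fun s => hatField U a b (c s)) =ᶠ[𝓝 s] fun t => Ad U (g t) (Ad U k b) := by
    filter_upwards [isOpen_Ioo.mem_nhds hs] with t ht
    rw [(hg t ht).1, ← hk, ← Ad_mul_apply, hreg.hatField_Ad hinv hb, Ad_mul_apply]
  have h3 := h1.congr_of_eventuallyEq h2
  rw [show hatField U a b (c s) = Ad U (g s) (Ad U k b) from h2.self_of_nhds]
  simpa using h3

theorem IsRegular.hatField_mem {a b : E} (hreg : IsRegular U a) (hb : b ∈ isotropy U a) {p : E}
    (hp : p ∈ adOrbit U a) : hatField U a b p ∈ isotropy U p := by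
  obtain ⟨g, rfl⟩ := hp
  rw [hreg.hatField_Ad hinv hb]
  exact Ad_mem_isotropy.2 hb

theorem IsRegular.isParallelNormal_hatField {a b : E} (hreg : IsRegular U a)
    (hb : b ∈ isotropy U a) : IsParallelNormal U a (hatField U a b) where
  normal p hp := by
    rw [orbitTangent_orthogonal hinv]
    exact hreg.hatField_mem hinv hb hp
  smooth c hc := by
    refine contDiff_of_linear_ode (B := fun s => adL U (omega U a (c s) (deriv c s))) ?_
      fun s => by simpa using hreg.hasDerivAt_hatField hinv hb hc s
    exact (adL U (E := E)).contDiff.comp (((contDiff_omega a).comp hc.smooth).clm_apply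
      (contDiff_infty_iff_deriv.1 hc.smooth).2)
  parallel c hc s := by
    rw [(hreg.hasDerivAt_hatField hinv hb hc s).deriv]
    exact brk_isotropy_mem_orbitTangent hinv (hreg.hatField_mem hinv hb (hc.mem s))
      (omega_mem _)

theorem IsRegular.isParallelNormalFrame_hatField {a : E} (hreg : IsRegular U a) {m : ℕ}
    {A : Fin m → E} (hA : Orthonormal ℝ A)
    (hspan : Submodule.span ℝ (Set.range A) = isotropy U a) :
    IsParallelNormalFrame U a fun i => hatField U a (A i) := by
  have hmem : ∀ i, A i ∈ isotropy U a := fun i => hspan ▸ Submodule.subset_span ⟨i, rfl⟩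
  refine ⟨fun i => hreg.isParallelNormal_hatField hinv (hmem i), ?_, ?_⟩
  · rintro _ ⟨g, rfl⟩
    simp only [fun i => hreg.hatField_Ad hinv (hmem i) g]
    rw [orthonormal_iff_ite] at hA ⊢
    simpa only [hinv] using hA
  · rintro _ ⟨g, rfl⟩
    simp only [fun i => hreg.hatField_Ad hinv (hmem i) g]
    rw [orbitTangent_orthogonal hinv]
    have : (Set.range fun i => Ad U g (A i)) = (Ad U g : E →L[ℝ] E).toLinearMap '' Set.range A := by
      rw [← Set.range_comp]; rfl
    rw [this, Submodule.span_image, hspan]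
    ext X
    constructor
    · rintro ⟨Y, hY, rfl⟩
      exact Ad_mem_isotropy.2 hY
    · intro hX
      refine ⟨Ad U g⁻¹ X, ?_, Ad_Ad_inv g X⟩
      rw [← Ad_Ad_inv g X] at hX
      exact Ad_mem_isotropy.1 hX

end OrbitGeometry

/-! ### Rapidly decreasing and tame functions -/

section FunctionClasses

variable {F G H : Type*} [NormedAddCommGroup F] [NormedSpace ℝ F] [NormedAddCommGroup G]
  [NormedSpace ℝ G] [NormedAddCommGroup H] [NormedSpace ℝ H]

/-- `(1 + |x|) ^ k * ‖f x‖` is bounded. -/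
def WeightBdd (k : ℕ) (f : ℝ → F) : Prop := ∃ C : ℝ, ∀ x, (1 + |x|) ^ k * ‖f x‖ ≤ C

/-- The first `n` derivatives of `f` are bounded with the weight `(1 + |x|) ^ k`. -/
def DecaysTo (k : ℕ) : ℕ → (ℝ → F) → Prop
  | 0, f => WeightBdd k f
  | n + 1, f => WeightBdd k f ∧ DecaysTo k n (deriv f)

/-- `f` is smooth, and all its derivatives are bounded with the weight `(1 + |x|) ^ k`. -/
def Decays (k : ℕ) (f : ℝ → F) : Prop := ContDiff ℝ ∞ f ∧ ∀ n, DecaysTo k n f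

/-- `f` is smooth with bounded derivatives of all orders. -/
def Tame (f : ℝ → F) : Prop := Decays 0 f

/-- `f` is smooth and rapidly decreasing.  The inductive form of the estimates suits products and
compositions; `rapid_iff` identifies these functions with Mathlib's Schwartz functions. -/
def Rapid (f : ℝ → F) : Prop := ∀ k, Decays k f

theorem DecaysTo.weightBdd {k n : ℕ} {f : ℝ → F} (h : DecaysTo k n f) : WeightBdd k f := by
  cases n with
  | zero => exact h
  | succ n => exact h.1

theorem DecaysTo.of_succ {k n : ℕ} {f : ℝ → F} (h : DecaysTo k (n + 1) f) : DecaysTo k n f := by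
  induction n generalizing f with
  | zero => exact h.1
  | succ n ih => exact ⟨h.1, ih h.2⟩

theorem Decays.deriv {k : ℕ} {f : ℝ → F} (h : Decays k f) : Decays k (deriv f) :=
  ⟨(contDiff_infty_iff_deriv.1 h.1).2, fun n => (h.2 (n + 1)).2⟩

theorem Decays.of_deriv {k : ℕ} {f : ℝ → F} (hd : Differentiable ℝ f) (hb : WeightBdd k f)
    (h : Decays k (_root_.deriv f)) : Decays k f :=
  ⟨contDiff_infty_iff_deriv.2 ⟨hd, h.1⟩, fun n => by
    cases n with
    | zero => exact hb
    | succ n => exact ⟨hb, h.2 n⟩⟩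

theorem WeightBdd.add {k : ℕ} {f g : ℝ → F} (hf : WeightBdd k f) (hg : WeightBdd k g) :
    WeightBdd k fun x => f x + g x := by
  obtain ⟨C, hC⟩ := hf
  obtain ⟨D, hD⟩ := hg
  refine ⟨C + D, fun x => ?_⟩
  calc (1 + |x|) ^ k * ‖f x + g x‖ ≤ (1 + |x|) ^ k * (‖f x‖ + ‖g x‖) := by
        gcongr; exact norm_add_le _ _
    _ ≤ C + D := by rw [mul_add]; exact add_le_add (hC x) (hD x)

theorem DecaysTo.add {k n : ℕ} {f g : ℝ → F} (hf : ContDiff ℝ ∞ f) (hg : ContDiff ℝ ∞ g)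
    (h : DecaysTo k n f) (h' : DecaysTo k n g) : DecaysTo k n fun x => f x + g x := by
  induction n generalizing f g with
  | zero => exact WeightBdd.add h h'
  | succ n ih =>
    refine ⟨WeightBdd.add h.1 h'.1, ?_⟩
    have e : deriv (fun x => f x + g x) = fun x => deriv f x + deriv g x := by
      ext x
      exact deriv_fun_add (hf.differentiable (by simp) x) (hg.differentiable (by simp) x)
    rw [e]
    exact ih (contDiff_infty_iff_deriv.1 hf).2 (contDiff_infty_iff_deriv.1 hg).2 h.2 h'.2

theorem Decays.add {k : ℕ} {f g : ℝ → F} (hf : Decays k f) (hg : Decays k g) :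
    Decays k fun x => f x + g x :=
  ⟨hf.1.add hg.1, fun n => (hf.2 n).add hf.1 hg.1 (hg.2 n)⟩

theorem WeightBdd.bilin {k : ℕ} (B : F →L[ℝ] G →L[ℝ] H) {f : ℝ → F} {g : ℝ → G}
    (hf : WeightBdd k f) (hg : WeightBdd 0 g) : WeightBdd k fun x => B (f x) (g x) := by
  obtain ⟨C, hC⟩ := hf
  obtain ⟨D, hD⟩ := hg
  have hC0 : 0 ≤ C := le_trans (by positivity) (hC 0)
  refine ⟨‖B‖ * C * D, fun x => ?_⟩
  have h1 := B.le_opNorm₂ (f x) (g x)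
  have h2 : ‖g x‖ ≤ D := by simpa using hD x
  calc (1 + |x|) ^ k * ‖B (f x) (g x)‖ ≤ (1 + |x|) ^ k * (‖B‖ * ‖f x‖ * ‖g x‖) := by gcongr
    _ = ‖B‖ * ((1 + |x|) ^ k * ‖f x‖) * ‖g x‖ := by ring
    _ ≤ ‖B‖ * C * D := by gcongr; exact hC x

theorem DecaysTo.bilin {k n : ℕ} (B : F →L[ℝ] G →L[ℝ] H) {f : ℝ → F} {g : ℝ → G}
    (hf : ContDiff ℝ ∞ f) (hg : ContDiff ℝ ∞ g) (h : DecaysTo k n f) (h' : DecaysTo 0 n g) :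
    DecaysTo k n fun x => B (f x) (g x) := by
  induction n generalizing f g with
  | zero => exact WeightBdd.bilin B h h'
  | succ n ih =>
    refine ⟨WeightBdd.bilin B h.1 h'.1, ?_⟩
    have e : deriv (fun x => B (f x) (g x)) =
        fun x => B (deriv f x) (g x) + B (f x) (deriv g x) := by
      ext x
      exact ((B.hasFDerivAt.comp_hasDerivAt x
        (hf.differentiable (by simp) x).hasDerivAt).clm_apply
        (hg.differentiable (by simp) x).hasDerivAt).deriv
    rw [e]
    have hf' := (contDiff_infty_iff_deriv.1 hf).2
    have hg' := (contDiff_infty_iff_deriv.1 hg).2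
    exact DecaysTo.add ((B.contDiff.comp hf').clm_apply hg) ((B.contDiff.comp hf).clm_apply hg')
      (ih hf' hg h.2 h'.of_succ) (ih hf hg' h.of_succ h'.2)

theorem Decays.bilin {k : ℕ} (B : F →L[ℝ] G →L[ℝ] H) {f : ℝ → F} {g : ℝ → G}
    (hf : Decays k f) (hg : Tame g) : Decays k fun x => B (f x) (g x) :=
  ⟨(B.contDiff.comp hf.1).clm_apply hg.1, fun n => (hf.2 n).bilin B hf.1 hg.1 (hg.2 n)⟩

theorem tame_const (c : F) : Tame fun _ : ℝ => c := by
  have h0 : ∀ n, DecaysTo 0 n fun _ : ℝ => (0 : F) := by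
    intro n
    induction n with
    | zero => exact ⟨0, by simp⟩
    | succ n ih => exact ⟨⟨0, by simp⟩, by simpa using ih⟩
  refine ⟨contDiff_const, fun n => ?_⟩
  cases n with
  | zero => exact ⟨‖c‖, by simp⟩
  | succ n => exact ⟨⟨‖c‖, by simp⟩, by simpa using h0 n⟩

theorem Decays.clm {k : ℕ} (L : F →L[ℝ] H) {f : ℝ → F} (hf : Decays k f) :
    Decays k fun x => L (f x) :=
  hf.bilin (ContinuousLinearMap.apply ℝ H) (tame_const L)

theorem Rapid.deriv {f : ℝ → F} (h : Rapid f) : Rapid (deriv f) := fun k => (h k).deriv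
theorem Rapid.tame {f : ℝ → F} (h : Rapid f) : Tame f := h 0
theorem Rapid.add {f g : ℝ → F} (h : Rapid f) (h' : Rapid g) : Rapid fun x => f x + g x :=
  fun k => (h k).add (h' k)
theorem Rapid.bilin (B : F →L[ℝ] G →L[ℝ] H) {f : ℝ → F} {g : ℝ → G} (h : Rapid f) (h' : Tame g) :
    Rapid fun x => B (f x) (g x) := fun k => (h k).bilin B h'
theorem Rapid.bilin' (B : F →L[ℝ] G →L[ℝ] H) {f : ℝ → F} {g : ℝ → G} (h : Tame f) (h' : Rapid g) :
    Rapid fun x => B (f x) (g x) := fun k => (h' k).bilin B.flip h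
theorem Rapid.clm (L : F →L[ℝ] H) {f : ℝ → F} (h : Rapid f) : Rapid fun x => L (f x) :=
  fun k => (h k).clm L
theorem Rapid.smooth {f : ℝ → F} (h : Rapid f) : ContDiff ℝ ∞ f := (h 0).1
theorem Tame.smooth {f : ℝ → F} (h : Tame f) : ContDiff ℝ ∞ f := h.1
theorem Tame.clm (L : F →L[ℝ] H) {f : ℝ → F} (h : Tame f) : Tame fun x => L (f x) := Decays.clm L h
theorem Tame.add {f g : ℝ → F} (h : Tame f) (h' : Tame g) : Tame fun x => f x + g x :=
  Decays.add h h'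
theorem Tame.bilin (B : F →L[ℝ] G →L[ℝ] H) {f : ℝ → F} {g : ℝ → G} (h : Tame f) (h' : Tame g) :
    Tame fun x => B (f x) (g x) := Decays.bilin B h h'

theorem Tame.exists_bound {f : ℝ → F} (h : Tame f) : ∃ C : ℝ, ∀ x, ‖f x‖ ≤ C := by
  obtain ⟨C, hC⟩ := (h.2 0).weightBdd
  exact ⟨C, by simpa using hC⟩

theorem Tame.of_deriv {f : ℝ → F} (hd : Differentiable ℝ f) {C : ℝ} (hb : ∀ x, ‖f x‖ ≤ C)
    (h : Tame (deriv f)) : Tame f :=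
  Decays.of_deriv hd ⟨C, by simpa using hb⟩ h

theorem Rapid.weightBdd {f : ℝ → F} (h : Rapid f) (k : ℕ) : WeightBdd k f := (h k).2 0

/-- Bounded solutions of linear differential equations with tame coefficients are tame. -/
theorem Tame.of_linear_ode {B : ℝ → F →L[ℝ] F} (hB : Tame B) {y : ℝ → F}
    (hy : ∀ x, HasDerivAt y (B x (y x)) x) {C : ℝ} (hb : ∀ x, ‖y x‖ ≤ C) : Tame y := by
  have hs := contDiff_of_linear_ode hB.1 hy
  have hd : deriv y = fun x => B x (y x) := funext fun x => (hy x).deriv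
  have hb' : WeightBdd 0 y := ⟨C, by simpa using hb⟩
  refine ⟨hs, fun n => ?_⟩
  induction n with
  | zero => exact hb'
  | succ n ih =>
    refine ⟨hb', ?_⟩
    rw [hd]
    exact (hB.2 n).bilin (ContinuousLinearMap.id ℝ (F →L[ℝ] F)) hB.1 hs ih

theorem rapid_iff {f : ℝ → F} : Rapid f ↔ ∃ φ : 𝓢(ℝ, F), ∀ x, φ x = f x := by
  constructor
  · intro h
    have key : ∀ n k (f : ℝ → F), DecaysTo k n f → WeightBdd k (iteratedDeriv n f) := by
      intro n
      induction n with
      | zero => intro k f h; simpa using h.weightBdd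
      | succ n ih => intro k f h; rw [iteratedDeriv_succ']; exact ih k _ h.2
    refine ⟨⟨f, h.smooth, fun k n => ?_⟩, fun x => rfl⟩
    obtain ⟨C, hC⟩ := key n k f ((h k).2 n)
    refine ⟨C, fun x => le_trans ?_ (hC x)⟩
    rw [norm_iteratedFDeriv_eq_norm_iteratedDeriv, Real.norm_eq_abs]
    gcongr
    linarith
  · rintro ⟨φ, hφ⟩ k
    obtain rfl : (φ : ℝ → F) = f := funext hφ
    refine ⟨φ.smooth ⊤, fun n => ?_⟩
    clear hφ
    have hb : ∀ φ : 𝓢(ℝ, F), WeightBdd k φ := by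
      intro φ
      refine ⟨2 ^ k * ((Finset.Iic (k, 0)).sup fun m => SchwartzMap.seminorm ℝ m.1 m.2) φ,
        fun x => ?_⟩
      simpa using SchwartzMap.one_add_le_sup_seminorm_apply (𝕜 := ℝ) (m := (k, 0)) (k := k) (n := 0)
        le_rfl le_rfl φ x
    induction n generalizing φ with
    | zero => exact hb φ
    | succ n ih => exact ⟨hb φ, ih (SchwartzMap.derivCLM ℝ F φ)⟩

theorem Rapid.integrable [CompleteSpace F] {f : ℝ → F} (h : Rapid f) : Integrable f := by
  obtain ⟨φ, hφ⟩ := rapid_iff.1 h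
  rw [← funext hφ]
  exact φ.integrable

theorem Rapid.tendsto_cocompact {f : ℝ → F} (h : Rapid f) : Tendsto f (cocompact ℝ) (𝓝 0) := by
  obtain ⟨φ, hφ⟩ := rapid_iff.1 h
  rw [← funext hφ]
  exact zero_at_infty φ

theorem Rapid.tendsto_atBot {f : ℝ → F} (h : Rapid f) : Tendsto f atBot (𝓝 0) :=
  h.tendsto_cocompact.mono_left atBot_le_cocompact

theorem Rapid.tendsto_atTop {f : ℝ → F} (h : Rapid f) : Tendsto f atTop (𝓝 0) :=
  h.tendsto_cocompact.mono_left atTop_le_cocompact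

theorem Rapid.weight_integrable {f : ℝ → F} (h : Rapid f) (k : ℕ) :
    Integrable fun x => (1 + |x|) ^ k * ‖f x‖ := by
  obtain ⟨C, hC⟩ := h.weightBdd (k + 2)
  refine Integrable.mono' (integrable_inv_one_add_sq.const_mul C) ?_ (Eventually.of_forall fun x => ?_)
  · have := h.smooth.continuous
    exact (by fun_prop : Continuous fun x => (1 + |x|) ^ k * ‖f x‖).aestronglyMeasurable
  · rw [Real.norm_of_nonneg (by positivity), ← div_eq_mul_inv, le_div_iff₀ (by positivity)]
    refine le_trans ?_ (hC x)
    have h2 : 1 + x ^ 2 ≤ (1 + |x|) ^ 2 := by rw [← sq_abs x]; nlinarith [abs_nonneg x]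
    calc (1 + |x|) ^ k * ‖f x‖ * (1 + x ^ 2) ≤ (1 + |x|) ^ k * ‖f x‖ * (1 + |x|) ^ 2 := by gcongr
      _ = (1 + |x|) ^ (k + 2) * ‖f x‖ := by ring

/-- A function that tends to zero at both ends and has a rapidly decreasing derivative is rapidly
decreasing. -/
theorem Rapid.of_deriv [CompleteSpace F] {f : ℝ → F} (hd : Differentiable ℝ f) (h : Rapid (_root_.deriv f))
    (hbot : Tendsto f atBot (𝓝 0)) (htop : Tendsto f atTop (𝓝 0)) : Rapid f := by
  intro k
  refine Decays.of_deriv hd ?_ (h k)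
  refine ⟨∫ s, (1 + |s|) ^ k * ‖_root_.deriv f s‖, fun x => ?_⟩
  have hI := h.weight_integrable k
  have hkey : ∀ S : Set ℝ, MeasurableSet S → (∀ s ∈ S, |x| ≤ |s|) →
      ‖f x‖ = ‖∫ s in S, _root_.deriv f s‖ →
      (1 + |x|) ^ k * ‖f x‖ ≤ ∫ s, (1 + |s|) ^ k * ‖_root_.deriv f s‖ := by
    intro S hS hxs hf
    calc (1 + |x|) ^ k * ‖f x‖ ≤ (1 + |x|) ^ k * ∫ s in S, ‖_root_.deriv f s‖ := by
          rw [hf]; gcongr; exact norm_integral_le_integral_norm _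
      _ = ∫ s in S, (1 + |x|) ^ k * ‖_root_.deriv f s‖ := (integral_const_mul _ _).symm
      _ ≤ ∫ s in S, (1 + |s|) ^ k * ‖_root_.deriv f s‖ := by
          refine setIntegral_mono_on (h.integrable.norm.const_mul _).integrableOn hI.integrableOn hS
            fun s hs => ?_
          have := hxs s hs
          gcongr
      _ ≤ _ := setIntegral_le_integral hI (Eventually.of_forall fun s => by positivity)
  rcases le_total 0 x with hx | hx
  · refine hkey (Ioi x) measurableSet_Ioi (fun s hs => ?_) ?_
    · rw [abs_of_nonneg hx, abs_of_nonneg (hx.trans hs.le)]; exact hs.le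
    · rw [integral_Ioi_of_hasDerivAt_of_tendsto' (fun s _ => (hd s).hasDerivAt)
        h.integrable.integrableOn htop]; simp
  · refine hkey (Iic x) measurableSet_Iic (fun s hs => ?_) ?_
    · rw [abs_of_nonpos hx, abs_of_nonpos (le_trans hs hx)]; exact neg_le_neg hs
    · rw [integral_Iic_of_hasDerivAt_of_tendsto' (fun s _ => (hd s).hasDerivAt)
        h.integrable.integrableOn hbot]; simp

/-- A function with a rapidly decreasing derivative that tends to a limit at `-∞` is tame. -/
theorem Rapid.tame_of_deriv [CompleteSpace F] {f : ℝ → F} (hd : Differentiable ℝ f)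
    (h : Rapid (_root_.deriv f)) {l : F} (hbot : Tendsto f atBot (𝓝 l)) : Tame f := by
  refine Tame.of_deriv hd (C := ‖l‖ + ∫ s, ‖_root_.deriv f s‖) (fun x => ?_) h.tame
  have h1 := integral_Iic_of_hasDerivAt_of_tendsto' (a := x) (fun s _ => (hd s).hasDerivAt)
        h.integrable.integrableOn hbot
  have h2 : f x = l + ∫ s in Iic x, _root_.deriv f s := by rw [h1]; abel
  rw [h2]
  refine (norm_add_le _ _).trans (add_le_add_right ((norm_integral_le_integral_norm _).trans ?_) _)
  exact setIntegral_le_integral h.integrable.norm (Eventually.of_forall fun s => norm_nonneg _)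

/-- Smooth functions of tame functions are tame. -/
theorem Tame.comp {F H : Type u} [NormedAddCommGroup F] [NormedSpace ℝ F] [FiniteDimensional ℝ F]
    [NormedAddCommGroup H] [NormedSpace ℝ H] {Ψ : F → H} (hΨ : ContDiff ℝ ∞ Ψ) {f : ℝ → F}
    (hf : Tame f) : Tame fun x => Ψ (f x) := by
  have : ProperSpace F := FiniteDimensional.proper ℝ F
  obtain ⟨C, hC⟩ := hf.exists_bound
  have hb : ∀ (H : Type u) [NormedAddCommGroup H] [NormedSpace ℝ H] (Ψ : F → H), ContDiff ℝ ∞ Ψ →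
      WeightBdd 0 fun x => Ψ (f x) := by
    intro H _ _ Ψ hΨ
    obtain ⟨D, hD⟩ := (isCompact_closedBall (0 : F) C).exists_bound_of_continuousOn
      hΨ.continuous.continuousOn
    exact ⟨D, fun x => by simpa using hD (f x) (by simpa using hC x)⟩
  refine ⟨hΨ.comp hf.1, fun n => ?_⟩
  induction n generalizing H Ψ with
  | zero => exact hb H Ψ hΨ
  | succ n ih =>
    refine ⟨hb H Ψ hΨ, ?_⟩
    have e : _root_.deriv (fun x => Ψ (f x)) = fun x => fderiv ℝ Ψ (f x) (_root_.deriv f x) := by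
      ext x
      exact ((hΨ.differentiable (by simp) (f x)).hasFDerivAt.comp_hasDerivAt x
        (hf.1.differentiable (by simp) x).hasDerivAt).deriv
    rw [e]
    have h1 : ContDiff ℝ ∞ (fderiv ℝ Ψ) := hΨ.fderiv_right (m := ∞) (by simp)
    exact (ih h1).bilin (ContinuousLinearMap.id ℝ (F →L[ℝ] H)) (h1.comp hf.1)
      hf.deriv.1 (hf.deriv.2 n)

end FunctionClasses

section Primitive

variable {F : Type*} [NormedAddCommGroup F] [NormedSpace ℝ F] [CompleteSpace F]

theorem hasDerivAt_integral_Iic {f : ℝ → F} (hf : Continuous f) {b : ℝ} (hi : IntegrableOn f (Iic b))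
    (x : ℝ) : HasDerivAt (fun x => ∫ s in Iic x, f s) (f x) x := by
  have e : (fun x => ∫ s in Iic x, f s) = fun x => (∫ s in Iic b, f s) + ∫ s in b..x, f s := by
    ext x
    rw [← intervalIntegral.integral_Iic_sub_Iic hi ?_]; · abel
    rcases le_total x b with h | h
    · exact hi.mono_set (Iic_subset_Iic.2 h)
    · rw [← Iic_union_Icc_eq_Iic h]
      exact hi.union hf.continuousOn.integrableOn_Icc
  rw [e]
  exact (intervalIntegral.integral_hasDerivAt_right (hf.intervalIntegrable _ _)
    (hf.stronglyMeasurableAtFilter _ _) hf.continuousAt).const_add _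

theorem tendsto_integral_Iic_atBot {f : ℝ → F} {b : ℝ} (hi : IntegrableOn f (Iic b)) :
    Tendsto (fun x => ∫ s in Iic x, f s) atBot (𝓝 0) := by
  have := tendsto_setIntegral_of_antitone (μ := volume) (s := fun x : ℝ => Iic (-x))
    (f := f) (fun _ => measurableSet_Iic) (fun x y h => Iic_subset_Iic.2 (neg_le_neg h))
    ⟨-b, by simpa using hi⟩
  have e : (⋂ x : ℝ, Iic (-x)) = (∅ : Set ℝ) := by
    ext y; simp only [mem_iInter, mem_Iic, mem_empty_iff_false, iff_false, not_forall, not_le]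
    exact ⟨-(y - 1), by simp⟩
  rw [e, Measure.restrict_empty, integral_zero_measure] at this
  simpa [Function.comp_def] using this.comp tendsto_neg_atBot_atTop

end Primitive

/-! ### Frames and the development map -/

section Development

variable {E : Type*} [NormedAddCommGroup E] [InnerProductSpace ℝ E] [FiniteDimensional ℝ E]
variable {U : Type*} [TopologicalSpace U] [ChartedSpace E U] [Group U] [LieGroup 𝓘(ℝ, E) ∞ U]

theorem rapidDecay_iff {f : ℝ → E} : RapidDecay f ↔ Rapid f := rapid_iff.symm

theorem HasVel.comp {h : ℝ → U} {v : E} {φ : ℝ → ℝ} {φ' x : ℝ} (hv : HasVel h v (φ x))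
    (hφ : HasDerivAt φ φ' x) : HasVel (fun y => h (φ y)) (φ' • v) x := by
  rw [hasVel_iff] at hv ⊢
  exact ⟨ContinuousAt.comp (f := φ) (g := h) hv.1 hφ.continuousAt, hv.2.scomp x hφ⟩

/-- The compactification `y = arctan x` carries a rapidly decreasing coefficient on the line to a
continuous one. -/
theorem continuous_tan_weight {w : ℝ → E} (hw : Rapid w) : Continuous fun y : ℝ =>
    if Real.cos y = 0 then 0 else (1 + Real.tan y ^ 2) • w (Real.tan y) := by
  refine continuous_iff_continuousAt.2 fun y => ?_
  by_cases hy : Real.cos y = 0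
  · obtain ⟨C, hC⟩ := hw.weightBdd 3
    have hb : ∀ z : ℝ, ‖(1 + z ^ 2) • w z‖ ≤ C / (1 + |z|) := by
      intro z
      rw [le_div_iff₀ (by positivity), norm_smul, Real.norm_of_nonneg (by positivity)]
      refine le_trans ?_ (hC z)
      have h2 : 1 + z ^ 2 ≤ (1 + |z|) ^ 2 := by rw [← sq_abs z]; nlinarith [abs_nonneg z]
      calc (1 + z ^ 2) * ‖w z‖ * (1 + |z|) ≤ (1 + |z|) ^ 2 * ‖w z‖ * (1 + |z|) := by gcongr
        _ = (1 + |z|) ^ 3 * ‖w z‖ := by ring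
    rw [continuousAt_iff_punctured_nhds, if_pos hy]
    refine squeeze_zero_norm (a := fun z => C / (1 + |Real.tan z|)) (fun z => ?_) ?_
    · split_ifs with h
      · rw [norm_zero]
        exact le_trans (norm_nonneg _) (hb _)
      · exact hb _
    · exact Tendsto.div_atTop tendsto_const_nhds
        (tendsto_atTop_add_const_left _ _ (Real.tendsto_abs_tan_of_cos_eq_zero hy))
  · have hc : ContinuousAt (fun y => (1 + Real.tan y ^ 2) • w (Real.tan y)) y := by
      have h1 := Real.continuousAt_tan.2 hy
      exact ((continuousAt_const.add (h1.pow 2)).smul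
        (hw.smooth.continuous.continuousAt.comp (f := Real.tan) h1))
    refine hc.congr ?_
    filter_upwards [Real.continuous_cos.continuousAt.eventually_ne hy] with z hz
    rw [if_neg hz]

variable (U) in
/-- A rapidly decreasing logarithmic derivative has a primitive in the group that starts at the
identity at `-∞`. -/
theorem exists_hasVel_tendsto {w : ℝ → E} (hw : Rapid w) :
    ∃ h : ℝ → U, (∀ x, HasVel h (w x) x) ∧ Tendsto h atBot (𝓝 1) := by
  have := FiniteDimensional.complete ℝ E
  obtain ⟨h, h0, hh⟩ := exists_hasVel_Ioo (E := E) (U := U) (continuous_tan_weight hw)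
    (-(Real.pi / 2)) 1 (2 * Real.pi)
  have hpi := Real.pi_pos
  refine ⟨fun x => h (Real.arctan x), fun x => ?_, ?_⟩
  · have h1 := Real.neg_pi_div_two_lt_arctan x
    have h2 := Real.arctan_lt_pi_div_two x
    have h3 := (hh (Real.arctan x) ⟨by linarith, by linarith⟩).comp (Real.hasDerivAt_arctan x)
    rw [if_neg (Real.cos_arctan_pos x).ne', Real.tan_arctan, smul_smul,
      one_div_mul_cancel (by positivity), one_smul] at h3
    exact h3
  · have h1 := (hasVel_iff.1 (hh (-(Real.pi / 2)) ⟨by linarith, by linarith⟩)).1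
    have h2 : Tendsto h (𝓝 (-(Real.pi / 2))) (𝓝 1) := by rw [← h0]; exact h1
    exact h2.comp (Real.tendsto_arctan_atBot.mono_right nhdsWithin_le_nhds)

variable (U) in
/-- `g` is the frame of the curve `γ` that defines its development `u`: it lifts `γ`, starts at the
identity at `-∞`, and its logarithmic derivative `u` is rapidly decreasing and orthogonal to `𝔲_a`. -/
structure IsFrame (a : E) (γ u : ℝ → E) (g : ℝ → U) : Prop where
  pot : Rapid u
  mem : ∀ x, u x ∈ (isotropy U a)ᗮ
  smooth : ContMDiff 𝓘(ℝ, ℝ) 𝓘(ℝ, E) ∞ g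
  lift : ∀ x, γ x = Ad U (g x) a
  tendsto : Tendsto g atBot (𝓝 1)
  vel : ∀ x, HasVel g (u x) x

theorem isDevelopment_iff {a : E} {γ u : ℝ → E} :
    IsDevelopment U a γ u ↔ ∃ g, IsFrame U a γ u g :=
  ⟨fun ⟨⟨h1, h2⟩, g, h3, h4, h5, h6⟩ => ⟨g, rapidDecay_iff.1 h1, h2, h3, h4, h5, h6⟩,
    fun ⟨g, h⟩ => ⟨⟨rapidDecay_iff.2 h.pot, h.mem⟩, g, h.smooth, h.lift, h.tendsto, h.vel⟩⟩

variable (U) in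
/-- The velocity of a curve of the orbit, as the element of the Lie algebra tangent to the orbit that
generates it. -/
def angVel (a : E) (γ : ℝ → E) (x : ℝ) : E := omega U a (γ x) (deriv γ x)

theorem IsFrame.hasDerivAt_Ad {a : E} {γ u : ℝ → E} {g : ℝ → U} (h : IsFrame U a γ u g) (x : ℝ) :
    HasDerivAt (fun x => (Ad U (g x) : E →L[ℝ] E)) ((Ad U (g x)).comp (adL U (u x))) x :=
  (h.vel x).hasDerivAt_Ad

theorem IsFrame.hasDerivAt_Ad_inv {a : E} {γ u : ℝ → E} {g : ℝ → U} (h : IsFrame U a γ u g) (x : ℝ) :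
    HasDerivAt (fun x => (Ad U (g x)⁻¹ : E →L[ℝ] E)) (-((adL U (u x)).comp (Ad U (g x)⁻¹))) x := by
  have h1 := (h.vel x).inv.hasDerivAt_Ad
  have h2 := Ad_adL_Ad_inv (g x)⁻¹ (u x)
  rw [inv_inv] at h2
  rwa [map_neg, ContinuousLinearMap.comp_neg, h2] at h1

theorem IsFrame.hasDerivAt_Ad_apply {a : E} {γ u : ℝ → E} {g : ℝ → U} (h : IsFrame U a γ u g)
    {v : ℝ → E} {v' : E} {x : ℝ} (hv : HasDerivAt v v' x) :
    HasDerivAt (fun x => Ad U (g x) (v x)) (Ad U (g x) (v' + brk U (u x) (v x))) x := by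
  have := (h.hasDerivAt_Ad x).clm_apply hv
  rw [map_add, add_comm]
  simpa using this

theorem IsFrame.hasDerivAt_Ad_inv_apply {a : E} {γ u : ℝ → E} {g : ℝ → U} (h : IsFrame U a γ u g)
    {v : ℝ → E} {v' : E} {x : ℝ} (hv : HasDerivAt v v' x) :
    HasDerivAt (fun x => Ad U (g x)⁻¹ (v x))
      (Ad U (g x)⁻¹ v' - brk U (u x) (Ad U (g x)⁻¹ (v x))) x := by
  have := (h.hasDerivAt_Ad_inv x).clm_apply hv
  rw [sub_eq_neg_add]
  simpa using this

theorem IsFrame.mem_adOrbit {a : E} {γ u : ℝ → E} {g : ℝ → U} (h : IsFrame U a γ u g) (x : ℝ) :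
    γ x ∈ adOrbit U a := ⟨g x, (h.lift x).symm⟩

theorem IsFrame.hasDerivAt_curve {a : E} {γ u : ℝ → E} {g : ℝ → U} (h : IsFrame U a γ u g) (x : ℝ) :
    HasDerivAt γ (Ad U (g x) (brk U (u x) a)) x := by
  have := h.hasDerivAt_Ad_apply (hasDerivAt_const x a)
  simp only [← h.lift, zero_add] at this
  exact this

variable (hinv : ∀ (g : U) (X Y : E), ⟪Ad U g X, Ad U g Y⟫_ℝ = ⟪X, Y⟫_ℝ)

include hinv

/-- In the frame the angular velocity is `u`: as `u` is orthogonal to `𝔲_a`, the pseudo-inverse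
recovers it from `γ_x = g [u, a] g⁻¹`. -/
theorem IsFrame.angVel_eq {a : E} {γ u : ℝ → E} {g : ℝ → U} (h : IsFrame U a γ u g) (x : ℝ) :
    angVel U a γ x = Ad U (g x) (u x) := by
  rw [angVel, (h.hasDerivAt_curve x).deriv, h.lift x, omega_Ad]
  congr 1
  refine omega_brk hinv (mem_adOrbit_self a) ?_
  rw [← isotropy_orthogonal hinv]; exact h.mem x

theorem IsFrame.pot_eq {a : E} {γ u : ℝ → E} {g : ℝ → U} (h : IsFrame U a γ u g) (x : ℝ) :
    u x = Ad U (g x)⁻¹ (angVel U a γ x) := by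
  rw [h.angVel_eq hinv, Ad_inv_Ad]

theorem IsFrame.hasDerivAt_Ad' {a : E} {γ u : ℝ → E} {g : ℝ → U} (h : IsFrame U a γ u g) (x : ℝ) :
    HasDerivAt (fun x => (Ad U (g x) : E →L[ℝ] E))
      ((adL U (angVel U a γ x)).comp (Ad U (g x))) x := by
  have h1 := h.hasDerivAt_Ad x
  rwa [h.pot_eq hinv x, Ad_adL_Ad_inv] at h1

theorem IsFrame.hasDerivAt_Ad_inv' {a : E} {γ u : ℝ → E} {g : ℝ → U} (h : IsFrame U a γ u g) (x : ℝ) :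
    HasDerivAt (fun x => (Ad U (g x)⁻¹ : E →L[ℝ] E))
      (-((Ad U (g x)⁻¹).comp (adL U (angVel U a γ x)))) x := by
  have h1 := (h.vel x).inv.hasDerivAt_Ad
  rwa [← h.angVel_eq hinv, map_neg, ContinuousLinearMap.comp_neg] at h1

/-- The development is unique, and the frame is unique up to the kernel of `Ad`: the equation `g_x
= angVel g` depends on the curve only. -/
theorem IsFrame.unique {a : E} {γ u u' : ℝ → E} {g g' : ℝ → U} (h : IsFrame U a γ u g)
    (h' : IsFrame U a γ u' g') : (∀ x, (Ad U (g x) : E →L[ℝ] E) = Ad U (g' x)) ∧ u = u' := by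
  have key : ∀ x, HasDerivAt (fun x => (Ad U (g x)⁻¹ : E →L[ℝ] E).comp (Ad U (g' x))) 0 x := by
    intro x
    have := (h.hasDerivAt_Ad_inv' hinv x).clm_comp (h'.hasDerivAt_Ad' hinv x)
    simpa [ContinuousLinearMap.comp_assoc] using this
  have hA : ∀ {g : ℝ → U}, Tendsto g atBot (𝓝 1) → Tendsto (fun x => (Ad U (g x) : E →L[ℝ] E)) atBot
      (𝓝 (ContinuousLinearMap.id ℝ E)) := by
    intro g hg
    rw [← Ad_one (U := U)]
    exact (continuous_Ad.tendsto 1).comp hg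
  have := topologicalGroup_of_lieGroup 𝓘(ℝ, E) ∞ (G := U)
  have hlim : Tendsto (fun x => (Ad U (g x)⁻¹ : E →L[ℝ] E).comp (Ad U (g' x))) atBot
      (𝓝 (ContinuousLinearMap.id ℝ E)) := by
    have h1 := hA (show Tendsto (fun x => (g x)⁻¹) atBot (𝓝 1) by simpa using h.tendsto.inv)
    simpa [Function.comp_def] using (isBoundedBilinearMap_comp.continuous.tendsto _).comp
      (h1.prodMk_nhds (hA h'.tendsto))
  have hconst : ∀ x, (Ad U (g x)⁻¹ : E →L[ℝ] E).comp (Ad U (g' x)) = ContinuousLinearMap.id ℝ E := by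
    intro x
    have h1 : ∀ y, (Ad U (g y)⁻¹ : E →L[ℝ] E).comp (Ad U (g' y)) =
        (Ad U (g x)⁻¹ : E →L[ℝ] E).comp (Ad U (g' x)) := fun y =>
      is_const_of_deriv_eq_zero (fun x => (key x).differentiableAt) (fun x => (key x).deriv) y x
    simp only [h1] at hlim
    exact tendsto_nhds_unique tendsto_const_nhds hlim
  have hF : ∀ x, (Ad U (g x) : E →L[ℝ] E) = Ad U (g' x) := by
    intro x
    ext X
    have := DFunLike.congr_fun (hconst x) X
    simp only [ContinuousLinearMap.comp_apply, ContinuousLinearMap.id_apply] at this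
    rw [← Ad_Ad_inv (g x) (Ad U (g' x) X), this]
  refine ⟨hF, ?_⟩
  ext x
  have h1 : Ad U (g x) (u x) = Ad U (g x) (u' x) := by
    rw [← h.angVel_eq hinv, hF, ← h'.angVel_eq hinv]
  rw [← Ad_inv_Ad (g x) (u x), h1, Ad_inv_Ad]

theorem IsFrame.development_eq {a : E} {γ u : ℝ → E} {g : ℝ → U} (h : IsFrame U a γ u g) :
    development U a γ = u := by
  have hex : ∃ u, IsDevelopment U a γ u := ⟨u, isDevelopment_iff.2 ⟨g, h⟩⟩
  rw [development, dif_pos hex]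
  obtain ⟨g', h'⟩ := isDevelopment_iff.1 hex.choose_spec
  exact (h'.unique hinv h).2

theorem IsCurve.tame {a : E} {γ : ℝ → E} (hγ : IsCurve U a γ) : Tame γ :=
  Tame.of_deriv (hγ.orbit.smooth.differentiable (by simp))
    (fun x => (norm_of_mem_adOrbit hinv (hγ.orbit.mem x)).le) (rapidDecay_iff.1 hγ.decay).tame

theorem IsCurve.rapid_angVel {a : E} {γ : ℝ → E} (hγ : IsCurve U a γ) : Rapid (angVel U a γ) :=
  Rapid.bilin' (ContinuousLinearMap.id ℝ (E →L[ℝ] E)) ((hγ.tame hinv).comp (contDiff_omega (U := U) a))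
    (rapidDecay_iff.1 hγ.decay)

/-- The angular velocity generates the curve. -/
theorem IsCurve.brk_angVel {a : E} {γ : ℝ → E} (hγ : IsCurve U a γ) (x : ℝ) :
    brk U (angVel U a γ x) (γ x) = deriv γ x := by
  rw [angVel, brk_omega hinv (hγ.orbit.mem x), tanProj_eq_self (hγ.orbit.tangent x)]

theorem norm_Ad_le (g : U) : ‖(Ad U g : E →L[ℝ] E)‖ ≤ 1 :=
  ContinuousLinearMap.opNorm_le_bound _ zero_le_one fun X => by rw [norm_Ad hinv, one_mul]

omit hinv in
theorem Tame.comp_adL {w : ℝ → E} (hw : Tame w) :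
    Tame fun x => ContinuousLinearMap.compL ℝ E E E (adL U (w x)) :=
  Tame.clm (F := E) (H := (E →L[ℝ] E) →L[ℝ] E →L[ℝ] E)
    ((ContinuousLinearMap.compL ℝ E E E).comp (adL U)) hw

theorem IsFrame.tame_Ad {a : E} {γ u : ℝ → E} {g : ℝ → U} (h : IsFrame U a γ u g)
    (hγ : IsCurve U a γ) : Tame fun x => (Ad U (g x) : E →L[ℝ] E) :=
  Tame.of_linear_ode (Tame.comp_adL (U := U) (hγ.rapid_angVel hinv).tame)
    (fun x => h.hasDerivAt_Ad' hinv x) fun x => norm_Ad_le hinv (g x)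

theorem IsFrame.tame_Ad_inv {a : E} {γ u : ℝ → E} {g : ℝ → U} (h : IsFrame U a γ u g) :
    Tame fun x => (Ad U (g x)⁻¹ : E →L[ℝ] E) :=
  Tame.of_linear_ode (Tame.clm (-ContinuousLinearMap.id ℝ _) (Tame.comp_adL (U := U) h.pot.tame))
    (fun x => by simpa using h.hasDerivAt_Ad_inv x) fun x => norm_Ad_le hinv (g x)⁻¹

/-- Every curve of the curve space has a development: the inverse `h` of the frame has the logarithmic
derivative `-angVel`, which is known from the curve. -/
theorem IsCurve.exists_frame {a : E} {γ : ℝ → E} (hγ : IsCurve U a γ) :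
    ∃ (u : ℝ → E) (g : ℝ → U), IsFrame U a γ u g := by
  have := topologicalGroup_of_lieGroup 𝓘(ℝ, E) ∞ (G := U)
  have hw := hγ.rapid_angVel hinv
  obtain ⟨h, hh, hlim⟩ := exists_hasVel_tendsto U (hw.clm (-ContinuousLinearMap.id ℝ E))
  simp only [neg_apply, ContinuousLinearMap.id_apply] at hh
  have hinvlim : Tendsto (fun x => (h x)⁻¹) atBot (𝓝 1) := by simpa using hlim.inv
  have hd : ∀ x, HasDerivAt (fun x => Ad U (h x) (γ x)) 0 x := by
    intro x
    have h1 := (hh x).hasDerivAt_Ad.clm_apply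
      (hγ.orbit.smooth.differentiable (by simp) x).hasDerivAt
    simpa [hγ.brk_angVel hinv] using h1
  have hlift : ∀ x, Ad U (h x) (γ x) = a := by
    intro x
    have h1 : ∀ y, Ad U (h y) (γ y) = Ad U (h x) (γ x) := fun y =>
      is_const_of_deriv_eq_zero (fun x => (hd x).differentiableAt) (fun x => (hd x).deriv) y x
    have h2 : Tendsto (fun y => Ad U (h y) (γ y)) atBot (𝓝 a) := by
      have h3 := (isBoundedBilinearMap_apply.continuous.tendsto _).comp
        (((continuous_Ad (E := E).tendsto (1 : U)).comp hlim).prodMk_nhds hγ.tendsto)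
      simpa [Ad_one, Function.comp_def] using h3
    simp only [h1] at h2
    exact tendsto_nhds_unique tendsto_const_nhds h2
  set u : ℝ → E := fun x => Ad U (h x) (angVel U a γ x) with hu
  have hvel : ∀ x, HasVel (fun y => (h y)⁻¹) (u x) x := by
    intro x
    have h1 := (hh x).inv
    simpa [hu] using h1
  have hF : ∀ x, HasDerivAt (fun x => (Ad U (h x) : E →L[ℝ] E)) (-((adL U (u x)).comp (Ad U (h x)))) x := by
    intro x
    have h1 := (hh x).hasDerivAt_Ad
    have h2 : (Ad U (h x)).comp (adL U (angVel U a γ x)) = (adL U (u x)).comp (Ad U (h x)) := by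
      have := Ad_adL_Ad_inv (h x) (u x)
      rwa [hu, Ad_inv_Ad] at this
    rwa [map_neg, ContinuousLinearMap.comp_neg, h2] at h1
  have hF' : ∀ x, HasDerivAt (fun x => (Ad U (h x) : E →L[ℝ] E))
      (-((Ad U (h x)).comp (adL U (angVel U a γ x)))) x := by
    intro x
    have h1 := (hh x).hasDerivAt_Ad
    rwa [map_neg, ContinuousLinearMap.comp_neg] at h1
  have htame : Tame fun x => (Ad U (h x) : E →L[ℝ] E) :=
    Tame.of_linear_ode (Tame.clm (-(ContinuousLinearMap.compL ℝ E E E).flip.comp (adL U)) hw.tame)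
      (fun x => by simpa using hF' x) fun x => norm_Ad_le hinv (h x)
  have hur : Rapid u := Rapid.bilin' (ContinuousLinearMap.id ℝ (E →L[ℝ] E)) htame hw
  refine ⟨u, fun x => (h x)⁻¹, hur, fun x => ?_, contMDiff_of_hasVel hur.smooth hvel, fun x => ?_,
    hinvlim, hvel⟩
  · rw [isotropy_orthogonal hinv, ← hlift x]
    exact Ad_mem_orbitTangent (omega_mem _)
  · conv_rhs => rw [← hlift x, Ad_inv_Ad]

end Development

/-! ### The Poisson operator `P_u` -/

section PoissonOperator

theorem eq_of_hasDerivAt_of_tendsto {F : Type*} [NormedAddCommGroup F] [NormedSpace ℝ F]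
    {f g f' : ℝ → F} (hf : ∀ x, HasDerivAt f (f' x) x) (hg : ∀ x, HasDerivAt g (f' x) x) {l : F}
    (hfl : Tendsto f atBot (𝓝 l)) (hgl : Tendsto g atBot (𝓝 l)) : f = g := by
  ext x
  have hd : ∀ x, HasDerivAt (fun x => f x - g x) 0 x := fun x => by
    simpa using (hf x).fun_sub (hg x)
  have h1 : ∀ y, f y - g y = f x - g x := fun y =>
    is_const_of_deriv_eq_zero (fun x => (hd x).differentiableAt) (fun x => (hd x).deriv) y x
  have h2 := hfl.sub hgl
  simp only [h1, sub_self] at h2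
  exact sub_eq_zero.1 (tendsto_nhds_unique tendsto_const_nhds h2)

theorem HasDerivAt.mem_submodule {F : Type*} [NormedAddCommGroup F] [InnerProductSpace ℝ F]
    [FiniteDimensional ℝ F] {S : Submodule ℝ F}
    {f : ℝ → F} {f' : F} {x : ℝ} (hf : HasDerivAt f f' x) (h : ∀ x, f x ∈ S) : f' ∈ S := by
  have h1 := (S.starProjection.hasFDerivAt.comp_hasDerivAt x hf)
  have h2 : (S.starProjection ∘ f) = f := by
    ext x; exact Submodule.starProjection_eq_self_iff.2 (h x)
  rw [h2] at h1
  rw [hf.unique h1]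
  exact Submodule.starProjection_apply_mem _ _

variable {E : Type*} [NormedAddCommGroup E] [InnerProductSpace ℝ E] [FiniteDimensional ℝ E]
variable {U : Type*} [TopologicalSpace U] [ChartedSpace E U] [Group U] [LieGroup 𝓘(ℝ, E) ∞ U]

variable (U) in
/-- The nonlocal term of `P_u`. -/
def nonlocal (a : E) (u v : ℝ → E) (x : ℝ) : E :=
  -∫ s in Iic x, projZero U a (brk U (u s) (v s))

theorem Pu_apply (a : E) (u v : ℝ → E) (x : ℝ) : Pu U a u v x =
    deriv v x + projOne U a (brk U (u x) (v x)) + brk U (u x) (nonlocal U a u v x) := rfl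

theorem projZero_add_projOne (a X : E) : projZero U a X + projOne U a X = X :=
  Submodule.starProjection_add_starProjection_orthogonal X

theorem projZero_mem (a X : E) : projZero U a X ∈ isotropy U a :=
  Submodule.starProjection_apply_mem _ _

theorem projOne_mem (a X : E) : projOne U a X ∈ (isotropy U a)ᗮ :=
  Submodule.starProjection_apply_mem _ _

theorem projZero_eq_zero {a X : E} (h : X ∈ (isotropy U a)ᗮ) : projZero U a X = 0 :=
  (Submodule.starProjection_apply_eq_zero_iff _).2 h

theorem projOne_eq_zero {a X : E} (h : X ∈ isotropy U a) : projOne U a X = 0 :=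
  (Submodule.starProjection_apply_eq_zero_iff _).2 (by rwa [Submodule.orthogonal_orthogonal])

theorem projOne_eq_self {a X : E} (h : X ∈ (isotropy U a)ᗮ) : projOne U a X = X :=
  Submodule.starProjection_eq_self_iff.2 h

theorem projZero_add (a X Y : E) : projZero U a (X + Y) = projZero U a X + projZero U a Y :=
  map_add _ _ _

theorem projOne_add (a X Y : E) : projOne U a (X + Y) = projOne U a X + projOne U a Y :=
  map_add _ _ _

variable (U) in
/-- A tangent field read in a frame: a tame function with values in the orthogonal complement of
`𝔲_a`, with rapidly decreasing derivative and limit zero at `-∞`. -/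
structure IsReduced (a : E) (v : ℝ → E) : Prop where
  tame : Tame v
  mem : ∀ x, v x ∈ (isotropy U a)ᗮ
  decay : Rapid (deriv v)
  tendsto : Tendsto v atBot (𝓝 0)

theorem IsReduced.hasDerivAt {a : E} {v : ℝ → E} (hv : IsReduced U a v) (x : ℝ) :
    HasDerivAt v (deriv v x) x := (hv.tame.smooth.differentiable (by simp) x).hasDerivAt

theorem isReduced_of_rapid {a : E} {v : ℝ → E} (hv : Rapid v) (h : ∀ x, v x ∈ (isotropy U a)ᗮ) :
    IsReduced U a v := ⟨hv.tame, h, hv.deriv, hv.tendsto_atBot⟩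

theorem isReduced_of_hasDerivAt {a : E} {v v' : ℝ → E} (hd : ∀ x, HasDerivAt v (v' x) x)
    (hv' : Rapid v') (h : ∀ x, v x ∈ (isotropy U a)ᗮ) (hl : Tendsto v atBot (𝓝 0)) :
    IsReduced U a v := by
  have := FiniteDimensional.complete ℝ E
  have e : deriv v = v' := funext fun x => (hd x).deriv
  exact ⟨Rapid.tame_of_deriv (fun x => (hd x).differentiableAt) (e ▸ hv') hl, h, e ▸ hv', hl⟩

theorem IsReduced.clm {a : E} {v : ℝ → E} (hv : IsReduced U a v) (L : E →L[ℝ] E)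
    (hL : ∀ X, L X ∈ (isotropy U a)ᗮ) : IsReduced U a fun x => L (v x) :=
  isReduced_of_hasDerivAt (fun x => L.hasFDerivAt.comp_hasDerivAt x (hv.hasDerivAt x))
    (hv.decay.clm L) (fun x => hL _)
    (by simpa [Function.comp_def] using (L.continuous.tendsto 0).comp hv.tendsto)

theorem rapid_brk {u v : ℝ → E} (hu : Rapid u) (hv : Tame v) : Rapid fun x => brk U (u x) (v x) := by
  simpa using Rapid.bilin (adL U) hu hv

theorem rapid_projZero (a : E) {v : ℝ → E} (hv : Rapid v) : Rapid fun x => projZero U a (v x) :=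
  hv.clm (isotropy U a).starProjection

theorem rapid_projOne (a : E) {v : ℝ → E} (hv : Rapid v) : Rapid fun x => projOne U a (v x) :=
  hv.clm (isotropy U a)ᗮ.starProjection

theorem rapid_inner {u v : ℝ → E} (hu : Rapid u) (hv : Tame v) : Rapid fun x => ⟪u x, v x⟫_ℝ :=
  Rapid.bilin (innerSL ℝ) hu hv

theorem hasDerivAt_nonlocal {a : E} {u v : ℝ → E} (hu : Rapid u) (hv : Tame v) (x : ℝ) :
    HasDerivAt (nonlocal U a u v) (-projZero U a (brk U (u x) (v x))) x := by
  have := FiniteDimensional.complete ℝ E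
  have h1 := rapid_projZero (U := U) a (rapid_brk (U := U) hu hv)
  exact (hasDerivAt_integral_Iic h1.smooth.continuous (b := 0) h1.integrable.integrableOn x).neg

theorem tendsto_nonlocal {a : E} {u v : ℝ → E} (hu : Rapid u) (hv : Tame v) :
    Tendsto (nonlocal U a u v) atBot (𝓝 0) := by
  have := FiniteDimensional.complete ℝ E
  have h1 := rapid_projZero (U := U) a (rapid_brk (U := U) hu hv)
  have h2 := (tendsto_integral_Iic_atBot (b := 0) h1.integrable.integrableOn).neg
  rwa [neg_zero] at h2

theorem nonlocal_mem {a : E} {u v : ℝ → E} (hu : Rapid u) (hv : Tame v) (x : ℝ) :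
    nonlocal U a u v x ∈ isotropy U a := by
  have h0 : (fun x => projOne U a (nonlocal U a u v x)) = fun _ => 0 := by
    refine eq_of_hasDerivAt_of_tendsto (f' := fun _ => 0) (l := 0) (fun x => ?_)
      (fun x => hasDerivAt_const x _) ?_ tendsto_const_nhds
    · have := (isotropy U a)ᗮ.starProjection.hasFDerivAt.comp_hasDerivAt x
        (hasDerivAt_nonlocal (U := U) (a := a) hu hv x)
      have e : (isotropy U a)ᗮ.starProjection (-projZero U a (brk U (u x) (v x))) = 0 :=
        projOne_eq_zero (neg_mem (projZero_mem _ _))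
      rw [e] at this
      exact this
    · simpa [projOne, Function.comp_def] using ((isotropy U a)ᗮ.starProjection.continuous.tendsto 0).comp
        (tendsto_nonlocal (U := U) (a := a) hu hv)
  have h1 : projOne U a (nonlocal U a u v x) = 0 := congrFun h0 x
  rw [← projZero_add_projOne (U := U) a (nonlocal U a u v x), h1, add_zero]
  exact projZero_mem _ _

theorem tame_nonlocal {a : E} {u v : ℝ → E} (hu : Rapid u) (hv : Tame v) :
    Tame (nonlocal U a u v) := by
  have := FiniteDimensional.complete ℝ E
  refine Rapid.tame_of_deriv (fun x => (hasDerivAt_nonlocal hu hv x).differentiableAt) ?_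
    (tendsto_nonlocal hu hv)
  rw [show deriv (nonlocal U a u v) = fun x => (-ContinuousLinearMap.id ℝ E)
    (projZero U a (brk U (u x) (v x))) from funext fun x => (hasDerivAt_nonlocal hu hv x).deriv]
  exact (rapid_projZero (U := U) a (rapid_brk (U := U) hu hv)).clm _

theorem rapid_Pu {a : E} {u v : ℝ → E} (hu : Rapid u) (hv : IsReduced U a v) :
    Rapid (Pu U a u v) :=
  (hv.decay.add (rapid_projOne (U := U) a (rapid_brk (U := U) hu hv.tame))).add
    (rapid_brk (U := U) hu (tame_nonlocal hu hv.tame))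

/-- `v + h`, with `h` the nonlocal term, is an antiderivative of `P_u v` for the covariant derivative
`∂_x + [u, ·]`. -/
theorem hasDerivAt_add_nonlocal {a : E} {u v : ℝ → E} (hu : Rapid u) (hv : IsReduced U a v) (x : ℝ) :
    HasDerivAt (fun x => v x + nonlocal U a u v x)
      (Pu U a u v x - brk U (u x) (v x + nonlocal U a u v x)) x := by
  refine ((hv.hasDerivAt x).fun_add
    (hasDerivAt_nonlocal (U := U) (a := a) hu hv.tame x)).congr_deriv ?_
  rw [Pu_apply, brk_add_right]
  have e := projZero_add_projOne (U := U) a (brk U (u x) (v x))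
  rw [← eq_sub_iff_add_eq'] at e
  rw [e]
  abel

/-- The basic identity: in the frame, `P_u` is the ordinary derivative of the field corrected by
the nonlocal term, `(g (v + h) g⁻¹)_x = g (P_u v) g⁻¹`. -/
theorem IsFrame.hasDerivAt_add_nonlocal {a : E} {γ u v : ℝ → E} {g : ℝ → U}
    (h : IsFrame U a γ u g) (hv : IsReduced U a v) (x : ℝ) :
    HasDerivAt (fun x => Ad U (g x) (v x + nonlocal U a u v x)) (Ad U (g x) (Pu U a u v x)) x := by
  have := h.hasDerivAt_Ad_apply (AdjointCurves.hasDerivAt_add_nonlocal h.pot hv x)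
  simpa using this

variable (hinv : ∀ (g : U) (X Y : E), ⟪Ad U g X, Ad U g Y⟫_ℝ = ⟪X, Y⟫_ℝ)

include hinv

theorem brk_mem_orthogonal {a X Y : E} (hY : Y ∈ (isotropy U a)ᗮ) (hX : X ∈ isotropy U a) :
    brk U Y X ∈ (isotropy U a)ᗮ := by
  rw [isotropy_orthogonal hinv] at *
  exact brk_isotropy_mem_orbitTangent hinv hX hY

theorem Pu_mem {a : E} {u v : ℝ → E} (hu : Rapid u) (hua : ∀ x, u x ∈ (isotropy U a)ᗮ)
    (hv : IsReduced U a v) (x : ℝ) : Pu U a u v x ∈ (isotropy U a)ᗮ :=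
  add_mem (add_mem (HasDerivAt.mem_submodule (hv.hasDerivAt x) hv.mem) (projOne_mem _ _))
    (brk_mem_orthogonal hinv (hua x) (nonlocal_mem hu hv.tame x))

theorem isReduced_Pu {a : E} {u v : ℝ → E} (hu : Rapid u) (hua : ∀ x, u x ∈ (isotropy U a)ᗮ)
    (hv : IsReduced U a v) : IsReduced U a (Pu U a u v) :=
  isReduced_of_rapid (rapid_Pu hu hv) (Pu_mem hinv hu hua hv)

/-- Solving `P_u b = w`: the solution is the part orthogonal to `𝔲_a` of an antiderivative of `w` for
the covariant derivative `∂_x + [u, ·]`. -/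
theorem Pu_projOne {a : E} {u p w : ℝ → E} (hu : Rapid u) (hua : ∀ x, u x ∈ (isotropy U a)ᗮ)
    (hb : Tame fun x => projOne U a (p x)) (hpl : Tendsto p atBot (𝓝 0)) (hw : ∀ x, w x ∈ (isotropy U a)ᗮ)
    (hd : ∀ x, HasDerivAt p (w x - brk U (u x) (p x)) x) :
    nonlocal U a u (fun x => projOne U a (p x)) = (fun x => projZero U a (p x)) ∧
      Pu U a u (fun x => projOne U a (p x)) = w := by
  have hbrk : ∀ x, brk U (u x) (p x) = brk U (u x) (projZero U a (p x)) +
      brk U (u x) (projOne U a (p x)) := fun x => by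
    rw [← brk_add_right, projZero_add_projOne]
  have h0 : nonlocal U a u (fun x => projOne U a (p x)) = (fun x => projZero U a (p x)) := by
    refine eq_of_hasDerivAt_of_tendsto (fun x => hasDerivAt_nonlocal hu hb x) (fun x => ?_)
      (tendsto_nonlocal hu hb)
      (by simpa [projZero, Function.comp_def] using
        ((isotropy U a).starProjection.continuous.tendsto 0).comp hpl)
    have h1 := (isotropy U a).starProjection.hasFDerivAt.comp_hasDerivAt x (hd x)
    have e : (isotropy U a).starProjection (w x - brk U (u x) (p x)) =
        -projZero U a (brk U (u x) (projOne U a (p x))) := by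
      rw [map_sub]
      change projZero U a (w x) - projZero U a (brk U (u x) (p x)) = _
      rw [hbrk x, projZero_add, projZero_eq_zero (hw x),
        projZero_eq_zero (brk_mem_orthogonal hinv (hua x) (projZero_mem a (p x)))]
      simp
    rw [e] at h1
    exact h1
  refine ⟨h0, ?_⟩
  ext x
  rw [Pu_apply, h0]
  have h1 := (isotropy U a)ᗮ.starProjection.hasFDerivAt.comp_hasDerivAt x (hd x)
  rw [map_sub] at h1
  have h2 : deriv (fun x => projOne U a (p x)) x = w x - projOne U a (brk U (u x) (p x)) := by
    have h3 : (isotropy U a)ᗮ.starProjection (w x) = w x := projOne_eq_self (hw x)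
    rw [h3] at h1
    exact h1.deriv
  rw [h2, hbrk x, projOne_add,
    projOne_eq_self (brk_mem_orthogonal hinv (hua x) (projZero_mem a (p x)))]
  abel

/-- `P_u` is injective on reduced fields. -/
theorem IsFrame.Pu_injective {a : E} {γ u v v' : ℝ → E} {g : ℝ → U}
    (h : IsFrame U a γ u g) (hv : IsReduced U a v) (hv' : IsReduced U a v')
    (he : Pu U a u v = Pu U a u v') : v = v' := by
  have hlim : ∀ {v : ℝ → E}, IsReduced U a v →
      Tendsto (fun x => Ad U (g x) (v x + nonlocal U a u v x)) atBot (𝓝 0) := by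
    intro v hv
    rw [tendsto_zero_iff_norm_tendsto_zero]
    simp only [norm_Ad hinv]
    rw [← tendsto_zero_iff_norm_tendsto_zero]
    simpa using hv.tendsto.add (tendsto_nonlocal (U := U) (a := a) h.pot hv.tame)
  have h1 := eq_of_hasDerivAt_of_tendsto (fun x => h.hasDerivAt_add_nonlocal hv x)
    (fun x => by rw [he]; exact h.hasDerivAt_add_nonlocal hv' x) (hlim hv) (hlim hv')
  ext x
  have h2 := congrFun h1 x
  have h3 : v x + nonlocal U a u v x = v' x + nonlocal U a u v' x := by
    rw [← Ad_inv_Ad (g x) (v x + nonlocal U a u v x), h2, Ad_inv_Ad]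
  have h4 := congrArg (projOne U a) h3
  rwa [projOne_add, projOne_add, projOne_eq_zero (nonlocal_mem h.pot hv.tame x),
    projOne_eq_zero (nonlocal_mem h.pot hv'.tame x), projOne_eq_self (hv.mem x),
    projOne_eq_self (hv'.mem x), add_zero, add_zero] at h4

/-- `P_u` is skew-adjoint at the fields whose nonlocal term leaves no boundary term at `+∞`. -/
theorem IsFrame.Pu_skew {a : E} {γ u w m : ℝ → E} {g : ℝ → U}
    (h : IsFrame U a γ u g) (hw : IsReduced U a w) (hm : IsReduced U a m)
    (htop : Tendsto w atTop (𝓝 0)) (htop' : Tendsto (nonlocal U a u w) atTop (𝓝 0)) :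
    ∫ x, ⟪Pu U a u w x, m x⟫_ℝ = -∫ x, ⟪w x, Pu U a u m x⟫_ℝ := by
  set W : ℝ → E := fun x => w x + nonlocal U a u w x
  set M : ℝ → E := fun x => m x + nonlocal U a u m x
  have hort : ∀ {X Y : E}, X ∈ isotropy U a → Y ∈ (isotropy U a)ᗮ → ⟪X, Y⟫_ℝ = 0 :=
    fun hX hY => (Submodule.mem_orthogonal _ _).1 hY _ hX
  have hd : ∀ x, HasDerivAt (fun x => ⟪W x, M x⟫_ℝ)
      (⟪Pu U a u w x, m x⟫_ℝ + ⟪w x, Pu U a u m x⟫_ℝ) x := by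
    intro x
    have h1 := (h.hasDerivAt_add_nonlocal hw x).inner ℝ (h.hasDerivAt_add_nonlocal hm x)
    simp only [hinv] at h1
    refine h1.congr_deriv ?_
    rw [inner_add_left, inner_add_right, hort (nonlocal_mem h.pot hw.tame x)
      (Pu_mem hinv h.pot h.mem hm x), real_inner_comm (nonlocal U a u m x),
      hort (nonlocal_mem h.pot hm.tame x) (Pu_mem hinv h.pot h.mem hw x)]
    ring
  have hi1 : Integrable fun x => ⟪Pu U a u w x, m x⟫_ℝ :=
    (rapid_inner (rapid_Pu h.pot hw) hm.tame).integrable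
  have hi2 : Integrable fun x => ⟪w x, Pu U a u m x⟫_ℝ := by
    simpa only [real_inner_comm] using (rapid_inner (rapid_Pu h.pot hm) hw.tame).integrable
  obtain ⟨C, hC⟩ := (hm.tame.add (tame_nonlocal (U := U) (a := a) h.pot hm.tame)).exists_bound
  have hlim : ∀ l : Filter ℝ, Tendsto W l (𝓝 0) → Tendsto (fun x => ⟪W x, M x⟫_ℝ) l (𝓝 0) := by
    intro l hl
    refine squeeze_zero_norm (a := fun x => ‖W x‖ * C) (fun x => ?_) ?_
    · exact (norm_inner_le_norm _ _).trans (mul_le_mul_of_nonneg_left (hC x) (norm_nonneg _))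
    · simpa using hl.norm.mul_const C
  have h2 := integral_of_hasDerivAt_of_tendsto hd (hi1.add hi2)
    (hlim atBot (by simpa using hw.tendsto.add (tendsto_nonlocal (U := U) (a := a) h.pot hw.tame)))
    (hlim atTop (by simpa using htop.add htop'))
  rw [integral_add hi1 hi2, sub_zero] at h2
  linarith

/-- The inverse of `J_a` is given by the tangent pseudo-inverse at `a`. -/
theorem JaInv_eq {a : E} {v : ℝ → E} (hv : ∀ x, v x ∈ (isotropy U a)ᗮ) :
    JaInv U a v = fun x => omega U a a (v x) := by
  ext x
  have h1 : brk U (omega U a a (v x)) a = v x := by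
    rw [brk_omega hinv (mem_adOrbit_self a), tanProj_eq_self]
    rw [← isotropy_orthogonal hinv]; exact hv x
  have hex : ∃ w ∈ (isotropy U a)ᗮ, brk U w a = v x := ⟨_, by
    rw [isotropy_orthogonal hinv]; exact omega_mem _, h1⟩
  simp only [JaInv]
  rw [dif_pos hex]
  refine eq_of_brk_eq hinv (p := a) ?_ (omega_mem _) (hex.choose_spec.2.trans h1.symm)
  rw [← isotropy_orthogonal hinv]
  exact hex.choose_spec.1

theorem JaInv_Ja {a : E} {w : ℝ → E} (hw : ∀ x, w x ∈ (isotropy U a)ᗮ) : JaInv U a (Ja U a w) = w := by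
  rw [JaInv_eq hinv fun x => ?_]
  · ext x
    exact omega_brk hinv (mem_adOrbit_self a) (by rw [← isotropy_orthogonal hinv]; exact hw x)
  · rw [isotropy_orthogonal hinv]; exact ⟨w x, rfl⟩

theorem IsReduced.Ja {a : E} {v : ℝ → E} (hv : IsReduced U a v) : IsReduced U a (Ja U a v) := by
  have := hv.clm ((adL U).flip a) fun X => by
    rw [isotropy_orthogonal hinv]; exact ⟨X, by simp [adRight]⟩
  simp only [ContinuousLinearMap.flip_apply, adL_apply] at this
  exact this

theorem IsReduced.JaInv {a : E} {v : ℝ → E} (hv : IsReduced U a v) : IsReduced U a (JaInv U a v) := by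
  rw [JaInv_eq hinv hv.mem]
  exact hv.clm _ fun X => by rw [isotropy_orthogonal hinv]; exact omega_mem _

theorem Ja_JaInv {a : E} {v : ℝ → E} (hv : ∀ x, v x ∈ (isotropy U a)ᗮ) : Ja U a (JaInv U a v) = v := by
  rw [JaInv_eq hinv hv]
  ext x
  rw [Ja, brk_omega hinv (mem_adOrbit_self a), tanProj_eq_self]
  rw [← isotropy_orthogonal hinv]; exact hv x

/-- A tangent field, read in the frame, is reduced. -/
theorem IsFrame.isReduced {a : E} {γ u ξ : ℝ → E} {g : ℝ → U} (h : IsFrame U a γ u g)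
    (hξ : IsTangentField U γ ξ) : IsReduced U a fun x => Ad U (g x)⁻¹ (ξ x) := by
  have := FiniteDimensional.complete ℝ E
  have hξ' := rapidDecay_iff.1 hξ.decay
  have hξt : Tame ξ := Rapid.tame_of_deriv (hξ.smooth.differentiable (by simp)) hξ' hξ.tendsto
  have hG := h.tame_Ad_inv hinv
  have hv : Tame fun x => Ad U (g x)⁻¹ (ξ x) :=
    Tame.bilin (ContinuousLinearMap.id ℝ (E →L[ℝ] E)) hG hξt
  refine isReduced_of_hasDerivAt (fun x => h.hasDerivAt_Ad_inv_apply
    (hξ.smooth.differentiable (by simp) x).hasDerivAt) ?_ (fun x => ?_) ?_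
  · have h1 : Rapid fun x => Ad U (g x)⁻¹ (deriv ξ x) :=
      Rapid.bilin' (ContinuousLinearMap.id ℝ (E →L[ℝ] E)) hG hξ'
    have h2 := h1.add ((rapid_brk (U := U) h.pot hv).clm (-ContinuousLinearMap.id ℝ E))
    simpa [sub_eq_add_neg] using h2
  · rw [isotropy_orthogonal hinv]
    have h1 := Ad_mem_orbitTangent (g := (g x)⁻¹) (hξ.tangent x)
    rwa [h.lift x, Ad_inv_Ad] at h1
  · rw [tendsto_zero_iff_norm_tendsto_zero]
    simp only [norm_Ad hinv]
    exact tendsto_zero_iff_norm_tendsto_zero.1 hξ.tendsto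

/-- A reduced field, transported by the frame, is a tangent field. -/
theorem IsFrame.isTangentField {a : E} {γ u v : ℝ → E} {g : ℝ → U} (h : IsFrame U a γ u g)
    (hγ : IsCurve U a γ) (hv : IsReduced U a v) : IsTangentField U γ fun x => Ad U (g x) (v x) := by
  have hF := h.tame_Ad hinv hγ
  have hs : Tame fun x => Ad U (g x) (v x) :=
    Tame.bilin (ContinuousLinearMap.id ℝ (E →L[ℝ] E)) hF hv.tame
  refine ⟨hs.smooth, fun x => ?_, rapidDecay_iff.2 ?_, ?_⟩
  · rw [h.lift x]
    refine Ad_mem_orbitTangent ?_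
    rw [← isotropy_orthogonal hinv]; exact hv.mem x
  · rw [show deriv (fun x => Ad U (g x) (v x)) = fun x => Ad U (g x) (deriv v x + brk U (u x) (v x))
      from funext fun x => (h.hasDerivAt_Ad_apply (hv.hasDerivAt x)).deriv]
    exact Rapid.bilin' (ContinuousLinearMap.id ℝ (E →L[ℝ] E)) hF
      (hv.decay.add (rapid_brk (U := U) h.pot hv.tame))
  · rw [tendsto_zero_iff_norm_tendsto_zero]
    simp only [norm_Ad hinv]
    exact tendsto_zero_iff_norm_tendsto_zero.1 hv.tendsto

end PoissonOperator

/-! ### Variations of curves -/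

section TwoVariables

variable {F : Type*} [NormedAddCommGroup F] [NormedSpace ℝ F] {Γ : ℝ → ℝ → F}

theorem hasDerivAt_snd_of_contDiff (h : ContDiff ℝ ∞ fun q : ℝ × ℝ => Γ q.1 q.2) (t x : ℝ) :
    HasDerivAt (Γ t) (fderiv ℝ (fun q : ℝ × ℝ => Γ q.1 q.2) (t, x) (0, 1)) x :=
  (h.differentiable (by simp) (t, x)).hasFDerivAt.comp_hasDerivAt x
    ((hasDerivAt_const x t).prodMk (hasDerivAt_id x))

theorem hasDerivAt_fst_of_contDiff (h : ContDiff ℝ ∞ fun q : ℝ × ℝ => Γ q.1 q.2) (t x : ℝ) :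
    HasDerivAt (fun s => Γ s x) (fderiv ℝ (fun q : ℝ × ℝ => Γ q.1 q.2) (t, x) (1, 0)) t :=
  HasFDerivAt.comp_hasDerivAt (f := fun s : ℝ => (s, x)) t
    (h.differentiable (by simp) (t, x)).hasFDerivAt
    ((hasDerivAt_id t).prodMk (hasDerivAt_const t x))

theorem contDiff_deriv_snd (h : ContDiff ℝ ∞ fun q : ℝ × ℝ => Γ q.1 q.2) :
    ContDiff ℝ ∞ fun q : ℝ × ℝ => deriv (Γ q.1) q.2 := by
  rw [show (fun q : ℝ × ℝ => deriv (Γ q.1) q.2) = fun q =>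
    fderiv ℝ (fun q : ℝ × ℝ => Γ q.1 q.2) q (0, 1) from
    funext fun q => (hasDerivAt_snd_of_contDiff h q.1 q.2).deriv]
  exact (h.fderiv_right (m := ∞) (by simp)).clm_apply contDiff_const

theorem contDiff_deriv_fst (h : ContDiff ℝ ∞ fun q : ℝ × ℝ => Γ q.1 q.2) :
    ContDiff ℝ ∞ fun q : ℝ × ℝ => deriv (fun s => Γ s q.2) q.1 := by
  rw [show (fun q : ℝ × ℝ => deriv (fun s => Γ s q.2) q.1) = fun q =>
    fderiv ℝ (fun q : ℝ × ℝ => Γ q.1 q.2) q (1, 0) from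
    funext fun q => (hasDerivAt_fst_of_contDiff h q.1 q.2).deriv]
  exact (h.fderiv_right (m := ∞) (by simp)).clm_apply contDiff_const

theorem deriv_deriv_comm (h : ContDiff ℝ ∞ fun q : ℝ × ℝ => Γ q.1 q.2) (t x : ℝ) :
    deriv (fun s => deriv (Γ s) x) t = deriv (fun y => deriv (fun s => Γ s y) t) x := by
  set f := fun q : ℝ × ℝ => Γ q.1 q.2
  have h2 : HasFDerivAt (fderiv ℝ f) (fderiv ℝ (fderiv ℝ f) (t, x)) (t, x) :=
    ((h.fderiv_right (m := ∞) (by simp)).differentiable (by simp) _).hasFDerivAt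
  have e1 : HasDerivAt (fun s => deriv (Γ s) x) (fderiv ℝ (fderiv ℝ f) (t, x) (1, 0) (0, 1)) t := by
    rw [show (fun s => deriv (Γ s) x) = fun s => fderiv ℝ f (s, x) (0, 1) from
      funext fun s => (hasDerivAt_snd_of_contDiff h s x).deriv]
    have := (HasFDerivAt.comp_hasDerivAt (f := fun s : ℝ => (s, x)) t h2
      ((hasDerivAt_id t).prodMk (hasDerivAt_const t x))).clm_apply
      (hasDerivAt_const t ((0, 1) : ℝ × ℝ))
    simpa using this
  have e2 : HasDerivAt (fun y => deriv (fun s => Γ s y) t)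
      (fderiv ℝ (fderiv ℝ f) (t, x) (0, 1) (1, 0)) x := by
    rw [show (fun y => deriv (fun s => Γ s y) t) = fun y => fderiv ℝ f (t, y) (1, 0) from
      funext fun y => (hasDerivAt_fst_of_contDiff h t y).deriv]
    have := (HasFDerivAt.comp_hasDerivAt (f := fun y : ℝ => (t, y)) x h2
      ((hasDerivAt_const x t).prodMk (hasDerivAt_id x))).clm_apply
      (hasDerivAt_const x ((1, 0) : ℝ × ℝ))
    simpa using this
  rw [e1.deriv, e2.deriv]
  have : IsSymmSndFDerivAt ℝ f (t, x) := h.contDiffAt.isSymmSndFDerivAt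
    (by simpa using WithTop.coe_le_coe.2 (le_top : (2 : ℕ∞) ≤ ⊤))
  exact this _ _

end TwoVariables

section Settled

variable {F G H : Type*} [NormedAddCommGroup F] [NormedSpace ℝ F] [NormedAddCommGroup G]
  [NormedSpace ℝ G] [NormedAddCommGroup H] [NormedSpace ℝ H]

/-- `f` is tame with a rapidly decreasing derivative. -/
def Settled (f : ℝ → F) : Prop := Tame f ∧ Rapid (deriv f)

theorem Settled.bilin (B : F →L[ℝ] G →L[ℝ] H) {f : ℝ → F} {g : ℝ → G} (hf : Settled f)
    (hg : Settled g) : Settled fun x => B (f x) (g x) := by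
  refine ⟨hf.1.bilin B hg.1, ?_⟩
  rw [show deriv (fun x => B (f x) (g x)) = fun x => B (deriv f x) (g x) + B (f x) (deriv g x) from
    funext fun x => ((B.hasFDerivAt.comp_hasDerivAt x
        (hf.1.smooth.differentiable (by simp) x).hasDerivAt).clm_apply
        (hg.1.smooth.differentiable (by simp) x).hasDerivAt).deriv]
  exact (Rapid.bilin B hf.2 hg.1).add (Rapid.bilin' B hf.1 hg.2)

theorem Settled.comp {F H : Type u} [NormedAddCommGroup F] [NormedSpace ℝ F] [FiniteDimensional ℝ F]
    [NormedAddCommGroup H] [NormedSpace ℝ H] {Ψ : F → H} (hΨ : ContDiff ℝ ∞ Ψ) {f : ℝ → F}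
    (hf : Settled f) : Settled fun x => Ψ (f x) := by
  refine ⟨hf.1.comp hΨ, ?_⟩
  rw [show deriv (fun x => Ψ (f x)) = fun x => fderiv ℝ Ψ (f x) (deriv f x) from
    funext fun x => ((hΨ.differentiable (by simp) (f x)).hasFDerivAt.comp_hasDerivAt x
        (hf.1.smooth.differentiable (by simp) x).hasDerivAt).deriv]
  exact Rapid.bilin' (ContinuousLinearMap.id ℝ (F →L[ℝ] H))
    (hf.1.comp (hΨ.fderiv_right (m := ∞) (by simp))) hf.2

end Settled

section Variations

variable {E : Type*} [NormedAddCommGroup E] [InnerProductSpace ℝ E] [FiniteDimensional ℝ E]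
variable {U : Type*} [TopologicalSpace U] [ChartedSpace E U] [Group U] [LieGroup 𝓘(ℝ, E) ∞ U]

theorem contDiff_exp_clm : ContDiff ℝ ∞ (NormedSpace.exp : (E →L[ℝ] E) → E →L[ℝ] E) := by
  have := FiniteDimensional.complete ℝ E
  exact contDiff_iff_contDiffAt.2 fun x => (NormedSpace.exp_analytic (𝕂 := ℝ) x).contDiffAt

theorem IsTangentField.settled {γ ξ : ℝ → E} (hξ : IsTangentField U γ ξ) : Settled ξ := by
  have := FiniteDimensional.complete ℝ E
  have h := rapidDecay_iff.1 hξ.decay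
  exact ⟨Rapid.tame_of_deriv (hξ.smooth.differentiable (by simp)) h hξ.tendsto, h⟩

variable (hinv : ∀ (g : U) (X Y : E), ⟪Ad U g X, Ad U g Y⟫_ℝ = ⟪X, Y⟫_ℝ)

variable (U) in
/-- The flow of the curve `γ` in the direction of `κ`: `t ↦ Ad (exp t κ) γ`. -/
def expFlow (κ γ : ℝ → E) (t x : ℝ) : E := NormedSpace.exp (t • adL U (κ x)) (γ x)

theorem expFlow_zero (κ γ : ℝ → E) : expFlow U κ γ 0 = γ := by
  ext x; simp [expFlow, NormedSpace.exp_zero]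

theorem contDiff_expFlow {κ γ : ℝ → E} (hκ : ContDiff ℝ ∞ κ) (hγ : ContDiff ℝ ∞ γ) :
    ContDiff ℝ ∞ fun q : ℝ × ℝ => expFlow U κ γ q.1 q.2 :=
  (contDiff_exp_clm.comp (contDiff_fst.smul
    ((adL U (E := E)).contDiff.comp (hκ.comp contDiff_snd)))).clm_apply (hγ.comp contDiff_snd)

theorem exists_Ad_expFlow (κ : ℝ → E) (t x : ℝ) : ∃ g : U,
    (Ad U g : E →L[ℝ] E) = NormedSpace.exp (t • adL U (κ x)) ∧
      (Ad U g⁻¹ : E →L[ℝ] E) = NormedSpace.exp (-(t • adL U (κ x))) := by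
  obtain ⟨g, hg⟩ := exists_Ad_eq_exp_smul (U := U) (κ x) t
  refine ⟨g, hg, ?_⟩
  have h1 := Ad_mul_Ad_inv (E := E) g
  have h2 := exp_neg_mul_exp (t • adL U (κ x))
  rw [← hg] at h2
  calc (Ad U g⁻¹ : E →L[ℝ] E) = NormedSpace.exp (-(t • adL U (κ x))) * Ad U g * Ad U g⁻¹ := by
        rw [h2, one_mul]
    _ = _ := by rw [mul_assoc, h1, mul_one]

/-- The derivative along `γ` of the flow satisfies the linearized flow equation. -/
theorem hasDerivAt_deriv_expFlow {κ γ : ℝ → E} (hκ : ContDiff ℝ ∞ κ) (hγ : ContDiff ℝ ∞ γ) (t x : ℝ) :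
    HasDerivAt (fun s => deriv (expFlow U κ γ s) x) (brk U (deriv κ x) (expFlow U κ γ t x) +
      brk U (κ x) (deriv (expFlow U κ γ t) x)) t := by
  have h := contDiff_expFlow (U := U) hκ hγ
  have h1 := (hasDerivAt_fst_of_contDiff (Γ := fun t x => deriv (expFlow U κ γ t) x)
    (contDiff_deriv_snd h) t x)
  rw [← h1.deriv, deriv_deriv_comm h] at h1
  have e : (fun y => deriv (fun s => expFlow U κ γ s y) t) =
      fun y => adL U (κ y) (expFlow U κ γ t y) := by
    ext y
    rw [adL_apply]
    exact (hasDerivAt_exp_adL U (κ y) (γ y) t).deriv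
  have h2 := ((adL U (E := E)).hasFDerivAt.comp_hasDerivAt x
    (hκ.differentiable (by simp) x).hasDerivAt).clm_apply
    (hasDerivAt_snd_of_contDiff h t x).differentiableAt.hasDerivAt
  have h3 : deriv (fun y => adL U (κ y) (expFlow U κ γ t y)) x = _ := h2.deriv
  rw [e, h3] at h1
  simpa using h1

include hinv

/-- The derivative of the flow along the curve is, after transport back to `γ`, tangent to the orbit,
and differs from the derivative of `γ` by a multiple of the derivative of `κ`. -/
theorem exists_deriv_expFlow {κ γ : ℝ → E} (hκ : ContDiff ℝ ∞ κ) (hγ : ContDiff ℝ ∞ γ) {x : ℝ}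
    (hγt : deriv γ x ∈ orbitTangent U (γ x)) (t : ℝ) :
    deriv (expFlow U κ γ t) x ∈ orbitTangent U (expFlow U κ γ t x) ∧
      ‖deriv (expFlow U κ γ t) x‖ ≤ ‖deriv γ x‖ + ‖adL U (E := E)‖ * ‖deriv κ x‖ * ‖γ x‖ * |t| := by
  set N := adL U (κ x)
  set V : ℝ → E := fun s => NormedSpace.exp (-(s • N)) (deriv (expFlow U κ γ s) x) with hV
  set V' : ℝ → E := fun s => NormedSpace.exp (-(s • N)) (brk U (deriv κ x) (expFlow U κ γ s x))
  have hVd : ∀ s, HasDerivAt V (V' s) s := by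
    intro s
    have h1 := hasDerivAt_exp_smul_const (𝕂 := ℝ) (-N) s
    simp only [smul_neg] at h1
    have h2 := h1.clm_apply (hasDerivAt_deriv_expFlow (U := U) hκ hγ s x)
    refine h2.congr_deriv ?_
    simp only [N, mul_neg, neg_apply, mul_apply_eq_comp, adL_apply, map_add, V']
    abel
  have hV' : ∀ s, ∃ Y, V' s = brk U Y (γ x) ∧ ‖V' s‖ ≤ ‖adL U (E := E)‖ * ‖deriv κ x‖ * ‖γ x‖ := by
    intro s
    obtain ⟨g, hg, hg'⟩ := exists_Ad_expFlow (U := U) κ s x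
    have e : V' s = brk U (Ad U g⁻¹ (deriv κ x)) (γ x) := by
      simp only [V']
      rw [← hg', Ad_brk, expFlow, ← hg, Ad_inv_Ad]
    refine ⟨_, e, ?_⟩
    rw [e, ← adL_apply]
    refine ((adL U).le_opNorm₂ _ _).trans ?_
    rw [norm_Ad hinv]
  have hV0 : V 0 = deriv γ x := by simp [hV, expFlow_zero, NormedSpace.exp_zero]
  have hmem : V t ∈ orbitTangent U (γ x) := by
    have h1 : ∀ s, HasDerivAt (fun s => norProj U (γ x) (V s)) 0 s := by
      intro s
      have h2 := (orbitTangent U (γ x))ᗮ.starProjection.hasFDerivAt.comp_hasDerivAt s (hVd s)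
      obtain ⟨Y, hY, -⟩ := hV' s
      have h3 : (orbitTangent U (γ x))ᗮ.starProjection (V' s) = 0 :=
        (Submodule.starProjection_apply_eq_zero_iff _).2
          (by rw [Submodule.orthogonal_orthogonal, hY]; exact ⟨Y, rfl⟩)
      rw [h3] at h2
      exact h2
    have h2 := is_const_of_deriv_eq_zero (fun s => (h1 s).differentiableAt) (fun s => (h1 s).deriv) t 0
    have h3 : norProj U (γ x) (V 0) = 0 := (Submodule.starProjection_apply_eq_zero_iff _).2
      (by rwa [Submodule.orthogonal_orthogonal, hV0])
    rw [h3] at h2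
    rw [← tanProj_add_norProj (U := U) (γ x) (V t), h2, add_zero]
    exact tanProj_mem _ _
  obtain ⟨g, hg, hg'⟩ := exists_Ad_expFlow (U := U) κ t x
  have hR : deriv (expFlow U κ γ t) x = Ad U g (V t) := by
    simp only [hV]
    rw [← hg', Ad_Ad_inv]
  have hΓ : expFlow U κ γ t x = Ad U g (γ x) := by rw [expFlow, ← hg]
  refine ⟨by rw [hR, hΓ]; exact Ad_mem_orbitTangent hmem, ?_⟩
  rw [hR, norm_Ad hinv]
  have h1 := convex_univ.norm_image_sub_le_of_norm_hasDerivWithin_le (f := V) (f' := V')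
    (fun s _ => (hVd s).hasDerivWithinAt) (fun s _ => (hV' s).choose_spec.2) (mem_univ 0) (mem_univ t)
  rw [hV0, sub_zero, Real.norm_eq_abs] at h1
  calc ‖V t‖ = ‖deriv γ x + (V t - deriv γ x)‖ := by rw [add_sub_cancel]
    _ ≤ _ := (norm_add_le _ _).trans (add_le_add_right h1 _)

/-- Every tangent field is the velocity of a variation. -/
theorem IsCurve.exists_variation {a : E} {γ β : ℝ → E} (hγ : IsCurve U a γ)
    (hβ : IsTangentField U γ β) : ∃ Γ, IsVariation U a γ β Γ := by
  have hγs : Settled γ := ⟨hγ.tame hinv, rapidDecay_iff.1 hγ.decay⟩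
  set κ : ℝ → E := fun x => omega U a (γ x) (β x) with hκdef
  have hκ : Settled κ := Settled.bilin (ContinuousLinearMap.id ℝ (E →L[ℝ] E))
    (hγs.comp (contDiff_omega (U := U) a)) hβ.settled
  have hbound : ∀ t x, ‖expFlow U κ γ t x‖ = ‖a‖ := by
    intro t x
    obtain ⟨g, hg, -⟩ := exists_Ad_expFlow (U := U) κ t x
    rw [expFlow, ← hg, norm_Ad hinv, norm_of_mem_adOrbit hinv (hγ.orbit.mem x)]
  have hR := fun x t => exists_deriv_expFlow hinv hκ.1.smooth hγs.1.smooth (hγ.orbit.tangent x) t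
  have hexp : ∀ t : ℝ, ContDiff ℝ ∞ fun X : E => NormedSpace.exp (t • adL U X) := fun t =>
    contDiff_exp_clm.comp (t • adL U (E := E)).contDiff
  have hκ0 : Tendsto κ atBot (𝓝 0) := by
    refine squeeze_zero_norm (a := fun x => ‖omega U a a‖ * ‖β x‖)
      (fun x => norm_omega_le hinv (hγ.orbit.mem x) _) ?_
    simpa using (tendsto_zero_iff_norm_tendsto_zero.1 hβ.tendsto).const_mul ‖omega U a a‖
  refine ⟨expFlow U κ γ, contDiff_expFlow hκ.1.smooth hγs.1.smooth, fun t => ?_, expFlow_zero κ γ,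
    fun x => ?_, fun R k => ?_⟩
  · have hset : Settled (expFlow U κ γ t) := Settled.bilin (ContinuousLinearMap.id ℝ (E →L[ℝ] E))
      (hκ.comp (hexp t)) hγs
    refine ⟨⟨hset.1.smooth, fun x => ?_, fun x => (hR x t).1⟩, ?_, rapidDecay_iff.2 hset.2⟩
    · obtain ⟨g, hg, -⟩ := exists_Ad_expFlow (U := U) κ t x
      rw [expFlow, ← hg]
      exact Ad_mem_adOrbit g (hγ.orbit.mem x)
    · have h1 := (isBoundedBilinearMap_apply (𝕜 := ℝ) (E := E) (F := E)).continuous.tendsto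
        (NormedSpace.exp (t • adL U (0 : E)), a)
      have h2 := h1.comp ((((hexp t).continuous.tendsto 0).comp hκ0).prodMk_nhds hγ.tendsto)
      simp only [Function.comp_def, map_zero, smul_zero, NormedSpace.exp_zero] at h2
      exact h2
  · have h1 := hasDerivAt_exp_adL U (κ x) (γ x) 0
    have h2 : brk U (κ x) (γ x) = β x := by
      rw [hκdef, brk_omega hinv (hγ.orbit.mem x), tanProj_eq_self (hβ.tangent x)]
    simp only [zero_smul, NormedSpace.exp_zero, one_apply_eq_self, h2] at h1
    exact h1
  · obtain ⟨C₁, hC₁⟩ := hγs.2.weightBdd k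
    obtain ⟨C₂, hC₂⟩ := hκ.2.weightBdd k
    obtain ⟨C₃, hC₃⟩ := hκ.1.exists_bound
    set M := ‖adL U (E := E)‖
    have hR' : ∀ t x, |t| ≤ R → |x| ^ k * ‖deriv (expFlow U κ γ t) x‖ ≤ C₁ + M * C₂ * ‖a‖ * R := by
      intro t x ht
      have h1 := (hR x t).2
      rw [norm_of_mem_adOrbit hinv (hγ.orbit.mem x)] at h1
      have hR0 : 0 ≤ R := (abs_nonneg t).trans ht
      calc |x| ^ k * ‖deriv (expFlow U κ γ t) x‖
          ≤ (1 + |x|) ^ k * (‖deriv γ x‖ + M * ‖deriv κ x‖ * ‖a‖ * R) := by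
            gcongr
            · linarith
            · exact h1.trans (by gcongr)
        _ = (1 + |x|) ^ k * ‖deriv γ x‖ + M * ((1 + |x|) ^ k * ‖deriv κ x‖) * ‖a‖ * R := by ring
        _ ≤ _ := by gcongr; exacts [hC₁ x, hC₂ x]
    refine ⟨max (C₁ + M * C₂ * ‖a‖ * R) (M * C₂ * ‖a‖ + M * C₃ * (C₁ + M * C₂ * ‖a‖ * R)),
      fun t x ht => ⟨(hR' t x ht).trans (le_max_left _ _), le_trans ?_ (le_max_right _ _)⟩⟩
    rw [(hasDerivAt_deriv_expFlow (U := U) hκ.1.smooth hγs.1.smooth t x).deriv]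
    have h1 : ‖brk U (deriv κ x) (expFlow U κ γ t x)‖ ≤ M * ‖deriv κ x‖ * ‖a‖ := by
      rw [← adL_apply, ← hbound t x]; exact (adL U).le_opNorm₂ _ _
    have h2 : ‖brk U (κ x) (deriv (expFlow U κ γ t) x)‖ ≤
        M * C₃ * ‖deriv (expFlow U κ γ t) x‖ := by
      rw [← adL_apply]; exact ((adL U).le_opNorm₂ _ _).trans (by gcongr; exact hC₃ x)
    have hC₃0 : 0 ≤ C₃ := (norm_nonneg _).trans (hC₃ 0)
    calc |x| ^ k * ‖brk U (deriv κ x) (expFlow U κ γ t x) + brk U (κ x) (deriv (expFlow U κ γ t) x)‖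
        ≤ |x| ^ k * (M * ‖deriv κ x‖ * ‖a‖ + M * C₃ * ‖deriv (expFlow U κ γ t) x‖) := by
          gcongr; exact (norm_add_le _ _).trans (add_le_add h1 h2)
      _ = M * (|x| ^ k * ‖deriv κ x‖) * ‖a‖ +
          M * C₃ * (|x| ^ k * ‖deriv (expFlow U κ γ t) x‖) := by ring
      _ ≤ _ := by
          gcongr
          · exact le_trans (by gcongr; linarith) (hC₂ x)
          · exact hR' t x ht

end Variations

/-! ### The derivative of the development map -/

section DerivativeOfDevelopment

/-- The derivative of a product one of whose factors vanishes and whose other factor is merely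
continuous. -/
theorem hasDerivAt_mul_of_eq_zero {R : Type*} [NormedRing R] [NormedAlgebra ℝ R] {f g : ℝ → R} {g' : R}
    {t : ℝ} (hf : ContinuousAt f t) (hg : HasDerivAt g g' t) (h0 : g t = 0) :
    HasDerivAt (fun s => f s * g s) (f t * g') t := by
  rw [hasDerivAt_iff_tendsto_slope] at hg ⊢
  have h1 := (hf.tendsto.mono_left nhdsWithin_le_nhds).mul hg
  refine h1.congr' (Eventually.of_forall fun s => ?_)
  simp [slope_def_module, h0]

variable {E : Type*} [NormedAddCommGroup E] [InnerProductSpace ℝ E] [FiniteDimensional ℝ E]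
variable {U : Type*} [TopologicalSpace U] [ChartedSpace E U] [Group U] [LieGroup 𝓘(ℝ, E) ∞ U]

theorem integrable_const_div_one_add_sq (C : ℝ) : Integrable fun x : ℝ => C / (1 + x ^ 2) := by
  simpa [div_eq_mul_inv] using integrable_inv_one_add_sq.const_mul C

theorem setIntegral_const_div_one_add_sq_le {C : ℝ} (hC : 0 ≤ C) (x : ℝ) :
    ∫ s in Iic x, C / (1 + s ^ 2) ≤ C * Real.pi := by
  refine (setIntegral_le_integral (integrable_const_div_one_add_sq C)
    (Eventually.of_forall fun s => by positivity)).trans_eq ?_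
  simp only [div_eq_mul_inv]
  rw [integral_const_mul, integral_univ_inv_one_add_sq]

/-- A family `H t` of antiderivatives with common value `e` at `-∞`, whose derivatives `-K t` are of
order `t` with an integrable bound, is continuous and differentiable at `t = 0`. -/
theorem hasDerivAt_of_antideriv_family {F : Type*} [NormedAddCommGroup F] [NormedSpace ℝ F]
    [CompleteSpace F] {H K : ℝ → ℝ → F} {e : F} {C : ℝ} (hC : 0 ≤ C)
    (hd : ∀ t x, HasDerivAt (H t) (-K t x) x) (hl : ∀ t, Tendsto (H t) atBot (𝓝 e))
    (hKc : ∀ t, Continuous (K t)) (hKb : ∀ t x, |t| ≤ 1 → ‖K t x‖ ≤ C / (1 + x ^ 2) * |t|) :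
    (∀ x, Tendsto (fun t => H t x) (𝓝 0) (𝓝 e)) ∧
      ∀ K' : ℝ → F, Continuous K' → (∀ x, HasDerivAt (fun t => K t x) (K' x) 0) →
        ∀ x, HasDerivAt (fun t => H t x) (-∫ s in Iic x, K' s) 0 := by
  have hball : Metric.ball (0 : ℝ) 1 ∈ 𝓝 (0 : ℝ) := Metric.ball_mem_nhds _ one_pos
  have hbi : ∀ t : ℝ, Integrable fun x : ℝ => C / (1 + x ^ 2) * |t| := fun t =>
    (integrable_const_div_one_add_sq C).mul_const _
  have hKi : ∀ t, |t| ≤ 1 → Integrable (K t) := fun t ht => Integrable.mono' (hbi t)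
    (hKc t).aestronglyMeasurable (Eventually.of_forall fun x => hKb t x ht)
  have hHK : ∀ t x, |t| ≤ 1 → H t x = e - ∫ s in Iic x, K t s := by
    intro t x ht
    have h1 := integral_Iic_of_hasDerivAt_of_tendsto' (a := x) (fun s _ => hd t s)
      (hKi t ht).neg.integrableOn (hl t)
    rw [integral_neg] at h1
    rw [sub_eq_add_neg, h1, add_sub_cancel]
  constructor
  · intro x
    have h1 : Tendsto (fun t : ℝ => C * Real.pi * |t|) (𝓝 0) (𝓝 0) := by
      have : Continuous fun t : ℝ => C * Real.pi * |t| := by fun_prop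
      simpa using this.tendsto 0
    rw [tendsto_iff_norm_sub_tendsto_zero]
    refine squeeze_zero' (Eventually.of_forall fun _ => norm_nonneg _) ?_ h1
    filter_upwards [hball] with t ht
    rw [mem_ball_zero_iff, Real.norm_eq_abs] at ht
    rw [hHK t x ht.le, sub_sub_cancel_left, norm_neg]
    calc ‖∫ s in Iic x, K t s‖ ≤ ∫ s in Iic x, C / (1 + s ^ 2) * |t| :=
          norm_integral_le_of_norm_le (hbi t).integrableOn
            (Eventually.of_forall fun s => hKb t s ht.le)
      _ = (∫ s in Iic x, C / (1 + s ^ 2)) * |t| := integral_mul_const _ _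
      _ ≤ _ := by
          gcongr
          exact setIntegral_const_div_one_add_sq_le hC x
  · intro K' hK'c hKd x
    have hK0 : ∀ x, K 0 x = 0 := fun x => by simpa using hKb 0 x (by simp)
    have hint := hasFDerivAt_integral_of_dominated_loc_of_lip' (μ := volume.restrict (Iic x))
      (𝕜 := ℝ) (F := K) (x₀ := (0 : ℝ))
      (F' := fun s => ContinuousLinearMap.toSpanSingleton ℝ (K' s))
      (bound := fun s : ℝ => C / (1 + s ^ 2)) hball
      (fun t _ => (hKc t).aestronglyMeasurable) (hKi 0 (by simp)).integrableOn
      (((ContinuousLinearMap.toSpanSingletonCLE (𝕜 := ℝ) (E := F)).continuous.comp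
        hK'c).aestronglyMeasurable)
      (Eventually.of_forall fun s t ht => by
        rw [mem_ball_zero_iff, Real.norm_eq_abs] at ht
        rw [hK0, sub_zero, sub_zero, Real.norm_eq_abs]
        exact hKb t s ht.le)
      (integrable_const_div_one_add_sq C).integrableOn
      (Eventually.of_forall fun s => (hKd s).hasFDerivAt)
    have h3 := hint.2.hasDerivAt
    have e₁ : (∫ s in Iic x, (ContinuousLinearMap.toSpanSingleton ℝ (K' s) : ℝ →L[ℝ] F)) 1 =
        ∫ s in Iic x, K' s := by
      rw [ContinuousLinearMap.integral_apply hint.1]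
      simp only [ContinuousLinearMap.toSpanSingleton_apply, one_smul]
    rw [e₁] at h3
    refine (h3.const_sub e).congr_of_eventuallyEq ?_
    filter_upwards [hball] with t ht
    rw [mem_ball_zero_iff, Real.norm_eq_abs] at ht
    exact hHK t x ht.le

variable (hinv : ∀ (g : U) (X Y : E), ⟪Ad U g X, Ad U g Y⟫_ℝ = ⟪X, Y⟫_ℝ)

include hinv

/-- Along a variation of curves, the angular velocity is Lipschitz in the parameter, with an
integrable bound. -/
theorem IsVariation.exists_angVel_sub_le {a : E} {γ β : ℝ → E} {Γ : ℝ → ℝ → E}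
    (hΓ : IsVariation U a γ β Γ) : ∃ C : ℝ, 0 ≤ C ∧ ∀ t x : ℝ, |t| ≤ 1 →
      ‖angVel U a (Γ t) x - angVel U a (Γ 0) x‖ ≤ C / (1 + x ^ 2) * |t| := by
  have := FiniteDimensional.complete ℝ E
  obtain ⟨C₀, h₀⟩ := hΓ.decay 1 0
  obtain ⟨C₂, h₂⟩ := hΓ.decay 1 2
  set C := C₀ + C₂
  have hC : 0 ≤ C := by
    have h1 := (h₀ 0 0 (by simp)).1
    have h2 := (h₂ 0 0 (by simp)).1
    have h3 : 0 ≤ C₀ := le_trans (by positivity) h1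
    have h4 : 0 ≤ C₂ := le_trans (by positivity) h2
    positivity
  have hx1 : ∀ t x : ℝ, |t| ≤ 1 → ‖deriv (Γ t) x‖ ≤ C / (1 + x ^ 2) := by
    intro t x ht
    rw [le_div_iff₀ (by positivity)]
    have h1 := (h₀ t x ht).1
    have h2 := (h₂ t x ht).1
    rw [sq_abs] at h2
    simp only [C]; nlinarith
  have hx2 : ∀ t x : ℝ, |t| ≤ 1 → ‖deriv (fun s => deriv (Γ s) x) t‖ ≤ C / (1 + x ^ 2) := by
    intro t x ht
    rw [le_div_iff₀ (by positivity)]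
    have h1 := (h₀ t x ht).2
    have h2 := (h₂ t x ht).2
    rw [sq_abs] at h2
    simp only [C]; nlinarith
  have hd : ∀ t x : ℝ, |t| ≤ 1 → ‖deriv (Γ t) x - deriv (Γ 0) x‖ ≤ C / (1 + x ^ 2) * |t| := by
    intro t x ht
    have h1 := (convex_Icc (-1 : ℝ) 1).norm_image_sub_le_of_norm_deriv_le
      (f := fun s => deriv (Γ s) x) (C := C / (1 + x ^ 2))
      (fun s _ => (hasDerivAt_fst_of_contDiff (Γ := fun s x => deriv (Γ s) x)
        (contDiff_deriv_snd hΓ.smooth) s x).differentiableAt)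
      (fun s hs => hx2 s x (abs_le.2 (mem_Icc.1 hs))) (x := 0) (y := t)
      (mem_Icc.2 ⟨by norm_num, by norm_num⟩) (mem_Icc.2 (abs_le.1 ht))
    simpa using h1
  have hΓd : ∀ t x : ℝ, |t| ≤ 1 → ‖Γ t x - Γ 0 x‖ ≤ C * Real.pi * |t| := by
    intro t x ht
    have h1 : ∀ t x, HasDerivAt (Γ t) (deriv (Γ t) x) x := fun t x =>
      ((hΓ.curve t).orbit.smooth.differentiable (by simp) x).hasDerivAt
    have hi : Integrable fun s => deriv (Γ t) s - deriv (Γ 0) s :=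
      (rapidDecay_iff.1 (hΓ.curve t).decay).integrable.sub
        (rapidDecay_iff.1 (hΓ.curve 0).decay).integrable
    have h2 := integral_Iic_of_hasDerivAt_of_tendsto' (a := x)
      (fun s _ => (h1 t s).fun_sub (h1 0 s)) hi.integrableOn
      ((hΓ.curve t).tendsto.sub (hΓ.curve 0).tendsto)
    rw [sub_self, sub_zero] at h2
    rw [← h2]
    calc ‖∫ s in Iic x, (deriv (Γ t) s - deriv (Γ 0) s)‖
        ≤ ∫ s in Iic x, C / (1 + s ^ 2) * |t| :=
          norm_integral_le_of_norm_le ((integrable_const_div_one_add_sq C).mul_const _).integrableOn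
            (Eventually.of_forall fun s => hd t s ht)
      _ = (∫ s in Iic x, C / (1 + s ^ 2)) * |t| := integral_mul_const _ _
      _ ≤ _ := by gcongr; exact setIntegral_const_div_one_add_sq_le hC x
  obtain ⟨K, hK⟩ : ∃ K : NNReal, LipschitzOnWith K (omega U a) (Metric.closedBall (0 : E) ‖a‖) := by
    have : ProperSpace E := FiniteDimensional.proper ℝ E
    exact ((contDiff_omega (U := U) a).contDiffOn (n := ∞)).exists_lipschitzOnWith (by simp)
      (convex_closedBall (0 : E) ‖a‖) (isCompact_closedBall (0 : E) ‖a‖)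
  have hmem : ∀ t x, Γ t x ∈ Metric.closedBall (0 : E) ‖a‖ := fun t x => by
    rw [mem_closedBall_zero_iff, norm_of_mem_adOrbit hinv ((hΓ.curve t).orbit.mem x)]
  refine ⟨K * (C * Real.pi) * C + ‖omega U a a‖ * C, by positivity, fun t x ht => ?_⟩
  have e : angVel U a (Γ t) x - angVel U a (Γ 0) x =
      (omega U a (Γ t x) - omega U a (Γ 0 x)) (deriv (Γ t) x) +
        omega U a (Γ 0 x) (deriv (Γ t) x - deriv (Γ 0) x) := by
    simp only [angVel, sub_apply, map_sub]; abel
  rw [e]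
  have h1 : ‖omega U a (Γ t x) - omega U a (Γ 0 x)‖ ≤ K * (C * Real.pi * |t|) := by
    have := hK.dist_le_mul _ (hmem t x) _ (hmem 0 x)
    rw [dist_eq_norm, dist_eq_norm] at this
    exact this.trans (by gcongr; exact hΓd t x ht)
  calc _ ≤ ‖omega U a (Γ t x) - omega U a (Γ 0 x)‖ * ‖deriv (Γ t) x‖ +
        ‖omega U a a‖ * ‖deriv (Γ t) x - deriv (Γ 0) x‖ :=
        (norm_add_le _ _).trans (add_le_add (ContinuousLinearMap.le_opNorm _ _)
          (norm_omega_le hinv ((hΓ.curve 0).orbit.mem x) _))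
    _ ≤ K * (C * Real.pi * |t|) * (C / (1 + x ^ 2)) + ‖omega U a a‖ * (C / (1 + x ^ 2) * |t|) := by
        gcongr
        · exact hx1 t x ht
        · exact hd t x ht
    _ = _ := by ring

omit hinv in
theorem IsVariation.contDiff_angVel {a : E} {γ β : ℝ → E} {Γ : ℝ → ℝ → E}
    (hΓ : IsVariation U a γ β Γ) : ContDiff ℝ ∞ fun q : ℝ × ℝ => angVel U a (Γ q.1) q.2 :=
  ((contDiff_omega a).comp hΓ.smooth).clm_apply (contDiff_deriv_snd hΓ.smooth)

omit hinv in
theorem IsVariation.continuous_angVel {a : E} {γ β : ℝ → E} {Γ : ℝ → ℝ → E}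
    (hΓ : IsVariation U a γ β Γ) (t : ℝ) : Continuous (angVel U a (Γ t)) :=
  hΓ.contDiff_angVel.continuous.comp (Continuous.prodMk_right t)

omit hinv in
theorem IsVariation.exists_hasDerivAt_angVel {a : E} {γ β : ℝ → E} {Γ : ℝ → ℝ → E}
    (hΓ : IsVariation U a γ β Γ) : ∃ θ : ℝ → E, Continuous θ ∧
      ∀ x, HasDerivAt (fun t => angVel U a (Γ t) x) (θ x) 0 :=
  ⟨fun x => deriv (fun t => angVel U a (Γ t) x) 0,
    (contDiff_deriv_fst hΓ.contDiff_angVel).continuous.comp (Continuous.prodMk_right (0 : ℝ)),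
    fun x => (hasDerivAt_fst_of_contDiff hΓ.contDiff_angVel 0 x).differentiableAt.hasDerivAt⟩

/-- The derivative of the frames along a variation, read in the frame of the initial curve, is
the antiderivative of the derivative of the angular velocity. -/
theorem IsVariation.hasDerivAt_frame {a : E} {γ β : ℝ → E} {Γ : ℝ → ℝ → E}
    (hΓ : IsVariation U a γ β Γ) {u : ℝ → ℝ → E} {g : ℝ → ℝ → U}
    (hg : ∀ t, IsFrame U a (Γ t) (u t) (g t)) :
    ∃ ψ : ℝ → E, Continuous ψ ∧ Integrable ψ ∧
      (∀ x, HasDerivAt (fun t => angVel U a (Γ t) x) (Ad U (g 0 x) (ψ x)) 0) ∧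
      ∀ x, HasDerivAt (fun t => (Ad U (g t x)⁻¹ : E →L[ℝ] E) * Ad U (g 0 x))
        (-adL U (∫ s in Iic x, ψ s)) 0 := by
  have := FiniteDimensional.complete ℝ E
  obtain ⟨C, hC, hlip⟩ := hΓ.exists_angVel_sub_le hinv
  obtain ⟨θ, hθc, hθd⟩ := hΓ.exists_hasDerivAt_angVel
  have hwc := hΓ.continuous_angVel
  have hFc : ∀ t, Continuous fun x => (Ad U (g t x) : E →L[ℝ] E) := fun t =>
    continuous_iff_continuousAt.2 fun x => ((hg t).hasDerivAt_Ad x).continuousAt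
  have hGc : ∀ t, Continuous fun x => (Ad U (g t x)⁻¹ : E →L[ℝ] E) := fun t =>
    continuous_iff_continuousAt.2 fun x => ((hg t).hasDerivAt_Ad_inv x).continuousAt
  obtain ⟨w, hw⟩ : ∃ w : ℝ → ℝ → E, ∀ t, w t = angVel U a (Γ t) := ⟨_, fun _ => rfl⟩
  simp only [← hw] at hlip hθd hwc ⊢
  set ψ : ℝ → E := fun x => Ad U (g 0 x)⁻¹ (θ x) with hψ
  have hψF : ∀ x, Ad U (g 0 x) (ψ x) = θ x := fun x => Ad_Ad_inv _ _
  have hψc : Continuous ψ := (hGc 0).clm_apply hθc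
  have hball : Metric.ball (0 : ℝ) 1 ∈ 𝓝 (0 : ℝ) := Metric.ball_mem_nhds _ one_pos
  have hψb : ∀ x, ‖ψ x‖ ≤ C / (1 + x ^ 2) := by
    intro x
    rw [hψ, norm_Ad hinv]
    refine (hθd x).le_of_lip' (by positivity) ?_
    filter_upwards [hball] with t ht
    rw [mem_ball_zero_iff, Real.norm_eq_abs] at ht
    simpa using hlip t x ht.le
  have hψi : Integrable ψ := Integrable.mono' (integrable_const_div_one_add_sq C)
    hψc.aestronglyMeasurable (Eventually.of_forall hψb)
  refine ⟨ψ, hψc, hψi, fun x => by rw [hψF]; exact hθd x, fun x => ?_⟩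
  -- `H t` is the frame of `Γ 0` read in the frame of `Γ t`, and `-K t` is its derivative
  set H : ℝ → ℝ → E →L[ℝ] E := fun t x => (Ad U (g t x)⁻¹ : E →L[ℝ] E) * Ad U (g 0 x) with hH
  set K : ℝ → ℝ → E →L[ℝ] E := fun t x =>
    (Ad U (g t x)⁻¹ : E →L[ℝ] E) * (adL U (w t x - w 0 x) * Ad U (g 0 x)) with hK
  have hKc : ∀ t, Continuous (K t) := fun t =>
    (hGc t).mul (((adL U).continuous.comp ((hwc t).sub (hwc 0))).mul (hFc 0))
  set A := ‖adL U (E := E)‖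
  have hKb : ∀ t x, |t| ≤ 1 → ‖K t x‖ ≤ A * C / (1 + x ^ 2) * |t| := by
    intro t x ht
    calc ‖K t x‖ ≤ 1 * (‖adL U (w t x - w 0 x)‖ * 1) :=
          (norm_mul_le _ _).trans (mul_le_mul (norm_Ad_le hinv _) ((norm_mul_le _ _).trans
            (mul_le_mul_of_nonneg_left (norm_Ad_le hinv _) (norm_nonneg _))) (norm_nonneg _)
            zero_le_one)
      _ ≤ A * (C / (1 + x ^ 2) * |t|) := by
          rw [one_mul, mul_one]
          exact ((adL U).le_opNorm _).trans (mul_le_mul_of_nonneg_left (hlip t x ht) (norm_nonneg _))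
      _ = _ := by ring
  have hHd : ∀ t x, HasDerivAt (H t) (-K t x) x := by
    intro t x
    have h1 := HasDerivAt.mul (𝔸 := E →L[ℝ] E) ((hg t).hasDerivAt_Ad_inv' hinv x) ((hg 0).hasDerivAt_Ad' hinv x)
    refine h1.congr_deriv ?_
    ext X
    simp [hK, ← hw, map_sub]
    abel
  have htop := topologicalGroup_of_lieGroup 𝓘(ℝ, E) ∞ (G := U)
  have hHl : ∀ t, Tendsto (H t) atBot (𝓝 1) := by
    intro t
    have hA : ∀ {k : ℝ → U}, Tendsto k atBot (𝓝 1) →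
        Tendsto (fun x => (Ad U (k x) : E →L[ℝ] E)) atBot (𝓝 1) := by
      intro k hk
      have h1 : (1 : E →L[ℝ] E) = Ad U (1 : U) := Ad_one.symm
      rw [h1]
      exact (continuous_Ad.tendsto 1).comp hk
    have h1 := hA (show Tendsto (fun x => (g t x)⁻¹) atBot (𝓝 1) by simpa using (hg t).tendsto.inv)
    simpa using h1.mul (hA (hg 0).tendsto)
  obtain ⟨hHc, hHdiff⟩ := hasDerivAt_of_antideriv_family
    (show 0 ≤ A * C from mul_nonneg (norm_nonneg (adL U (E := E))) hC) hHd hHl hKc hKb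
  have hGcont : ∀ x, ContinuousAt (fun t => (Ad U (g t x)⁻¹ : E →L[ℝ] E)) 0 := by
    intro x
    have h1 := (hHc x).mul_const (Ad U (g 0 x)⁻¹ : E →L[ℝ] E)
    rw [one_mul] at h1
    refine h1.congr (fun t => ?_)
    change (Ad U (g t x)⁻¹ : E →L[ℝ] E) * Ad U (g 0 x) * Ad U (g 0 x)⁻¹ = _
    rw [mul_assoc, Ad_mul_Ad_inv, mul_one]
  have hKd : ∀ x, HasDerivAt (fun t => K t x) (adL U (ψ x)) 0 := by
    intro x
    have h1 : HasDerivAt (fun t => adL U (w t x - w 0 x) * (Ad U (g 0 x) : E →L[ℝ] E))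
        (adL U (θ x) * Ad U (g 0 x)) 0 :=
      ((adL U).hasFDerivAt.comp_hasDerivAt 0 ((hθd x).sub_const (w 0 x))).mul_const _
    have h2 := hasDerivAt_mul_of_eq_zero (hGcont x) h1 (by simp)
    refine h2.congr_deriv ?_
    rw [← hψF]
    ext X
    simp [Ad_brk, Ad_inv_Ad]
  have h3 := hHdiff _ ((adL U).continuous.comp hψc) hKd x
  have e : ∫ s in Iic x, adL U (ψ s) = adL U (∫ s in Iic x, ψ s) :=
    (adL U).integral_comp_comm hψi.integrableOn
  rw [← e]
  exact h3

/-- The derivative of the development map: `dΦ(β) = P_u J_a⁻¹(g⁻¹ β g)`. -/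
theorem IsFrame.hasDevDeriv {a : E} {γ β u : ℝ → E} {g : ℝ → U} (h : IsFrame U a γ u g)
    (hβ : IsTangentField U γ β) :
    HasDevDeriv U a γ β (Pu U a u (JaInv U a fun x => Ad U (g x)⁻¹ (β x))) := by
  have := FiniteDimensional.complete ℝ E
  intro Γ hΓ
  have hex : ∀ t, ∃ (v : ℝ → E) (k : ℝ → U), IsFrame U a (Γ t) v k := fun t =>
    (hΓ.curve t).exists_frame hinv
  choose v k hk using hex
  have hdev : ∀ t, development U a (Γ t) = v t := fun t => (hk t).development_eq hinv
  have hk0 := hk 0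
  rw [hΓ.start] at hk0
  obtain ⟨hAd, rfl⟩ := h.unique hinv hk0
  have hAd' : ∀ x, (Ad U (g x)⁻¹ : E →L[ℝ] E) = Ad U (k 0 x)⁻¹ := by
    intro x
    have h1 := Ad_inv_mul_Ad (E := E) (g x)
    rw [hAd] at h1
    calc (Ad U (g x)⁻¹ : E →L[ℝ] E) = Ad U (g x)⁻¹ * (Ad U (k 0 x) * Ad U (k 0 x)⁻¹) := by
          rw [Ad_mul_Ad_inv, mul_one]
      _ = _ := by rw [← mul_assoc, h1, one_mul]
  simp only [hAd', hdev]
  have hred := hk0.isReduced hinv hβ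
  obtain ⟨ψ, hψc, hψi, hψd, hH⟩ := hΓ.hasDerivAt_frame hinv hk
  set q : ℝ → E := fun x => ∫ s in Iic x, ψ s
  have hq : ∀ x, HasDerivAt q (ψ x) x := fun x =>
    hasDerivAt_integral_Iic hψc (b := 0) hψi.integrableOn x
  have hql : Tendsto q atBot (𝓝 0) := tendsto_integral_Iic_atBot (b := 0) hψi.integrableOn
  -- differentiate a transported vector
  have htrans : ∀ {f : ℝ → E} {f' : E} {x : ℝ}, HasDerivAt f (Ad U (k 0 x) f') 0 →
      HasDerivAt (fun t => Ad U (k t x)⁻¹ (f t)) (f' - brk U (q x) (Ad U (k 0 x)⁻¹ (f 0))) 0 := by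
    intro f f' x hf
    have h1 := (hH x).clm_apply ((Ad U (k 0 x)⁻¹ : E →L[ℝ] E).hasFDerivAt.comp_hasDerivAt 0 hf)
    have e : (fun t => ((Ad U (k t x)⁻¹ : E →L[ℝ] E) * Ad U (k 0 x) : E →L[ℝ] E)
        ((⇑(Ad U (k 0 x)⁻¹) ∘ f) t)) = fun t => Ad U (k t x)⁻¹ (f t) := by
      ext t; simp [Ad_Ad_inv]
    rw [e] at h1
    refine h1.congr_deriv ?_
    simp only [Function.comp_apply, mul_apply_eq_comp, Ad_inv_Ad, neg_apply, adL_apply, q]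
    abel
  -- transport of the angular velocity of `Γ t` gives its development
  have hu : ∀ x, HasDerivAt (fun t => v t x) (ψ x - brk U (q x) (v 0 x)) 0 := by
    intro x
    have h1 := htrans (hψd x)
    simp only [← (hk _).pot_eq hinv] at h1
    exact h1
  -- transport of the curve `Γ t` itself gives the constant `a`
  have hqa : ∀ x, brk U (q x) a = Ad U (k 0 x)⁻¹ (β x) := by
    intro x
    have h1 := htrans (f := fun t => Γ t x) (f' := Ad U (k 0 x)⁻¹ (β x)) (x := x)
      (by rw [Ad_Ad_inv]; exact hΓ.velocity x)
    simp only [(hk _).lift x, Ad_inv_Ad] at h1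
    exact (sub_eq_zero.1 (h1.unique (hasDerivAt_const _ _))).symm
  have hq1 : (fun x => projOne U a (q x)) = JaInv U a fun x => Ad U (k 0 x)⁻¹ (β x) := by
    have h1 : (fun x => Ad U (k 0 x)⁻¹ (β x)) = Ja U a fun x => projOne U a (q x) := by
      ext x
      rw [Ja, ← hqa x]
      conv_lhs => rw [← projZero_add_projOne (U := U) a (q x), brk_add_left,
        mem_isotropy.1 (projZero_mem a (q x)), zero_add]
    rw [h1, JaInv_Ja hinv fun x => projOne_mem _ _]
  intro x
  -- `q` is an antiderivative of the derivative of the development, for `∂_x + [u, ·]`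
  have hP := Pu_projOne hinv (p := q) (w := fun x => ψ x - brk U (q x) (v 0 x)) hk0.pot hk0.mem
    (by rw [hq1]; exact (hred.JaInv hinv).tame) hql
    (fun x => HasDerivAt.mem_submodule (hu x) fun t => (hk t).mem x)
    (fun x => (hq x).congr_deriv (by rw [brk_antisymm (q x)]; abel))
  rw [← hq1, hP.2]
  exact hu x

theorem IsCurve.hasDevDeriv_unique {a : E} {γ β w w' : ℝ → E} (hγ : IsCurve U a γ)
    (hβ : IsTangentField U γ β) (h : HasDevDeriv U a γ β w) (h' : HasDevDeriv U a γ β w') : w = w' := by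
  obtain ⟨Γ, hΓ⟩ := hγ.exists_variation hinv hβ
  ext x
  exact (h Γ hΓ x).unique (h' Γ hΓ x)

end DerivativeOfDevelopment

/-! ### Ferapontov's operator and Dirac reduction in a frame -/

section GeometricFormula

variable {E : Type*} [NormedAddCommGroup E] [InnerProductSpace ℝ E] [FiniteDimensional ℝ E]
variable {U : Type*} [TopologicalSpace U] [ChartedSpace E U] [Group U] [LieGroup 𝓘(ℝ, E) ∞ U]

theorem norProj_eq_zero {p X : E} (h : X ∈ orbitTangent U p) : norProj U p X = 0 :=
  (Submodule.starProjection_apply_eq_zero_iff _).2 (by rwa [Submodule.orthogonal_orthogonal])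

theorem norProj_add (p X Y : E) : norProj U p (X + Y) = norProj U p X + norProj U p Y :=
  map_add _ _ _

theorem eq_sum_inner_smul_of_mem_span {F ι : Type*} [NormedAddCommGroup F] [InnerProductSpace ℝ F]
    [Fintype ι] {b : ι → F} (hb : Orthonormal ℝ b) {Y : F}
    (hY : Y ∈ Submodule.span ℝ (Set.range b)) : Y = ∑ i, ⟪b i, Y⟫_ℝ • b i := by
  obtain ⟨c, rfl⟩ := (Submodule.mem_span_range_iff_exists_fun ℝ).1 hY
  refine Finset.sum_congr rfl fun i _ => ?_
  rw [hb.inner_right_fintype]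

variable (hinv : ∀ (g : U) (X Y : E), ⟪Ad U g X, Ad U g Y⟫_ℝ = ⟪X, Y⟫_ℝ)

include hinv

theorem tanProj_Ad (g : U) (a X : E) : tanProj U (Ad U g a) (Ad U g X) = Ad U g (projOne U a X) := by
  refine tanProj_eq_of_sub_mem (Ad_mem_orbitTangent ?_) ?_
  · rw [← isotropy_orthogonal hinv]; exact projOne_mem _ _
  · rw [orbitTangent_orthogonal hinv, ← map_sub]
    refine Ad_mem_isotropy.2 ?_
    have e := projZero_add_projOne (U := U) a X
    rw [← eq_sub_iff_add_eq] at e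
    rw [← e]; exact projZero_mem _ _

theorem norProj_Ad (g : U) (a X : E) : norProj U (Ad U g a) (Ad U g X) = Ad U g (projZero U a X) := by
  have h1 := tanProj_add_norProj (U := U) (Ad U g a) (Ad U g X)
  rw [tanProj_Ad hinv, ← eq_sub_iff_add_eq', ← map_sub] at h1
  rw [h1, ← projZero_add_projOne (U := U) a X, add_sub_assoc]
  simp [projOne, projZero]

/-- The second fundamental form `II(ξ, γ_x)` read in the frame. -/
theorem IsFrame.secondFF_eq {a : E} {γ u : ℝ → E} {g : ℝ → U} (h : IsFrame U a γ u g) {x : ℝ} {ξ : E}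
    (hξ : ξ ∈ orbitTangent U (γ x)) :
    secondFF U (γ x) ξ (deriv γ x) = Ad U (g x) (projZero U a (brk U (u x) (Ad U (g x)⁻¹ ξ))) := by
  have hp := h.mem_adOrbit x
  set m := omega U a (γ x) ξ
  have hm : brk U m (γ x) = ξ := by rw [brk_omega hinv hp, tanProj_eq_self hξ]
  have hw : deriv γ x = brk U (Ad U (g x) (u x)) (γ x) := by
    rw [(h.hasDerivAt_curve x).deriv, Ad_brk, ← h.lift x]
  have hγ' : deriv γ x ∈ orbitTangent U (γ x) := by rw [hw]; exact ⟨_, rfl⟩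
  -- the second fundamental form is symmetric, by the Jacobi identity
  have e : brk U m (deriv γ x) = brk U (brk U m (Ad U (g x) (u x))) (γ x) +
      brk U (Ad U (g x) (u x)) ξ := by
    rw [hw, ← hm]
    exact brk_brk ..
  rw [AdjointCurves.secondFF_eq hinv hp hξ hγ', e, norProj_add, norProj_eq_zero (mem_orbitTangent.2 ⟨_, rfl⟩), zero_add]
  conv_lhs => rw [h.lift x, ← Ad_Ad_inv (g x) ξ, ← Ad_brk, norProj_Ad hinv]

/-- The shape operator `A_ν(γ_x)` read in the frame. -/
theorem IsFrame.shapeOp_eq {a : E} {γ u : ℝ → E} {g : ℝ → U} (h : IsFrame U a γ u g) {x : ℝ} {b : E}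
    (hb : b ∈ isotropy U a) :
    shapeOp U (γ x) (Ad U (g x) b) (deriv γ x) = -Ad U (g x) (brk U (u x) b) := by
  have hγ' : deriv γ x ∈ orbitTangent U (γ x) := by
    rw [(h.hasDerivAt_curve x).deriv, Ad_brk, ← h.lift x]; exact ⟨_, rfl⟩
  rw [AdjointCurves.shapeOp_eq hinv (h.mem_adOrbit x) ?_ hγ', ← angVel, h.angVel_eq hinv, Ad_brk]
  rw [orbitTangent_orthogonal hinv, h.lift x]
  exact Ad_mem_isotropy.2 hb

/-- The covariant derivative read in the frame: the local part of `P_u`. -/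
theorem IsFrame.covDeriv_eq {a : E} {γ u v : ℝ → E} {g : ℝ → U} (h : IsFrame U a γ u g)
    (hv : IsReduced U a v) (x : ℝ) : covDeriv U γ (fun x => Ad U (g x) (v x)) x =
      Ad U (g x) (deriv v x + projOne U a (brk U (u x) (v x))) := by
  rw [covDeriv, (h.hasDerivAt_Ad_apply (hv.hasDerivAt x)).deriv, h.lift x, tanProj_Ad hinv,
    projOne_add, projOne_eq_self (HasDerivAt.mem_submodule (hv.hasDerivAt x) hv.mem)]

/-- A normal field along `γ` whose derivative is tangential is constant in the frame. -/
theorem IsFrame.exists_eq_Ad_const {a : E} {γ u ν : ℝ → E} {g : ℝ → U} (h : IsFrame U a γ u g)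
    (hγ : IsOrbitCurve U a γ) (hν : Differentiable ℝ ν) (hn : ∀ x, ν x ∈ (orbitTangent U (γ x))ᗮ)
    (ht : ∀ x, deriv ν x ∈ orbitTangent U (γ x)) :
    ∃ b ∈ isotropy U a, ∀ x, ν x = Ad U (g x) b := by
  have hd : ∀ x, HasDerivAt (fun x => Ad U (g x)⁻¹ (ν x)) 0 x := by
    intro x
    have h1 := hγ.tanProj_deriv hinv hν hn x
    rw [tanProj_eq_self (ht x), ← angVel, h.angVel_eq hinv] at h1
    refine (h.hasDerivAt_Ad_inv_apply (hν x).hasDerivAt).congr_deriv ?_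
    rw [h1, Ad_brk, Ad_inv_Ad, sub_self]
  have hc : ∀ x, Ad U (g x)⁻¹ (ν x) = Ad U (g 0)⁻¹ (ν 0) := fun x =>
    is_const_of_deriv_eq_zero (fun x => (hd x).differentiableAt) (fun x => (hd x).deriv) x 0
  refine ⟨Ad U (g 0)⁻¹ (ν 0), ?_, fun x => by rw [← hc x, Ad_Ad_inv]⟩
  have h1 := hn 0
  rw [orbitTangent_orthogonal hinv, ← Ad_Ad_inv (g 0) (ν 0), h.lift 0] at h1
  exact Ad_mem_isotropy.1 h1

/-- A parallel orthonormal normal frame field is given, along a curve with frame `g`, by an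
orthonormal basis of `𝔲_a`. -/
theorem IsFrame.exists_basis_of_isParallelNormalFrame {a : E} {γ u : ℝ → E} {g : ℝ → U}
    (h : IsFrame U a γ u g) (hγ : IsOrbitCurve U a γ) {m : ℕ} {e : Fin m → E → E}
    (he : IsParallelNormalFrame U a e) : ∃ b : Fin m → E, Orthonormal ℝ b ∧
      Submodule.span ℝ (Set.range b) = isotropy U a ∧ ∀ i x, e i (γ x) = Ad U (g x) (b i) := by
  have h1 : ∀ i, ∃ b ∈ isotropy U a, ∀ x, e i (γ x) = Ad U (g x) b := fun i =>
    h.exists_eq_Ad_const hinv hγ (((he.parallel i).smooth γ hγ).differentiable (by simp))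
      (fun x => (he.parallel i).normal _ (hγ.mem x)) ((he.parallel i).parallel γ hγ)
  choose b hb hbe using h1
  have h2 := he.orthonormal _ (hγ.mem 0)
  have h3 := he.span _ (hγ.mem 0)
  simp only [hbe] at h2 h3
  refine ⟨b, ?_, le_antisymm (Submodule.span_le.2 (by rintro _ ⟨i, rfl⟩; exact hb i)) ?_, hbe⟩
  · rw [orthonormal_iff_ite] at h2 ⊢
    simpa only [hinv] using h2
  · intro X hX
    have h4 : Ad U (g 0) X ∈ (orbitTangent U (γ 0))ᗮ := by
      rw [orbitTangent_orthogonal hinv, h.lift 0]; exact Ad_mem_isotropy.2 hX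
    have h5 : (Set.range fun i => Ad U (g 0) (b i)) =
        (Ad U (g 0) : E →L[ℝ] E).toLinearMap '' Set.range b := by
      rw [← Set.range_comp]; rfl
    rw [← h3, h5, Submodule.span_image] at h4
    obtain ⟨Y, hY, hYX⟩ := h4
    have h6 : Y = X := by rw [← Ad_inv_Ad (g 0) X, ← hYX]; exact (Ad_inv_Ad _ _).symm
    rwa [← h6]

/-- The integrand of the nonlocal term of Ferapontov's operator, read in the frame. -/
theorem IsFrame.inner_secondFF {a : E} {γ u v : ℝ → E} {g : ℝ → U} (h : IsFrame U a γ u g)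
    (hv : IsReduced U a v) (b : E) (x : ℝ) :
    ⟪secondFF U (γ x) (Ad U (g x) (v x)) (deriv γ x), Ad U (g x) b⟫_ℝ =
      ⟪projZero U a (brk U (u x) (v x)), b⟫_ℝ := by
  rw [h.secondFF_eq hinv, hinv, Ad_inv_Ad]
  rw [h.lift x]
  refine Ad_mem_orbitTangent ?_
  rw [← isotropy_orthogonal hinv]; exact hv.mem x

omit hinv in
theorem rapid_inner_projZero {a : E} {u v : ℝ → E} (hu : Rapid u) (hv : Tame v) (b : E) :
    Rapid fun x => ⟪projZero U a (brk U (u x) (v x)), b⟫_ℝ :=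
  rapid_inner (rapid_projZero (U := U) a (rapid_brk (U := U) hu hv)) (tame_const b)

/-- Ferapontov's operator, in any parallel orthonormal normal frame field, is `P_u` read in the
frame. -/
theorem IsFrame.ferapontov_eq {a : E} {γ u v : ℝ → E} {g : ℝ → U} (h : IsFrame U a γ u g)
    (hγ : IsOrbitCurve U a γ) (hv : IsReduced U a v) {m : ℕ} {e : Fin m → E → E}
    (he : IsParallelNormalFrame U a e) (x : ℝ) :
    ferapontov U e γ (fun x => Ad U (g x) (v x)) x = Ad U (g x) (Pu U a u v x) := by
  have := FiniteDimensional.complete ℝ E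
  obtain ⟨b, hb, hspan, hbe⟩ := h.exists_basis_of_isParallelNormalFrame hinv hγ he
  have hbm : ∀ i, b i ∈ isotropy U a := fun i => hspan ▸ Submodule.subset_span ⟨i, rfl⟩
  have hi : Integrable fun s => projZero U a (brk U (u s) (v s)) :=
    (rapid_projZero (U := U) a (rapid_brk (U := U) h.pot hv.tame)).integrable
  have hint : ∀ i, ∫ s in Iic x, ⟪secondFF U (γ s) (Ad U (g s) (v s)) (deriv γ s), e i (γ s)⟫_ℝ =
      -⟪b i, nonlocal U a u v x⟫_ℝ := by
    intro i
    simp only [hbe, h.inner_secondFF hinv hv]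
    rw [nonlocal, inner_neg_right, neg_neg, ← integral_inner hi.integrableOn]
    simp only [real_inner_comm]
  simp only [ferapontov, hint]
  simp only [h.covDeriv_eq hinv hv, hbe, h.shapeOp_eq hinv (hbm _)]
  have hY := nonlocal_mem (U := U) (a := a) h.pot hv.tame x
  rw [← hspan] at hY
  have hsum : brk U (u x) (nonlocal U a u v x) =
      ∑ i, ⟪b i, nonlocal U a u v x⟫_ℝ • brk U (u x) (b i) := by
    conv_lhs => rw [eq_sum_inner_smul_of_mem_span hb hY, ← adL_apply, map_sum]
    simp
  rw [Pu_apply, hsum, map_add (Ad U (g x)) (deriv v x + _), map_sum]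
  simp

/-- The normal correction of the Dirac reduction is the nonlocal term of `P_u`, read in the frame. -/
theorem IsFrame.isDiracCorrection_iff {a : E} {γ u v : ℝ → E} {g : ℝ → U} (h : IsFrame U a γ u g)
    (hγ : IsCurve U a γ) (hv : IsReduced U a v) {η : ℝ → E} :
    IsDiracCorrection U γ (fun x => Ad U (g x) (v x)) η ↔
      η = fun x => Ad U (g x) (nonlocal U a u v x) := by
  have key : IsDiracCorrection U γ (fun x => Ad U (g x) (v x))
      fun x => Ad U (g x) (nonlocal U a u v x) := by
    refine ⟨(Tame.bilin (ContinuousLinearMap.id ℝ (E →L[ℝ] E)) (h.tame_Ad hinv hγ)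
      (tame_nonlocal h.pot hv.tame)).smooth, fun x => ?_, ?_, fun x => ?_⟩
    · rw [orbitTangent_orthogonal hinv, h.lift x]
      exact Ad_mem_isotropy.2 (nonlocal_mem h.pot hv.tame x)
    · rw [tendsto_zero_iff_norm_tendsto_zero]
      simp only [norm_Ad hinv]
      exact tendsto_zero_iff_norm_tendsto_zero.1 (tendsto_nonlocal h.pot hv.tame)
    · simp only [← map_add]
      rw [(h.hasDerivAt_add_nonlocal hv x).deriv, h.lift x]
      refine Ad_mem_orbitTangent ?_
      rw [← isotropy_orthogonal hinv]
      exact Pu_mem hinv h.pot h.mem hv x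
  refine ⟨fun hη => ?_, fun e => e ▸ key⟩
  set η₀ : ℝ → E := fun x => Ad U (g x) (nonlocal U a u v x)
  have hd : ∀ {η : ℝ → E}, IsDiracCorrection U γ (fun x => Ad U (g x) (v x)) η → ∀ x,
      HasDerivAt η (deriv η x) x := fun hη x =>
    (hη.smooth.differentiable (by simp) x).hasDerivAt
  have hFv : ∀ x, HasDerivAt (fun x => Ad U (g x) (v x)) (deriv (fun x => Ad U (g x) (v x)) x) x :=
    fun x => (h.hasDerivAt_Ad_apply (hv.hasDerivAt x)).differentiableAt.hasDerivAt
  -- the difference of two corrections is normal with tangential derivative, so it has constant norm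
  obtain ⟨b, hb, hbe⟩ := h.exists_eq_Ad_const hinv hγ.orbit (ν := fun x => η x - η₀ x)
    (fun x => ((hd hη x).fun_sub (hd key x)).differentiableAt)
    (fun x => sub_mem (hη.normal x) (key.normal x)) (fun x => by
      have h1 := hη.tangent x
      have h2 := key.tangent x
      rw [((hFv x).fun_add (hd hη x)).deriv] at h1
      rw [((hFv x).fun_add (hd key x)).deriv] at h2
      rw [((hd hη x).fun_sub (hd key x)).deriv]
      simpa using sub_mem h1 h2)
  have h0 : ‖b‖ = 0 := by
    have h1 := (hη.tendsto.sub key.tendsto).norm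
    simp only [hbe, norm_Ad hinv, sub_zero, norm_zero] at h1
    exact tendsto_nhds_unique tendsto_const_nhds h1
  ext x
  have h1 := hbe x
  rw [norm_eq_zero.1 h0, map_zero] at h1
  exact sub_eq_zero.1 h1

end GeometricFormula

/-! ### Turning back a curve -/

section Cutoff

variable {F : Type*} [NormedAddCommGroup F] [NormedSpace ℝ F]

theorem WeightBdd.piecewise {k : ℕ} {f f₁ f₂ : ℝ → F} {x₀ x₁ : ℝ} (hf : Continuous f)
    (h₁ : WeightBdd k f₁) (h₂ : WeightBdd k f₂) (e₁ : ∀ x < x₀, f x = f₁ x)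
    (e₂ : ∀ x > x₁, f x = f₂ x) : WeightBdd k f := by
  obtain ⟨C₁, hC₁⟩ := h₁
  obtain ⟨C₂, hC₂⟩ := h₂
  obtain ⟨C, hC⟩ := (isCompact_Icc (a := x₀) (b := x₁)).exists_bound_of_continuousOn
    (f := fun x => (1 + |x|) ^ k * ‖f x‖) (by fun_prop)
  refine ⟨max C (max C₁ C₂), fun x => ?_⟩
  rcases lt_or_ge x x₀ with hx | hx
  · rw [e₁ x hx]
    exact (hC₁ x).trans ((le_max_left _ _).trans (le_max_right _ _))
  rcases lt_or_ge x₁ x with hx' | hx'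
  · rw [e₂ x hx']
    exact (hC₂ x).trans ((le_max_right _ _).trans (le_max_right _ _))
  · exact (le_abs_self _).trans ((hC x ⟨hx, hx'⟩).trans (le_max_left _ _))

/-- A smooth function that agrees with rapidly decreasing functions near `-∞` and near `+∞` is rapidly
decreasing. -/
theorem Rapid.piecewise {f f₁ f₂ : ℝ → F} {x₀ x₁ : ℝ} (hf : ContDiff ℝ ∞ f)
    (h₁ : Rapid f₁) (h₂ : Rapid f₂) (e₁ : ∀ x < x₀, f x = f₁ x)
    (e₂ : ∀ x > x₁, f x = f₂ x) : Rapid f := by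
  refine fun k => ⟨hf, fun n => ?_⟩
  induction n generalizing f f₁ f₂ with
  | zero => exact WeightBdd.piecewise hf.continuous (h₁.weightBdd k) (h₂.weightBdd k) e₁ e₂
  | succ n ih =>
    refine ⟨WeightBdd.piecewise hf.continuous (h₁.weightBdd k) (h₂.weightBdd k) e₁ e₂,
      ih (contDiff_infty_iff_deriv.1 hf).2 h₁.deriv h₂.deriv (fun x hx => ?_) fun x hx => ?_⟩
    · exact Filter.EventuallyEq.deriv_eq (eventually_of_mem (Iio_mem_nhds hx) e₁)
    · exact Filter.EventuallyEq.deriv_eq (eventually_of_mem (Ioi_mem_nhds hx) e₂)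

theorem Rapid.comp_neg {f : ℝ → F} (h : Rapid f) : Rapid fun x => f (-x) := by
  refine fun k => ⟨h.smooth.comp contDiff_neg, fun n => ?_⟩
  have hb : ∀ f : ℝ → F, Rapid f → WeightBdd k fun x => f (-x) := fun f hf => by
    obtain ⟨C, hC⟩ := hf.weightBdd k
    exact ⟨C, fun x => by simpa using hC (-x)⟩
  induction n generalizing f with
  | zero => exact hb f h
  | succ n ih =>
    refine ⟨hb f h, ?_⟩
    have e : _root_.deriv (fun x => f (-x)) =
        fun x => (-ContinuousLinearMap.id ℝ F) (_root_.deriv f (-x)) := by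
      ext x; rw [deriv_comp_neg]; rfl
    rw [e]
    exact ih (h.deriv.clm (-ContinuousLinearMap.id ℝ F))

/-- A smooth reparametrization of the line that is the identity on `(-∞, x₀]` and `x ↦ -x` on
`[x₀ + 1, ∞)`. -/
def turnBack (x₀ x : ℝ) : ℝ := x * (1 - 2 * Real.smoothTransition (x - x₀))

theorem contDiff_turnBack (x₀ : ℝ) : ContDiff ℝ ∞ (turnBack x₀) :=
  contDiff_id.mul (contDiff_const.sub (contDiff_const.mul
    (Real.smoothTransition.contDiff.comp (contDiff_id.sub contDiff_const))))

theorem turnBack_of_le {x₀ x : ℝ} (h : x ≤ x₀) : turnBack x₀ x = x := by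
  simp [turnBack, Real.smoothTransition.zero_of_nonpos (sub_nonpos.2 h)]

theorem turnBack_of_ge {x₀ x : ℝ} (h : x₀ + 1 ≤ x) : turnBack x₀ x = -x := by
  rw [turnBack, Real.smoothTransition.one_of_one_le (by linarith)]; ring

theorem hasDerivAt_turnBack (x₀ x : ℝ) : HasDerivAt (turnBack x₀) (deriv (turnBack x₀) x) x :=
  ((contDiff_turnBack x₀).differentiable (by simp) x).hasDerivAt

theorem turnBack_eventually_nhds_left {x₀ x : ℝ} (h : x < x₀) : turnBack x₀ =ᶠ[𝓝 x] id :=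
  eventually_of_mem (Iio_mem_nhds h) fun _ hy => turnBack_of_le (le_of_lt hy)

theorem turnBack_eventually_nhds_right {x₀ x : ℝ} (h : x₀ + 1 < x) :
    turnBack x₀ =ᶠ[𝓝 x] fun y => -y :=
  eventually_of_mem (Ioi_mem_nhds h) fun _ hy => turnBack_of_ge (le_of_lt hy)

theorem deriv_turnBack_left {x₀ x : ℝ} (h : x < x₀) : deriv (turnBack x₀) x = 1 := by
  rw [(turnBack_eventually_nhds_left h).deriv_eq]; simp

theorem deriv_turnBack_right {x₀ x : ℝ} (h : x₀ + 1 < x) : deriv (turnBack x₀) x = -1 := by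
  rw [(turnBack_eventually_nhds_right h).deriv_eq]; simp

theorem deriv_turnBack_of_le {x₀ x : ℝ} (h : x ≤ x₀) : deriv (turnBack x₀) x = 1 := by
  have hc : Continuous (deriv (turnBack x₀)) := (contDiff_turnBack x₀).continuous_deriv (by simp)
  have h1 : closure (Iio x₀) ⊆ {y | deriv (turnBack x₀) y = 1} :=
    closure_minimal (fun y hy => deriv_turnBack_left hy) (isClosed_eq hc continuous_const)
  rw [closure_Iio] at h1
  exact h1 h

/-- The curve `f`, run through up to a time after `x₀` and then backwards: both ends look like `f` near
`-∞`. -/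
theorem tendsto_comp_turnBack {f : ℝ → F} {l : F} (x₀ : ℝ) (hf : Tendsto f atBot (𝓝 l)) :
    Tendsto (fun x => f (turnBack x₀ x)) atBot (𝓝 l) ∧
      Tendsto (fun x => f (turnBack x₀ x)) atTop (𝓝 l) := by
  constructor
  · refine hf.congr' ((eventually_le_atBot x₀).mono fun x hx => ?_)
    simp only [turnBack_of_le hx]
  · refine (hf.comp tendsto_neg_atTop_atBot).congr' ((eventually_ge_atTop (x₀ + 1)).mono fun x hx => ?_)
    simp only [turnBack_of_ge hx]; rfl

theorem hasDerivAt_comp_turnBack {f : ℝ → F} (hf : Differentiable ℝ f) (x₀ x : ℝ) :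
    HasDerivAt (fun x => f (turnBack x₀ x))
      (deriv (turnBack x₀) x • deriv f (turnBack x₀ x)) x :=
  (hf _).hasDerivAt.scomp x (hasDerivAt_turnBack x₀ x)

theorem rapid_deriv_comp_turnBack {f : ℝ → F} (hf : ContDiff ℝ ∞ f) (hd : Rapid (deriv f)) (x₀ : ℝ) :
    Rapid (deriv fun x => f (turnBack x₀ x)) := by
  refine Rapid.piecewise (contDiff_infty_iff_deriv.1 (hf.comp (contDiff_turnBack x₀))).2 hd
    (hd.comp_neg.clm (-ContinuousLinearMap.id ℝ F)) (x₀ := x₀) (x₁ := x₀ + 1) (fun x hx => ?_)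
    fun x hx => ?_
  all_goals rw [(hasDerivAt_comp_turnBack (hf.differentiable (by simp)) x₀ x).deriv]
  · rw [deriv_turnBack_left hx, turnBack_of_le hx.le, one_smul]
  · rw [deriv_turnBack_right hx, turnBack_of_ge hx.le]; simp

/-- The vector field that corresponds to `ξ` under the reparametrization `turnBack`: tangent fields of
the curve space become rapidly decreasing. -/
theorem rapid_turnBack_smul [CompleteSpace F] {ξ : ℝ → F} (hξ : ContDiff ℝ ∞ ξ) (hd : Rapid (deriv ξ))
    (hl : Tendsto ξ atBot (𝓝 0)) (x₀ : ℝ) :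
    Rapid fun x => deriv (turnBack x₀) x • ξ (turnBack x₀ x) := by
  have hs : ContDiff ℝ ∞ fun x => deriv (turnBack x₀) x • ξ (turnBack x₀ x) :=
    (contDiff_infty_iff_deriv.1 (contDiff_turnBack x₀)).2.smul (hξ.comp (contDiff_turnBack x₀))
  have e₁ : ∀ x < x₀, deriv (turnBack x₀) x • ξ (turnBack x₀ x) = ξ x := fun x hx => by
    rw [deriv_turnBack_left hx, turnBack_of_le hx.le, one_smul]
  have e₂ : ∀ x > x₀ + 1, deriv (turnBack x₀) x • ξ (turnBack x₀ x) = -ξ (-x) := fun x hx => by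
    rw [deriv_turnBack_right hx, turnBack_of_ge hx.le, neg_one_smul]
  refine Rapid.of_deriv (hs.differentiable (by simp)) ?_ ?_ ?_
  · refine Rapid.piecewise (contDiff_infty_iff_deriv.1 hs).2 hd hd.comp_neg (x₀ := x₀)
      (x₁ := x₀ + 1) (fun x hx => ?_) fun x hx => ?_
    · exact Filter.EventuallyEq.deriv_eq (eventually_of_mem (Iio_mem_nhds hx) e₁)
    · rw [Filter.EventuallyEq.deriv_eq (eventually_of_mem (Ioi_mem_nhds hx) e₂)]
      rw [deriv.fun_neg, deriv_comp_neg, neg_neg]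
  · refine hl.congr' ((eventually_lt_atBot x₀).mono fun x hx => (e₁ x hx).symm)
  · have h1 := (hl.comp tendsto_neg_atTop_atBot).neg
    rw [neg_zero] at h1
    exact h1.congr' ((eventually_gt_atTop (x₀ + 1)).mono fun x hx => (e₂ x hx).symm)

/-- An antiderivative of the reparametrized function vanishes at `+∞`, since the reparametrized line
comes back to `-∞`. -/
theorem tendsto_atTop_of_hasDerivAt_turnBack [CompleteSpace F] {f Q : ℝ → F} (hf : Continuous f)
    {x₀ : ℝ}
    (hQ : ∀ x, HasDerivAt Q (deriv (turnBack x₀) x • f (turnBack x₀ x)) x)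
    (hl : Tendsto Q atBot (𝓝 0)) : Tendsto Q atTop (𝓝 0) := by
  set K : ℝ → F := fun y => ∫ s in (0 : ℝ)..y, f s
  have hK : ∀ y, HasDerivAt K (f y) y := fun y =>
    intervalIntegral.integral_hasDerivAt_right (hf.intervalIntegrable _ _)
      (hf.stronglyMeasurableAtFilter _ _) hf.continuousAt
  have hd : ∀ x, HasDerivAt (fun x => Q x - K (turnBack x₀ x)) 0 x := fun x => by
    simpa using (hQ x).fun_sub ((hK _).scomp x (hasDerivAt_turnBack x₀ x))
  have hc : ∀ x, Q x - K (turnBack x₀ x) = Q 0 - K (turnBack x₀ 0) := fun x =>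
    is_const_of_deriv_eq_zero (fun x => (hd x).differentiableAt) (fun x => (hd x).deriv) x 0
  set c := Q 0 - K (turnBack x₀ 0)
  have hKl : Tendsto K atBot (𝓝 (0 - c)) := by
    refine (hl.sub_const c).congr' ((eventually_le_atBot x₀).mono fun x hx => ?_)
    have := hc x
    rw [turnBack_of_le hx] at this
    rw [← this]; abel
  have h1 := (tendsto_comp_turnBack x₀ hKl).2.add_const c
  rw [sub_add_cancel] at h1
  refine h1.congr fun x => ?_
  rw [← hc x]; abel

end Cutoff

/-! ### The pulled-back operator -/

section PulledBackOperator

variable {E : Type*} [NormedAddCommGroup E] [InnerProductSpace ℝ E] [FiniteDimensional ℝ E]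
variable {U : Type*} [TopologicalSpace U] [ChartedSpace E U] [Group U] [LieGroup 𝓘(ℝ, E) ∞ U]

/-- A continuous function that is orthogonal to all its products with bump functions vanishes. -/
theorem eq_zero_of_forall_integral_inner_smul {D : ℝ → E} (hD : Continuous D)
    (h : ∀ φ : ℝ → ℝ, ContDiff ℝ ∞ φ → HasCompactSupport φ → ∫ x, ⟪D x, φ x • D x⟫_ℝ = 0) (x₀ : ℝ) :
    D x₀ = 0 := by
  by_contra hne
  set φ : ContDiffBump x₀ := ⟨1, 2, one_pos, one_lt_two⟩
  have h1 : ∀ x, ⟪D x, φ x • D x⟫_ℝ = φ x * ⟪D x, D x⟫_ℝ := fun x => real_inner_smul_right _ _ _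
  have h2 : 0 < ∫ x, φ x * ⟪D x, D x⟫_ℝ := by
    refine Continuous.integral_pos_of_hasCompactSupport_nonneg_nonzero (x := x₀)
      (φ.continuous.mul (hD.inner hD)) φ.hasCompactSupport.mul_right
      (fun x => mul_nonneg φ.nonneg real_inner_self_nonneg) ?_
    rw [φ.one_of_mem_closedBall (by simp [φ]), one_mul]
    exact inner_self_ne_zero.2 hne
  have h3 := h φ φ.contDiff φ.hasCompactSupport
  simp only [h1] at h3
  exact h2.ne' h3

theorem rapid_smul_of_hasCompactSupport {D : ℝ → E} (hD : Tame D) {φ : ℝ → ℝ} (hφ : ContDiff ℝ ∞ φ)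
    (hc : HasCompactSupport φ) : Rapid fun x => φ x • D x := by
  have h1 : Rapid φ := rapid_iff.2 ⟨hc.toSchwartzMap hφ, fun x => rfl⟩
  exact Rapid.bilin (ContinuousLinearMap.lsmul ℝ ℝ) h1 hD

/-- The derivative at the endpoint of a half-line is determined on the half-line. -/
theorem deriv_eq_of_eqOn_Iic {F : Type*} [NormedAddCommGroup F] [NormedSpace ℝ F] {f f' : ℝ → F}
    {x : ℝ} (hf : DifferentiableAt ℝ f x) (hf' : DifferentiableAt ℝ f' x)
    (h : ∀ s ≤ x, f s = f' s) : deriv f x = deriv f' x := by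
  have hu : UniqueDiffWithinAt ℝ (Iic x) x := uniqueDiffOn_Iic x x self_mem_Iic
  rw [← hf.derivWithin hu, ← hf'.derivWithin hu]
  exact derivWithin_congr h (h x le_rfl)

/-- Ferapontov's operator at `x` depends on the curve and on the field up to `x` only. -/
theorem ferapontov_congr {γ ξ γ' ξ' : ℝ → E} {m : ℕ} (e : Fin m → E → E) {x : ℝ}
    (hγ : Differentiable ℝ γ) (hγ' : Differentiable ℝ γ') (hξ : Differentiable ℝ ξ)
    (hξ' : Differentiable ℝ ξ') (h : ∀ s ≤ x, γ s = γ' s ∧ ξ s = ξ' s) :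
    ferapontov U e γ ξ x = ferapontov U e γ' ξ' x := by
  have hd : ∀ s ≤ x, deriv γ s = deriv γ' s := fun s hs =>
    deriv_eq_of_eqOn_Iic (hγ s) (hγ' s) fun r hr => (h r (hr.trans hs)).1
  have hd' : deriv ξ x = deriv ξ' x := deriv_eq_of_eqOn_Iic (hξ x) (hξ' x) fun r hr => (h r hr).2
  have hint : ∀ i, ∫ s in Iic x, ⟪secondFF U (γ s) (ξ s) (deriv γ s), e i (γ s)⟫_ℝ =
      ∫ s in Iic x, ⟪secondFF U (γ' s) (ξ' s) (deriv γ' s), e i (γ' s)⟫_ℝ := fun i =>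
    setIntegral_congr_fun measurableSet_Iic fun s hs => by
      simp only [hd s hs, (h s hs).1, (h s hs).2]
  simp only [ferapontov, covDeriv, hint, hd x le_rfl, hd', (h x le_rfl).1]

variable (hinv : ∀ (g : U) (X Y : E), ⟪Ad U g X, Ad U g Y⟫_ℝ = ⟪X, Y⟫_ℝ)

include hinv

/-- `J_a` is skew-adjoint, pointwise. -/
theorem inner_Ja (a : E) (v m : ℝ → E) (x : ℝ) : ⟪v x, Ja U a m x⟫_ℝ = -⟪Ja U a v x, m x⟫_ℝ := by
  have h1 := inner_brk hinv a (v x) (m x)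
  rw [Ja, Ja, brk_antisymm (m x), brk_antisymm (v x), inner_neg_right, inner_neg_left, neg_neg, h1]

/-- `(J_3)_u w` when `P_u w = J_a v`. -/
theorem Jk_three {a : E} {u w v : ℝ → E} (hw : ∀ x, w x ∈ (isotropy U a)ᗮ)
    (hv : ∀ x, v x ∈ (isotropy U a)ᗮ) (h : Pu U a u w = Ja U a v) :
    Jk U 3 a u w = Pu U a u (JaInv U a (Pu U a u v)) := by
  simp only [Jk, Function.iterate_succ, Function.iterate_zero, Function.comp_apply, id_eq]
  rw [JaInv_Ja hinv hw, h, JaInv_Ja hinv hv]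

theorem inner_Ad_right (g : U) (X Y : E) : ⟪X, Ad U g Y⟫_ℝ = ⟪Ad U g⁻¹ X, Y⟫_ℝ := by
  conv_lhs => rw [← Ad_Ad_inv g X, hinv]

/-- The pulled-back operator is `P_u`, read in the frame. -/
theorem IsFrame.eq_of_isPullbackPair {a : E} {γ u ξ ζ : ℝ → E} {g : ℝ → U} (h : IsFrame U a γ u g)
    (hγ : IsCurve U a γ) (hp : IsPullbackPair U 3 a γ ξ ζ) :
    ζ = fun x => Ad U (g x) (Pu U a u (fun x => Ad U (g x)⁻¹ (ξ x)) x) := by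
  obtain ⟨hξ, hζ, β, w, hβ, hrel, hw, hskew, hζd⟩ := hp
  rw [h.development_eq hinv] at hskew hζd
  set v : ℝ → E := fun x => Ad U (g x)⁻¹ (ξ x) with hvdef
  have hv : IsReduced U a v := h.isReduced hinv hξ
  have hwe := hγ.hasDevDeriv_unique hinv hβ hw (h.hasDevDeriv hinv hβ)
  have hwr : IsReduced U a w := by
    rw [hwe]; exact isReduced_Pu hinv h.pot h.mem ((h.isReduced hinv hβ).JaInv hinv)
  have hPw := isReduced_Pu hinv h.pot h.mem hwr
  -- testing the metric relation against all `m` in the Schwartz space gives `P_u w = [v, a]`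
  have htest : ∀ m, Rapid m → (∀ x, m x ∈ (isotropy U a)ᗮ) →
      ∫ x, ⟪Pu U a u w x - Ja U a v x, m x⟫_ℝ = 0 := by
    intro m hm hma
    have hmr := isReduced_of_rapid hm hma
    have hη := h.isTangentField hinv hγ (hmr.Ja hinv)
    have hy := h.hasDevDeriv hinv hη
    simp only [Ad_inv_Ad] at hy
    rw [show (fun x => Ja U a m x) = Ja U a m from rfl, JaInv_Ja hinv hma] at hy
    have h1 := (hrel w _ _ hw hη hy).2.2
    simp only [inner_Ad_right hinv] at h1
    have h2 := hskew m ⟨rapidDecay_iff.2 hm, hma⟩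
    rw [h1] at h2
    change _ = -∫ x, ⟪v x, Ja U a m x⟫_ℝ at h2
    simp only [inner_Ja hinv] at h2
    rw [integral_neg, neg_neg] at h2
    simp only [inner_sub_left]
    rw [integral_sub, h2, sub_self]
    · exact (rapid_inner (rapid_Pu h.pot hwr) hmr.tame).integrable
    · simpa only [real_inner_comm] using (rapid_inner hm (hv.Ja hinv).tame).integrable
  have hPJ : Pu U a u w = Ja U a v := by
    have hD : Tame fun x => Pu U a u w x - Ja U a v x := by
      have := hPw.tame.add ((hv.Ja hinv).tame.clm (-ContinuousLinearMap.id ℝ E))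
      simpa [sub_eq_add_neg] using this
    ext x
    refine sub_eq_zero.1 (eq_zero_of_forall_integral_inner_smul hD.smooth.continuous
      (fun φ hφ hc => htest _ (rapid_smul_of_hasCompactSupport hD hφ hc) fun x => ?_) x)
    exact Submodule.smul_mem _ _ (sub_mem (hPw.mem x) ((hv.Ja hinv).mem x))
  rw [Jk_three hinv hwr.mem hv.mem hPJ] at hζd
  have hζr := h.isReduced hinv hζ
  have hPv := isReduced_Pu hinv h.pot h.mem hv
  -- both sides are `P_u` of reduced fields: `dΦ ζ = P_u J_a⁻¹ (g⁻¹ ζ g)` and `(J_3)_u w = P_u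
  -- J_a⁻¹ P_u v`
  have h1 := h.Pu_injective hinv (hζr.JaInv hinv) (hPv.JaInv hinv)
    (hγ.hasDevDeriv_unique hinv hζ (h.hasDevDeriv hinv hζ) hζd)
  have h2 := congrArg (Ja U a) h1
  rw [Ja_JaInv hinv hζr.mem, Ja_JaInv hinv hPv.mem] at h2
  ext x
  rw [← h2, Ad_Ad_inv]

/-- Every rapidly decreasing tangent field `ξ` for which `[ξ, γ]` has a rapidly decreasing
antiderivative lies in the domain of the pulled-back operator. -/
theorem IsFrame.isPullbackPair {a : E} {γ u ξ Q : ℝ → E} {g : ℝ → U} (h : IsFrame U a γ u g)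
    (hγ : IsCurve U a γ) (hξ : IsTangentField U γ ξ) (hξr : Rapid ξ) (hQ : Rapid Q)
    (hQd : ∀ x, HasDerivAt Q (brk U (ξ x) (γ x)) x) :
    IsPullbackPair U 3 a γ ξ
      fun x => Ad U (g x) (Pu U a u (fun x => Ad U (g x)⁻¹ (ξ x)) x) := by
  have := FiniteDimensional.complete ℝ E
  set v : ℝ → E := fun x => Ad U (g x)⁻¹ (ξ x) with hvdef
  have hv : IsReduced U a v := h.isReduced hinv hξ
  -- `w = P_u⁻¹ J_a v`
  have hq : Rapid fun x => Ad U (g x)⁻¹ (Q x) :=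
    Rapid.bilin' (ContinuousLinearMap.id ℝ (E →L[ℝ] E)) (h.tame_Ad_inv hinv) hQ
  have hqd : ∀ x, HasDerivAt (fun x => Ad U (g x)⁻¹ (Q x))
      (Ja U a v x - brk U (u x) (Ad U (g x)⁻¹ (Q x))) x := fun x => by
    refine (h.hasDerivAt_Ad_inv_apply (hQd x)).congr_deriv ?_
    rw [Ad_brk, h.lift x, Ad_inv_Ad]; rfl
  set w : ℝ → E := fun x => projOne U a (Ad U (g x)⁻¹ (Q x)) with hwdef
  have hwr : Rapid w := rapid_projOne a hq
  have hw : IsReduced U a w := isReduced_of_rapid hwr fun x => projOne_mem _ _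
  obtain ⟨hnl, hPw⟩ := Pu_projOne hinv h.pot h.mem hwr.tame hq.tendsto_atBot (hv.Ja hinv).mem hqd
  have htop : Tendsto (nonlocal U a u w) atTop (𝓝 0) := by
    rw [hnl]; exact (rapid_projZero (U := U) a hq).tendsto_atTop
  have hskew : ∀ m, IsReduced U a m →
      ∫ x, ⟪Pu U a u w x, m x⟫_ℝ = -∫ x, ⟪w x, Pu U a u m x⟫_ℝ := fun m hm =>
    h.Pu_skew hinv hw hm hwr.tendsto_atTop htop
  -- `b = P_u⁻¹ w`
  have hFw : Rapid fun x => Ad U (g x) (w x) :=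
    Rapid.bilin' (ContinuousLinearMap.id ℝ (E →L[ℝ] E)) (h.tame_Ad hinv hγ) hwr
  have hId : ∀ x, HasDerivAt (fun x => ∫ s in Iic x, Ad U (g s) (w s)) (Ad U (g x) (w x)) x := fun x =>
    hasDerivAt_integral_Iic hFw.smooth.continuous (b := 0) hFw.integrable.integrableOn x
  have hIl : Tendsto (fun x => ∫ s in Iic x, Ad U (g s) (w s)) atBot (𝓝 0) :=
    tendsto_integral_Iic_atBot (b := 0) hFw.integrable.integrableOn
  have hIt : Tame fun x => ∫ s in Iic x, Ad U (g s) (w s) :=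
    Rapid.tame_of_deriv (fun x => (hId x).differentiableAt)
      (by rw [show deriv (fun x => ∫ s in Iic x, Ad U (g s) (w s)) = fun x => Ad U (g x) (w x) from
            funext fun x => (hId x).deriv]; exact hFw) hIl
  set p : ℝ → E := fun x => Ad U (g x)⁻¹ (∫ s in Iic x, Ad U (g s) (w s)) with hpdef
  have hpt : Tame p := Tame.bilin (ContinuousLinearMap.id ℝ (E →L[ℝ] E)) (h.tame_Ad_inv hinv) hIt
  have hpd : ∀ x, HasDerivAt p (w x - brk U (u x) (p x)) x := fun x => by
    refine (h.hasDerivAt_Ad_inv_apply (hId x)).congr_deriv ?_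
    rw [Ad_inv_Ad]
  have hpl : Tendsto p atBot (𝓝 0) := by
    rw [tendsto_zero_iff_norm_tendsto_zero] at hIl ⊢
    simpa only [hpdef, norm_Ad hinv] using hIl
  have hL1 : Tendsto (fun x => projOne U a (p x)) atBot (𝓝 0) := by
    simpa [projOne, Function.comp_def] using ((isotropy U a)ᗮ.starProjection.continuous.tendsto 0).comp hpl
  have hb : IsReduced U a fun x => projOne U a (p x) := by
    refine isReduced_of_hasDerivAt (v' := fun x => projOne U a (w x - brk U (u x) (p x)))
      (fun x => (isotropy U a)ᗮ.starProjection.hasFDerivAt.comp_hasDerivAt x (hpd x))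
      (rapid_projOne a ?_) (fun x => projOne_mem _ _) hL1
    simpa [sub_eq_add_neg] using
      hwr.add ((rapid_brk (U := U) h.pot hpt).clm (-ContinuousLinearMap.id ℝ E))
  have hPb := (Pu_projOne hinv h.pot h.mem hb.tame hpl hw.mem hpd).2
  have hβ := h.isTangentField hinv hγ (hb.Ja hinv)
  have hβd := h.hasDevDeriv hinv hβ
  simp only [Ad_inv_Ad] at hβd
  rw [show (fun x => Ja U a (fun x => projOne U a (p x)) x) = Ja U a (fun x => projOne U a (p x)) from
    rfl, JaInv_Ja hinv hb.mem, hPb] at hβd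
  have hPv := isReduced_Pu hinv h.pot h.mem hv
  have hζ := h.isTangentField hinv hγ hPv
  refine ⟨hξ, hζ, _, w, hβ, ?_, hβd, ?_, ?_⟩
  · intro w' η y hw' hη hy
    rw [hγ.hasDevDeriv_unique hinv hβ hw' hβd,
      hγ.hasDevDeriv_unique hinv hη hy (h.hasDevDeriv hinv hη)]
    have hm := (h.isReduced hinv hη).JaInv hinv
    have hJm := Ja_JaInv hinv (h.isReduced hinv hη).mem
    set m := JaInv U a fun x => Ad U (g x)⁻¹ (η x)
    refine ⟨(rapid_inner hwr (isReduced_Pu hinv h.pot h.mem hm).tame).integrable,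
      (rapid_inner hξr hη.settled.1).integrable, ?_⟩
    have h1 := hskew m hm
    rw [hPw] at h1
    have h2 : ∀ x, ⟪ξ x, η x⟫_ℝ = -⟪Ja U a v x, m x⟫_ℝ := fun x => by
      rw [← inner_Ja hinv, hJm]
      exact (hinv (g x)⁻¹ (ξ x) (η x)).symm
    simp only [h2]
    rw [integral_neg, h1, neg_neg]
  · rw [h.development_eq hinv]
    intro m hm
    exact hskew m (isReduced_of_rapid (rapidDecay_iff.1 hm.1) hm.2)
  · have hζd := h.hasDevDeriv hinv hζ
    rw [h.development_eq hinv, Jk_three hinv hw.mem hv.mem hPw]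
    simpa only [Ad_inv_Ad] using hζd

/-- Ferapontov's operator is `P_u` read in the frame; in particular it does not depend on the
parallel normal frame. -/
theorem IsCurve.ferapontov_eq {a : E} {γ u ξ : ℝ → E} {g : ℝ → U} (hγ : IsCurve U a γ)
    (h : IsFrame U a γ u g) (hξ : IsTangentField U γ ξ) {m : ℕ} {e : Fin m → E → E}
    (he : IsParallelNormalFrame U a e) : ferapontov U e γ ξ =
      fun x => Ad U (g x) (Pu U a u (fun x => Ad U (g x)⁻¹ (ξ x)) x) := by
  ext x
  rw [← h.ferapontov_eq hinv hγ.orbit (h.isReduced hinv hξ) he]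
  simp only [Ad_Ad_inv]

/-- Ferapontov's operator, in any parallel orthonormal normal frame field, is the pulled-back
operator `Φ^*(J_3)`. -/
theorem isPullbackOperator_ferapontov {a : E} {m : ℕ} {e : Fin m → E → E}
    (he : IsParallelNormalFrame U a e) : IsPullbackOperator U 3 a (ferapontov U e) where
  maps γ ξ hγ hξ := by
    obtain ⟨u, g, h⟩ := hγ.exists_frame hinv
    rw [hγ.ferapontov_eq hinv h hξ he]
    exact h.isTangentField hinv hγ (isReduced_Pu hinv h.pot h.mem (h.isReduced hinv hξ))
  pullback γ ξ ζ hγ hp := by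
    obtain ⟨u, g, h⟩ := hγ.exists_frame hinv
    rw [hγ.ferapontov_eq hinv h hp.1 he, h.eq_of_isPullbackPair hinv hγ hp]
  causal γ ξ γ' ξ' hγ hξ hγ' hξ' x hx :=
    ferapontov_congr e (hγ.orbit.smooth.differentiable (by simp))
      (hγ'.orbit.smooth.differentiable (by simp)) (hξ.smooth.differentiable (by simp))
      (hξ'.smooth.differentiable (by simp)) hx

omit hinv in
theorem IsCurve.turnBack {a : E} {γ : ℝ → E} (hγ : IsCurve U a γ) (x₀ : ℝ) :
    IsCurve U a fun x => γ (turnBack x₀ x) where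
  orbit := ⟨hγ.orbit.smooth.comp (contDiff_turnBack x₀), fun x => hγ.orbit.mem _, fun x => by
    rw [(hasDerivAt_comp_turnBack (hγ.orbit.smooth.differentiable (by simp)) x₀ x).deriv]
    exact Submodule.smul_mem _ _ (hγ.orbit.tangent _)⟩
  tendsto := (tendsto_comp_turnBack x₀ hγ.tendsto).1
  decay := rapidDecay_iff.2 (rapid_deriv_comp_turnBack hγ.orbit.smooth (rapidDecay_iff.1 hγ.decay) x₀)

/-- On every half-line `(-∞, x₀]`, a curve and a tangent field agree with a curve and a field in
the domain of the pulled-back operator: the curve is run through up to a time after `x₀`, then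
backwards. -/
theorem IsCurve.exists_isPullbackPair {a : E} {γ ξ : ℝ → E} (hγ : IsCurve U a γ)
    (hξ : IsTangentField U γ ξ) (x₀ : ℝ) : ∃ γ' ξ' ζ', IsCurve U a γ' ∧
      IsPullbackPair U 3 a γ' ξ' ζ' ∧ ∀ s ≤ x₀, γ s = γ' s ∧ ξ s = ξ' s := by
  have := FiniteDimensional.complete ℝ E
  have hγ' := hγ.turnBack x₀
  have hξr := rapid_turnBack_smul hξ.smooth (rapidDecay_iff.1 hξ.decay) hξ.tendsto x₀
  have hξ' : IsTangentField U (fun x => γ (AdjointCurves.turnBack x₀ x))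
      fun x => deriv (AdjointCurves.turnBack x₀) x • ξ (AdjointCurves.turnBack x₀ x) :=
    ⟨hξr.smooth, fun x => Submodule.smul_mem _ _ (hξ.tangent _), rapidDecay_iff.2 hξr.deriv,
      hξr.tendsto_atBot⟩
  obtain ⟨u, g, h⟩ := hγ'.exists_frame hinv
  have hR : Rapid fun x => brk U (deriv (AdjointCurves.turnBack x₀) x •
      ξ (AdjointCurves.turnBack x₀ x)) (γ (AdjointCurves.turnBack x₀ x)) :=
    rapid_brk hξr (hγ'.tame hinv)
  have hQd := fun x => hasDerivAt_integral_Iic hR.smooth.continuous (b := 0) hR.integrable.integrableOn x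
  have hQbot := tendsto_integral_Iic_atBot (b := 0) hR.integrable.integrableOn
  -- on the way back the integral of `[ξ, γ]` undoes itself, so it vanishes at both ends
  have hQtop := tendsto_atTop_of_hasDerivAt_turnBack (f := fun y => brk U (ξ y) (γ y)) (x₀ := x₀)
    (by simpa using ((adL U).continuous.comp hξ.smooth.continuous).clm_apply hγ.orbit.smooth.continuous)
    (fun x => by simpa only [brk_smul_left] using hQd x) hQbot
  refine ⟨_, _, _, hγ', h.isPullbackPair hinv hγ' hξ' hξr (Rapid.of_deriv
    (fun x => (hQd x).differentiableAt) ?_ hQbot hQtop) hQd, fun s hs => ?_⟩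
  · rwa [show deriv _ = _ from funext fun x => (hQd x).deriv]
  · simp only [turnBack_of_le hs, deriv_turnBack_of_le hs, one_smul, and_self]

/-- The pulled-back operator is unique on the curve space. -/
theorem IsPullbackOperator.unique {a : E} {Λ Λ' : (ℝ → E) → (ℝ → E) → ℝ → E}
    (h : IsPullbackOperator U 3 a Λ) (h' : IsPullbackOperator U 3 a Λ') {γ ξ : ℝ → E}
    (hγ : IsCurve U a γ) (hξ : IsTangentField U γ ξ) : Λ γ ξ = Λ' γ ξ := by
  ext x
  obtain ⟨γ', ξ', ζ', hγ', hp, hx⟩ := hγ.exists_isPullbackPair hinv hξ x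
  rw [h.causal γ ξ γ' ξ' hγ hξ hγ' hp.1 x hx, h'.causal γ ξ γ' ξ' hγ hξ hγ' hp.1 x hx,
    h.pullback γ' ξ' ζ' hγ' hp, h'.pullback γ' ξ' ζ' hγ' hp]

end PulledBackOperator

end

end AdjointCurves

/-! ### The operator `Φ^*(J_3)` -/

theorem theorem2p3
    {E : Type*} [NormedAddCommGroup E] [InnerProductSpace ℝ E] [FiniteDimensional ℝ E]
    {U : Type*} [TopologicalSpace U] [T2Space U] [CompactSpace U] [ChartedSpace E U] [Group U]
    [LieGroup 𝓘(ℝ, E) ∞ U]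
    (hinv : ∀ (g : U) (X Y : E),
      ⟪AdjointCurves.Ad U g X, AdjointCurves.Ad U g Y⟫_ℝ = ⟪X, Y⟫_ℝ)
    (T : Submodule ℝ E) (hT : AdjointCurves.IsMaximalAbelian U T)
    {k : ℕ} (A : OrthonormalBasis (Fin (k + 1)) ℝ T)
    (a : E) (ha : a = (A 0 : E)) (hreg : AdjointCurves.IsRegular U a) :
    -- the fields `â_i` are well defined and form a parallel orthonormal normal frame of `M_a`
    (∀ i (g : U), AdjointCurves.hatField U a (A i : E) (AdjointCurves.Ad U g a) =
      AdjointCurves.Ad U g (A i : E)) ∧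
    AdjointCurves.IsParallelNormalFrame U a
      (fun i => AdjointCurves.hatField U a (A i : E)) ∧
    -- the operator `Φ^*(J_3)` exists
    (∃ Λ, AdjointCurves.IsPullbackOperator U 3 a Λ) ∧
    ∀ Λ, AdjointCurves.IsPullbackOperator U 3 a Λ →
      ∀ γ, AdjointCurves.IsCurve U a γ → ∀ ξ, AdjointCurves.IsTangentField U γ ξ →
        -- the geometric formula
        (∀ i x, IntegrableOn (fun s => ⟪AdjointCurves.secondFF U (γ s) (ξ s) (deriv γ s),
          AdjointCurves.hatField U a (A i : E) (γ s)⟫_ℝ) (Iic x)) ∧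
        (∀ h : Fin (k + 1) → ℝ → ℝ,
          (∀ i x, h i x = -∫ s in Iic x, ⟪AdjointCurves.secondFF U (γ s) (ξ s) (deriv γ s),
            AdjointCurves.hatField U a (A i : E) (γ s)⟫_ℝ) →
          ∀ x, Λ γ ξ x = AdjointCurves.covDeriv U γ ξ x -
            ∑ i, h i x • AdjointCurves.shapeOp U (γ x)
              (AdjointCurves.hatField U a (A i : E) (γ x)) (deriv γ x)) ∧
        -- `Λ` is Ferapontov's operator, in every parallel orthonormal normal frame
        (∀ (m : ℕ) (e : Fin m → E → E), AdjointCurves.IsParallelNormalFrame U a e →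
          ∀ x, Λ γ ξ x = AdjointCurves.ferapontov U e γ ξ x) ∧
        -- `Λ` is the Dirac reduction of `d/dx`
        (∃! η, AdjointCurves.IsDiracCorrection U γ ξ η) ∧
        ∀ η, AdjointCurves.IsDiracCorrection U γ ξ η →
          ∀ x, Λ γ ξ x = deriv (fun s => ξ s + η s) x := by
  have haT : a ∈ T := ha ▸ (A 0).2
  have hiso : AdjointCurves.isotropy U a = T := hreg.isotropy_eq hinv hT haT
  have hAo : Orthonormal ℝ fun i => (A i : E) := A.orthonormal.comp_linearIsometry T.subtypeₗᵢ
  have hAs : Submodule.span ℝ (Set.range fun i => (A i : E)) = AdjointCurves.isotropy U a := by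
    have h1 : (Set.range fun i => (A i : E)) = T.subtype '' Set.range A := by
      rw [← Set.range_comp]; rfl
    rw [hiso, h1, Submodule.span_image, ← A.coe_toBasis, A.toBasis.span_eq, Submodule.map_subtype_top]
  have hAm : ∀ i, (A i : E) ∈ AdjointCurves.isotropy U a := fun i => hiso ▸ (A i).2
  have hframe := hreg.isParallelNormalFrame_hatField hinv hAo hAs
  have hop := AdjointCurves.isPullbackOperator_ferapontov hinv hframe
  refine ⟨fun i g => hreg.hatField_Ad hinv (hAm i) g, hframe, ⟨_, hop⟩, ?_⟩
  intro Λ hΛ γ hγ ξ hξ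
  rw [hΛ.unique hinv hop hγ hξ]
  obtain ⟨u, g, h⟩ := hγ.exists_frame hinv
  have hv := h.isReduced hinv hξ
  have hξv : (fun x => AdjointCurves.Ad U (g x) (AdjointCurves.Ad U (g x)⁻¹ (ξ x))) = ξ :=
    funext fun x => AdjointCurves.Ad_Ad_inv _ _
  have hdirac := fun η => h.isDiracCorrection_iff hinv hγ hv (η := η)
  rw [hξv] at hdirac
  refine ⟨fun i x => ?_, fun _ hc x => ?_, fun m e he x => ?_, ?_, fun η hη x => ?_⟩
  · have h1 := fun s => h.inner_secondFF hinv hv (A i : E) s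
    simp only [AdjointCurves.Ad_Ad_inv, ← hreg.hatField_Ad hinv (hAm i), ← h.lift] at h1
    simp only [h1]
    exact (AdjointCurves.rapid_inner_projZero h.pot hv.tame (A i : E)).integrable.integrableOn
  · simp only [AdjointCurves.ferapontov, hc, neg_smul, Finset.sum_neg_distrib, sub_neg_eq_add]
  · rw [hγ.ferapontov_eq hinv h hξ hframe, hγ.ferapontov_eq hinv h hξ he]
  · exact ⟨_, (hdirac _).2 rfl, fun η hη => (hdirac η).1 hη⟩
  · rw [hγ.ferapontov_eq hinv h hξ hframe, (hdirac η).1 hη]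
    have h1 := (h.hasDerivAt_add_nonlocal hv x).deriv
    simp only [map_add, AdjointCurves.Ad_Ad_inv] at h1
    exact h1.symm
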